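/- Let $n\ge 2$, $\tau\in\mathbb C$ with $\operatorname{Im}\tau>0$, and let $\theta(u)=\sum_{\mu\in\frac12+\mathbb Z}\exp 2\pi i\left(\mu(u+\tfrac12)+\tfrac{\mu^2}{2}\tau\right)$ be the Jacobi theta function, $\theta^{(k)}$ its $k$-th derivative. Let the variable $\lambda$ range either over $\mathbb C^n$, with $e_i=\epsilon_i$ the standard basis vectors, or over the weight space $\{\lambda\in\mathbb C^n:\sum_i\lambda_i=0\}$ of $sl_n$, with $e_i=\epsilon_i-\frac1n\sum_k\epsilon_k$. Let $(T_i^\hbar f)(\lambda)=f(\lambda+\hbar e_i)$, let $\partial_i$ be the derivative in the direction $e_i$, $\partial^J=\prod_{j\in J}\partial_j$, and $\Delta(\lambda)=\prod_{i<j}\theta(\lambda_i-\lambda_j)$. For $c,\hbar\in\mathbb C$ and $u\in\mathbb C\setminus(\mathbb Z+\mathbb Z\tau)$ let $\tilde L_\hbar(c|u)$ be the $n\times n$ matrix of difference operators $$\tilde L_\hbar(c|u)^i_j=\frac{\theta(\frac{c\hbar}{n}+u+\lambda_j-\lambda_i)}{\theta(u)}\prod_{k\ne j}\frac{\theta(\frac{c\hbar}{n}+\lambda_k-\lambda_i)}{\theta(\lambda_k-\lambda_j)}\;T_i^\hbar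 ,$$ and let $:\det[\,\cdot\,]:$ be the normally ordered determinant (all shifts and derivatives are put to the right of all functions of $\lambda$). All operators act on functions that are holomorphic on an open set, and identities hold at the points of that set with $\lambda_i-\lambda_j\notin\mathbb Z+\mathbb Z\tau$ for $i\ne j$. Then: 1. $\tilde L_\hbar(c|u)$ is differentiable in $\hbar$ at $\hbar=0$. Its derivative $\tilde L'_0(c|u)$ is the matrix of differential operators whose entry $(i,j)$ is the derivative at $\hbar=0$ of the coefficient of $T_i^\hbar$ above, plus $\delta_{ij}\partial_i$. For every $t\in\mathbb C$, $$\lim_{\hbar\to0}:\det\left[\frac{\tilde L_\hbar(c|u)-(1+\hbar t)}{\hbar}\right]:\;=\;:\det[\tilde L'_0(c|u)-t]:\;=\;\sum_{d=0}^n(-t)^{n-d}D_d(c|u),$$ where the differential operators $D_d(c|u)$ are defined by the last equality. 2. $[D_d(c|u),D_{d'}(c|v)]=0$ for all $0\le d,d'\le n$ and all $u,v\notin\mathbb Z+\mathbb Z\tau$. 3. If $c\ne0$, then for $0\le d\le n$, with $(-\frac nc\partial)^J=\prod_{j\in J}(-\frac nc\partial_j)$ and $I,I'\subset\{1,\dots,n\}$,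 $$D_d(c|u)=\left(-\frac cn\right)^{d}\sum_{|I|=d}\;\sum_{J'\sqcup J''\subset I}(-1)^{|J'|}\frac{\theta^{(|J'|)}(u)}{\theta(u)}\,\frac{\partial^{J''}\Delta}{\Delta}(\lambda)\left(-\frac nc\partial\right)^{I\setminus(J'\sqcup J'')}$$ $$=\left(-\frac cn\right)^{d}\sum_{k=0}^{d}(-1)^k\binom{n-d+k}{k}\frac{\theta^{(k)}(u)}{\theta(u)}\sum_{|I'|=d-k}\;\sum_{J''\subset I'}\frac{\partial^{J''}\Delta}{\Delta}(\lambda)\left(-\frac nc\partial\right)^{I'\setminus J''}.$$ -/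

import Mathlib

noncomputable section

namespace EllipticCM

/-- The theta series `θ_{m,l}(u, τ) = ∑_{μ ∈ m + lℤ} exp 2πi (μ u + μ² τ / (2l))`. -/
def thetaSeries (m l u τ : ℂ) : ℂ :=
  ∑' k : ℤ, Complex.exp
    (2 * Real.pi * Complex.I * ((m + l * k) * u + (m + l * k) ^ 2 / (2 * l) * τ))

/-- The Jacobi theta function `θ(u) = θ_{1/2,1}(u + 1/2, τ)`; it is odd, and its zeros are
the points of `ℤ + ℤτ`. -/
def theta (τ u : ℂ) : ℂ := thetaSeries (1 / 2) 1 (u + 1 / 2) τ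

/-- The lattice `ℤ + ℤτ`. -/
def lattice (τ : ℂ) : Set ℂ := {z | ∃ a b : ℤ, z = a + b * τ}

/-- The two spaces on which the operators act: functions of `λ ∈ ℂⁿ`, or functions on the
weight space of `sl_n`, realized as the orthogonal complement of `ε₁ + ⋯ + εₙ` in `ℂⁿ`. -/
inductive Realization
  | full
  | weight

/-- The space of the variable `λ`, as a subspace of `ℂⁿ`. -/
def Realization.space (n : ℕ) : Realization → Submodule ℂ (Fin n → ℂ)
  | full => ⊤
  | weight =>
    { carrier := {x | ∑ i, x i = 0}
      zero_mem' := by simp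
      add_mem' := by
        intro a b ha hb
        simp only [Set.mem_ofPred_eq] at ha hb ⊢
        simp [Finset.sum_add_distrib, ha, hb]
      smul_mem' := by
        intro r a ha
        simp only [Set.mem_ofPred_eq] at ha ⊢
        simp [← Finset.mul_sum, ha] }

/-- The direction of the `i`-th shift and of the `i`-th partial derivative: the basis vector
`ε_i` for `ℂⁿ`, and its orthogonal projection `ε_i - (ε₁ + ⋯ + εₙ)/n` for the weight space. -/
def Realization.dir (n : ℕ) : (r : Realization) → Fin n → r.space n
  | full => fun i => ⟨Pi.single i 1, Submodule.mem_top⟩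
  | weight => fun i => ⟨fun k => (Pi.single i 1 : Fin n → ℂ) k - 1 / n, by
      have hn : (n : ℂ) ≠ 0 := by
        have := i.pos
        exact_mod_cast this.ne'
      change ∑ k, ((Pi.single i 1 : Fin n → ℂ) k - 1 / n) = 0
      simp [Finset.sum_sub_distrib, hn]⟩

section Operators

variable {n : ℕ} {S : Submodule ℂ (Fin n → ℂ)}

/-- The shift operator `(T_i^ħ f)(λ) = f(λ + ħ e_i)`. -/
def shift (e : Fin n → S) (h : ℂ) (i : Fin n) (f : S → ℂ) : S → ℂ :=
  fun x => f (x + h • e i)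

/-- The derivative `∂_i f` in the direction `e_i`. -/
def pd (e : Fin n → S) (i : Fin n) (f : S → ℂ) : S → ℂ :=
  fun x => lineDeriv ℂ f x (e i)

/-- The operator monomial `A_1^{m_1} A_2^{m_2} ⋯ A_n^{m_n}`. -/
def opMonomial (A : Fin n → (S → ℂ) → (S → ℂ)) (m : Fin n → ℕ) (f : S → ℂ) : S → ℂ :=
  (List.finRange n).foldr (fun i g => (A i)^[m i] g) f

/-- The operator `A^J = ∏_{j ∈ J} A_j`. -/
def opProd (A : Fin n → (S → ℂ) → (S → ℂ)) (J : Finset (Fin n)) (f : S → ℂ) : S → ℂ :=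
  opMonomial A (fun i => if i ∈ J then 1 else 0) f

/-- Normally ordered expressions: commutative polynomials in the letters `X_1, …, X_n`, which
stand for the shifts or for the derivatives, with functions of `λ` as coefficients. -/
abbrev OpSymbol (S : Submodule ℂ (Fin n → ℂ)) : Type := MvPolynomial (Fin n) (S → ℂ)

/-- The operator `∑_m a_m(λ) A^m` of the expression `∑_m a_m(λ) X^m`: the operators `A_i` are
put to the right of all functions of `λ`. -/
def normalOp (A : Fin n → (S → ℂ) → (S → ℂ)) (p : OpSymbol S) (f : S → ℂ) : S → ℂ :=
  fun x => ∑ m ∈ p.support, MvPolynomial.coeff m p x * opMonomial A m f x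

/-- The normally ordered determinant `:det N:`. -/
def normalDet (A : Fin n → (S → ℂ) → (S → ℂ)) (N : Matrix (Fin n) (Fin n) (OpSymbol S))
    (f : S → ℂ) : S → ℂ :=
  normalOp A N.det f

/-- The coefficient of `T_i^ħ` in the entry `(i, j)` of the matrix `L̃_ħ(c|u)`. -/
def laxCoeff (τ c u h : ℂ) (i j : Fin n) : S → ℂ := fun x =>
  theta τ (c * h / n + u + (x.1 j - x.1 i)) / theta τ u *
    ∏ k ∈ Finset.univ.erase j,
      theta τ (c * h / n + (x.1 k - x.1 i)) / theta τ (x.1 k - x.1 j)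

/-- The matrix `L̃_ħ(c|u)` of difference operators; the letter `X_i` stands for `T_i^ħ`. -/
def lax (S : Submodule ℂ (Fin n → ℂ)) (τ c u h : ℂ) :
    Matrix (Fin n) (Fin n) (OpSymbol S) :=
  Matrix.of fun i j => MvPolynomial.C (laxCoeff τ c u h i j) * MvPolynomial.X i

/-- The matrix `L̃'_0(c|u)`, the `ħ`-derivative of `L̃_ħ(c|u)` at `ħ = 0`, whose entries are
differential operators; the letter `X_i` stands for `∂_i`. -/
def laxDeriv (S : Submodule ℂ (Fin n → ℂ)) (τ c u : ℂ) :
    Matrix (Fin n) (Fin n) (OpSymbol S) :=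
  Matrix.of fun i j =>
    MvPolynomial.C (fun x => deriv (fun h => laxCoeff τ c u h i j x) 0) +
      if i = j then MvPolynomial.X i else 0

/-- The differential operator `D_d(c|u)`, for `0 ≤ d ≤ n`: the coefficient of `(-t)^{n-d}` in
`:det[L̃'_0(c|u) - t]:`, as a polynomial in `t`. -/
def diffOp (e : Fin n → S) (τ c u : ℂ) (d : ℕ) (f : S → ℂ) : S → ℂ :=
  normalOp (pd e)
    ((-1) ^ (n - d) *
      ((laxDeriv S τ c u).map Polynomial.C -
        (Polynomial.X : Polynomial (OpSymbol S)) • 1).det.coeff (n - d)) f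

/-- The function `Δ(λ) = ∏_{i<j} θ(λ_i - λ_j)`. -/
def Delta (S : Submodule ℂ (Fin n → ℂ)) (τ : ℂ) : S → ℂ := fun x =>
  ∏ i, ∏ j ∈ Finset.Ioi i, theta τ (x.1 i - x.1 j)

end Operators

end EllipticCM

end

/-!
The entries of the Lax matrix, as functions of the row variable `λ_i`, are the Lagrange basis of a
space of theta functions of degree `n`, so a minor with shifted rows is a Frobenius determinant.
The normally ordered determinant is thereby a combination of the shifts of the function
`θ(y) Δ(y') f(y'')` along the directions `(c/n, -(c/n) e_i, e_i)`, and in the limit `ħ → 0` the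
operators `D_d` are obtained, up to the factor `θ(u) Δ(λ)`, by differentiating this function along
`d` of these directions. The explicit formulas follow by the Leibniz rule.

They present `D_d(c|u)` as a combination, with coefficients that depend on `u` only, of the elliptic
Calogero–Moser operators. Each of these is the limit of a family of difference operators, obtained
by replacing derivatives with divided differences, and the members of these families are
combinations of Ruijsenaars' operators `∑_I w(|I|) ∏_{i ∈ I, k ∉ I} g(λ_k - λ_i) ∏_{i ∈ I} T_i`
with `g(w) = θ(γ + w) / θ(w)`. The commutativity of the latter is an identity between sums over the
splittings of a finite set: by induction on its size, which takes care of the residues, the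
difference of the two sides is elliptic without poles in each variable, hence constant; but it is
odd under `λ ↦ -λ`, so it is zero.
-/

noncomputable section

namespace EllipticCM

open Complex Filter Topology

section EntireFunctions

theorem exists_eq_const_mul_of_wronskian_eq_zero {f g : ℂ → ℂ} (hf : Differentiable ℂ f)
    (hg : Differentiable ℂ g) (h : ∀ z, deriv f z * g z = f z * deriv g z) {p : ℂ}
    (hp : g p ≠ 0) : ∃ a, ∀ z, f z = a * g z := by
  obtain ⟨ε, hε, hne⟩ :=
    Metric.eventually_nhds_iff_ball.mp (hg.continuous.continuousAt.eventually_ne hp)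
  have hderiv : (Metric.ball p ε).EqOn (deriv fun z => f z / g z) 0 := fun z hz => by
    rw [deriv_fun_div (hf z) (hg z) (hne z hz), h z, sub_self, zero_div, Pi.zero_apply]
  obtain ⟨a, ha⟩ := Metric.isOpen_ball.exists_is_const_of_deriv_eq_zero
    (convex_ball p ε).isPreconnected
    (fun z hz => ((hf z).div (hg z) (hne z hz)).differentiableWithinAt) hderiv
  have hfa : AnalyticOnNhd ℂ f Set.univ := hf.differentiableOn.analyticOnNhd isOpen_univ
  have hga : AnalyticOnNhd ℂ (fun z => a * g z) Set.univ :=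
    (hg.const_mul a).differentiableOn.analyticOnNhd isOpen_univ
  refine ⟨a, congrFun (hfa.eq_of_eventuallyEq hga (z₀ := p) ?_)⟩
  filter_upwards [Metric.ball_mem_nhds p hε] with z hz
  exact (div_eq_iff (hne z hz)).mp (ha z hz)

theorem eventually_ne_zero_nhdsNE {f : ℂ → ℂ} (hf : Differentiable ℂ f) {p : ℂ} (hp : f p ≠ 0)
    (z₀ : ℂ) : ∀ᶠ z in 𝓝[≠] z₀, f z ≠ 0 := by
  have hfa : AnalyticOnNhd ℂ f Set.univ := hf.differentiableOn.analyticOnNhd isOpen_univ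
  refine (hfa z₀ trivial).eventually_eq_zero_or_eventually_ne_zero.resolve_left fun h => hp ?_
  exact congrFun (hfa.eq_of_eventuallyEq (g := fun _ => 0) analyticOnNhd_const h) p

theorem exists_differentiable_tendsto_nhdsNE {f : ℂ → ℂ}
    (hd : ∀ z₀, ∀ᶠ z in 𝓝[≠] z₀, DifferentiableAt ℂ f z)
    (hr : ∀ z₀, Tendsto (fun z => (z - z₀) * f z) (𝓝[≠] z₀) (𝓝 0)) :
    ∃ g, Differentiable ℂ g ∧ ∀ z₀, Tendsto f (𝓝[≠] z₀) (𝓝 (g z₀)) := by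
  have hlo : ∀ z₀, (fun z => f z - f z₀) =o[𝓝[≠] z₀] fun z => (z - z₀)⁻¹ := fun z₀ => by
    refine (Asymptotics.isLittleO_iff_tendsto' ?_).mpr ?_
    · filter_upwards [self_mem_nhdsWithin] with z hz h
      exact absurd (inv_eq_zero.mp h) (sub_ne_zero.mpr hz)
    · have hconst : Tendsto (fun z => (z - z₀) * f z₀) (𝓝[≠] z₀) (𝓝 0) :=
        (Continuous.tendsto' (by fun_prop) z₀ 0 (by simp)).mono_left nhdsWithin_le_nhds
      rw [← sub_zero 0]
      exact ((hr z₀).sub hconst).congr fun z => by rw [div_inv_eq_mul]; ring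
  have hlim : ∀ z₀, Tendsto f (𝓝[≠] z₀) (𝓝 (limUnder (𝓝[≠] z₀) f)) := fun z₀ =>
    tendsto_limUnder_of_differentiable_on_punctured_nhds_of_isLittleO (hd z₀) (hlo z₀)
  refine ⟨fun z₀ => limUnder (𝓝[≠] z₀) f, fun z₀ => ?_, hlim⟩
  have hupdate := differentiableOn_update_limUnder_insert_of_isLittleO
    (s := {z | DifferentiableAt ℂ f z}) (hd z₀)
    (fun z (hz : DifferentiableAt ℂ f z) => hz.differentiableWithinAt) (hlo z₀)
  have hmem : insert z₀ {z | DifferentiableAt ℂ f z} ∈ 𝓝 z₀ := insert_mem_nhds_iff.mpr (hd z₀)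
  refine (hupdate.differentiableAt hmem).congr_of_eventuallyEq ?_
  filter_upwards [hmem] with z hz
  rcases eq_or_ne z z₀ with rfl | hne
  · simp
  · rw [Function.update_of_ne hne]
    have hz' : DifferentiableAt ℂ f z := hz.resolve_left hne
    exact tendsto_nhds_unique (hlim z) (hz'.continuousAt.tendsto.mono_left nhdsWithin_le_nhds)

end EntireFunctions

section EllipticFunctions

theorem exists_eq_add_mul_add_int_add_int_mul {τ : ℂ} (hτ : 0 < τ.im) (z : ℂ) :
    ∃ a b : ℤ, ∃ s ∈ Set.Icc (0 : ℝ) 1, ∃ t ∈ Set.Icc (0 : ℝ) 1,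
      z = (s + t * τ) + (a + b * τ) := by
  set p : ℝ := z.re - z.im / τ.im * τ.re with hp
  set q : ℝ := z.im / τ.im with hq
  refine ⟨⌊p⌋, ⌊q⌋, Int.fract p, ⟨Int.fract_nonneg _, (Int.fract_lt_one _).le⟩, Int.fract q,
    ⟨Int.fract_nonneg _, (Int.fract_lt_one _).le⟩, ?_⟩
  have hfract : ∀ r : ℝ, ((Int.fract r : ℝ) : ℂ) + (⌊r⌋ : ℂ) = r := fun r => by
    exact_mod_cast Int.fract_add_floor r
  have hz : z = p + q * τ := by
    apply Complex.ext
    · simp [hp]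
    · simp [hq, hτ.ne']
  linear_combination hz - hfract p - τ * hfract q

theorem exists_const_of_doubly_periodic {τ : ℂ} (hτ : 0 < τ.im) {F : Type*}
    [NormedAddCommGroup F] [NormedSpace ℂ F] {g : ℂ → F} (hg : Differentiable ℂ g)
    (h₁ : Function.Periodic g 1) (h₂ : Function.Periodic g τ) : ∃ c, ∀ z, g z = c := by
  have hcompact : IsCompact ((fun p : ℝ × ℝ => g (p.1 + p.2 * τ)) ''
      (Set.Icc (0 : ℝ) 1 ×ˢ Set.Icc (0 : ℝ) 1)) :=
    (isCompact_Icc.prod isCompact_Icc).image (hg.continuous.comp (by fun_prop))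
  refine hg.exists_const_forall_eq_of_bounded (hcompact.isBounded.subset ?_)
  rintro _ ⟨z, rfl⟩
  obtain ⟨a, b, s, hs, t, ht, rfl⟩ := exists_eq_add_mul_add_int_add_int_mul hτ z
  have hper : Function.Periodic g (a + b * τ) := by
    simpa using (h₁.int_mul a).add_period (h₂.int_mul b)
  rw [hper]
  exact ⟨(s, t), ⟨hs, ht⟩, rfl⟩

theorem exists_const_of_elliptic {τ : ℂ} (hτ : 0 < τ.im) {f : ℂ → ℂ}
    (h₁ : Function.Periodic f 1) (h₂ : Function.Periodic f τ)
    (hd : ∀ z₀, ∀ᶠ z in 𝓝[≠] z₀, DifferentiableAt ℂ f z)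
    (hr : ∀ z₀, Tendsto (fun z => (z - z₀) * f z) (𝓝[≠] z₀) (𝓝 0)) :
    ∃ c, ∀ z, ContinuousAt f z → f z = c := by
  obtain ⟨g, hg, hlim⟩ := exists_differentiable_tendsto_nhdsNE hd hr
  have hper : ∀ ω : ℂ, Function.Periodic f ω → Function.Periodic g ω := fun ω hω z => by
    refine tendsto_nhds_unique (hlim (z + ω)) ?_
    rw [← map_add_right_nhdsNE, tendsto_map'_iff]
    exact (hlim z).congr fun w => (hω w).symm
  obtain ⟨c, hc⟩ := exists_const_of_doubly_periodic hτ hg (hper 1 h₁) (hper τ h₂)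
  refine ⟨c, fun z hz => ?_⟩
  rw [← hc z]
  exact tendsto_nhds_unique (hz.tendsto.mono_left nhdsWithin_le_nhds) (hlim z)

end EllipticFunctions

section Theta

theorem theta_eq_jacobiTheta₂ (τ u : ℂ) :
    theta τ u = cexp (Real.pi * I * (u + 1 / 2) + Real.pi * I * τ / 4) *
      jacobiTheta₂ (u + 1 / 2 + τ / 2) τ := by
  rw [theta, thetaSeries, jacobiTheta₂, ← tsum_mul_left]
  refine tsum_congr fun k => ?_
  rw [jacobiTheta₂_term, ← Complex.exp_add]
  ring_nf

theorem differentiable_theta {τ : ℂ} (hτ : 0 < τ.im) : Differentiable ℂ (theta τ) := by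
  rw [funext (theta_eq_jacobiTheta₂ τ)]
  have hjacobi : Differentiable ℂ fun z => jacobiTheta₂ z τ := fun z =>
    differentiableAt_jacobiTheta₂_fst z hτ
  exact Differentiable.mul (by fun_prop) (hjacobi.comp (by fun_prop))

theorem theta_add_one (τ u : ℂ) : theta τ (u + 1) = -theta τ u := by
  rw [theta_eq_jacobiTheta₂, theta_eq_jacobiTheta₂,
    show u + 1 + 1 / 2 + τ / 2 = u + 1 / 2 + τ / 2 + 1 by ring, jacobiTheta₂_add_left,
    show (Real.pi * I * (u + 1 + 1 / 2) + Real.pi * I * τ / 4 : ℂ) =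
      (Real.pi * I * (u + 1 / 2) + Real.pi * I * τ / 4) + Real.pi * I by ring,
    Complex.exp_add _ (Real.pi * I), Complex.exp_pi_mul_I]
  ring

theorem theta_add_tau (τ u : ℂ) :
    theta τ (u + τ) = -cexp (-(Real.pi * I * (τ + 2 * u))) * theta τ u := by
  rw [theta_eq_jacobiTheta₂, theta_eq_jacobiTheta₂,
    show u + τ + 1 / 2 + τ / 2 = u + 1 / 2 + τ / 2 + τ by ring, jacobiTheta₂_add_left',
    ← mul_assoc, ← mul_assoc, ← Complex.exp_add]
  congr 1
  rw [← neg_one_mul (cexp _), ← Complex.exp_pi_mul_I, ← Complex.exp_add, ← Complex.exp_add,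
    Complex.exp_eq_exp_iff_exists_int]
  exact ⟨-1, by push_cast; ring⟩

theorem theta_neg (τ u : ℂ) : theta τ (-u) = -theta τ u := by
  rw [theta_eq_jacobiTheta₂, theta_eq_jacobiTheta₂,
    show u + 1 / 2 + τ / 2 = -(-u + 1 / 2 + τ / 2) + τ + 1 by ring, jacobiTheta₂_add_left,
    jacobiTheta₂_add_left', jacobiTheta₂_neg_left, ← mul_assoc, ← Complex.exp_add, ← neg_mul,
    ← neg_one_mul (cexp _), ← Complex.exp_pi_mul_I, ← Complex.exp_add]
  congr 1
  rw [Complex.exp_eq_exp_iff_exists_int]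
  exact ⟨-1, by push_cast; ring⟩

theorem theta_zero (τ : ℂ) : theta τ 0 = 0 :=
  self_eq_neg.mp (by simpa using theta_neg τ 0)

theorem integral_jacobiTheta₂_term (τ : ℂ) (n : ℤ) :
    ∫ x in (0 : ℝ)..1, jacobiTheta₂_term n x τ = if n = 0 then 1 else 0 := by
  unfold jacobiTheta₂_term
  split_ifs with hn
  · simp [hn]
  · have hc : (2 * Real.pi * I * n : ℂ) ≠ 0 := by simp [Real.pi_ne_zero, hn]
    simp only [Complex.exp_add, intervalIntegral.integral_mul_const]
    rw [integral_exp_mul_complex hc,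
      show (2 * Real.pi * I * n * (1 : ℝ) : ℂ) = n * (2 * Real.pi * I) by push_cast; ring,
      Complex.exp_int_mul_two_pi_mul_I]
    simp

theorem integral_jacobiTheta₂ {τ : ℂ} (hτ : 0 < τ.im) :
    ∫ x in (0 : ℝ)..1, jacobiTheta₂ x τ = 1 := by
  have h := intervalIntegral.hasSum_integral_of_dominated_convergence (μ := MeasureTheory.volume)
    (a := 0) (b := 1) (F := fun (n : ℤ) (x : ℝ) => jacobiTheta₂_term n x τ)
    (f := fun x : ℝ => jacobiTheta₂ x τ) (fun n _ => ‖jacobiTheta₂_term n 0 τ‖)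
    (fun n => by
      refine Continuous.aestronglyMeasurable ?_
      unfold jacobiTheta₂_term
      fun_prop)
    (fun n => Eventually.of_forall fun x _ => le_of_eq (by simp [norm_jacobiTheta₂_term]))
    (Eventually.of_forall fun x _ => ((summable_jacobiTheta₂_term_iff 0 τ).mpr hτ).norm)
    (by simp)
    (Eventually.of_forall fun x _ => hasSum_jacobiTheta₂_term x hτ)
  simp only [integral_jacobiTheta₂_term] at h
  exact h.unique (hasSum_ite_eq 0 1)

theorem exists_theta_ne_zero {τ : ℂ} (hτ : 0 < τ.im) : ∃ u, theta τ u ≠ 0 := by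
  by_contra! h
  have hzero : ∀ z, jacobiTheta₂ z τ = 0 := fun z => by
    have hz := h (z - 1 / 2 - τ / 2)
    rw [theta_eq_jacobiTheta₂, show z - 1 / 2 - τ / 2 + 1 / 2 + τ / 2 = z by ring] at hz
    exact (mul_eq_zero.mp hz).resolve_left (Complex.exp_ne_zero _)
  simpa [hzero] using integral_jacobiTheta₂ hτ

theorem eventually_theta_affine_ne_zero {τ : ℂ} (hτ : 0 < τ.im) {a : ℂ} (ha : a ≠ 0) (b z₀ : ℂ) :
    ∀ᶠ z in 𝓝[≠] z₀, theta τ (a * z + b) ≠ 0 := by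
  obtain ⟨u, hu⟩ := exists_theta_ne_zero hτ
  refine eventually_ne_zero_nhdsNE (p := (u - b) / a)
    ((differentiable_theta hτ).comp (by fun_prop : Differentiable ℂ fun z => a * z + b)) ?_ z₀
  rwa [Function.comp_apply, mul_div_cancel₀ _ ha, sub_add_cancel]

theorem exists_theta_mul_theta_ne_zero {τ : ℂ} (hτ : 0 < τ.im) (a : ℂ) :
    ∃ p, theta τ p ≠ 0 ∧ theta τ (p + a) ≠ 0 := by
  simpa using ((eventually_theta_affine_ne_zero hτ one_ne_zero 0 0).and
    (eventually_theta_affine_ne_zero hτ one_ne_zero a 0)).exists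

/-- The even basis vector of the two-dimensional space of theta functions of degree two. -/
def thetaEven (τ x : ℂ) : ℂ := jacobiTheta₂ (2 * x) (2 * τ)

/-- The odd basis vector of the two-dimensional space of theta functions of degree two; even and
odd refer to the summation index `μ`, not to the parity in `x`. -/
def thetaOdd (τ x : ℂ) : ℂ :=
  cexp (2 * Real.pi * I * x + Real.pi * I * τ / 2) * jacobiTheta₂ (2 * x + τ) (2 * τ)

/-- The pairs of integers `(p + q, p - q - 1)` and `(p + q, p - q)`: this is the change of
summation indices in a product `θ(x + y) θ(x - y)`. -/
def intPairEquiv : (ℤ × ℤ) ⊕ (ℤ × ℤ) ≃ ℤ × ℤ :=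
  Equiv.ofBijective
    (Sum.elim (fun p => (p.1 + p.2, p.1 - p.2 - 1)) (fun p => (p.1 + p.2, p.1 - p.2))) <| by
    constructor
    · rintro (⟨a, b⟩ | ⟨a, b⟩) (⟨c, d⟩ | ⟨c, d⟩) h <;>
        simp only [Sum.elim_inl, Sum.elim_inr, Prod.mk.injEq, Sum.inl.injEq, Sum.inr.injEq,
          reduceCtorEq] at h ⊢ <;> omega
    · rintro ⟨k, l⟩
      rcases Int.even_or_odd' (k - l) with ⟨q, hq | hq⟩
      · exact ⟨Sum.inr (l + q, q), by simp only [Sum.elim_inr, Prod.mk.injEq]; omega⟩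
      · exact ⟨Sum.inl (l + q + 1, q), by simp only [Sum.elim_inl, Prod.mk.injEq]; omega⟩

theorem intPairEquiv_inl (p q : ℤ) : intPairEquiv (Sum.inl (p, q)) = (p + q, p - q - 1) := rfl

theorem intPairEquiv_inr (p q : ℤ) : intPairEquiv (Sum.inr (p, q)) = (p + q, p - q) := rfl

theorem hasSum_mul_prod {ι κ : Type*} {f : ι → ℂ} {g : κ → ℂ} {r s : ℂ} (hf : HasSum f r)
    (hg : HasSum g s) : HasSum (fun p : ι × κ => f p.1 * g p.2) (r * s) :=
  hf.mul hg (summable_mul_of_summable_norm hf.summable.norm hg.summable.norm)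

theorem theta_add_mul_theta_sub {τ : ℂ} (hτ : 0 < τ.im) (x y : ℂ) :
    theta τ (x + y) * theta τ (x - y) =
      thetaEven τ x * thetaOdd τ y - thetaOdd τ x * thetaEven τ y := by
  have hτ2 : 0 < (2 * τ).im := by simpa using hτ
  let t : ℂ → ℤ → ℂ := fun u k =>
    cexp (Real.pi * I * (u + 1 / 2) + Real.pi * I * τ / 4) *
      jacobiTheta₂_term k (u + 1 / 2 + τ / 2) τ
  have ht : ∀ u, HasSum (t u) (theta τ u) := fun u => by
    rw [theta_eq_jacobiTheta₂]
    exact (hasSum_jacobiTheta₂_term _ hτ).mul_left _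
  have hE : ∀ u, HasSum (fun k => jacobiTheta₂_term k (2 * u) (2 * τ)) (thetaEven τ u) :=
    fun u => hasSum_jacobiTheta₂_term _ hτ2
  have hO : ∀ u, HasSum (fun k => cexp (2 * Real.pi * I * u + Real.pi * I * τ / 2) *
      jacobiTheta₂_term k (2 * u + τ) (2 * τ)) (thetaOdd τ u) :=
    fun u => (hasSum_jacobiTheta₂_term _ hτ2).mul_left _
  have hsplit : HasSum ((fun p : ℤ × ℤ => t (x + y) p.1 * t (x - y) p.2) ∘ intPairEquiv)
      (thetaEven τ x * thetaOdd τ y + -(thetaOdd τ x * thetaEven τ y)) := by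
    refine HasSum.sum ?_ ?_
    · refine (hasSum_mul_prod (hE x) (hO y)).congr_fun ?_
      rintro ⟨p, q⟩
      simp only [Function.comp_apply, intPairEquiv_inl, t, jacobiTheta₂_term, ← Complex.exp_add]
      rw [Complex.exp_eq_exp_iff_exists_int]
      exact ⟨p, by push_cast; ring⟩
    · refine (hasSum_mul_prod (hO x) (hE y)).neg.congr_fun ?_
      rintro ⟨p, q⟩
      simp only [Function.comp_apply, intPairEquiv_inr, t, jacobiTheta₂_term, ← Complex.exp_add]
      rw [← neg_one_mul (cexp _), ← Complex.exp_pi_mul_I, ← Complex.exp_add,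
        Complex.exp_eq_exp_iff_exists_int]
      exact ⟨p, by push_cast; ring⟩
  rw [sub_eq_add_neg]
  exact (hasSum_mul_prod (ht (x + y)) (ht (x - y))).unique
    (intPairEquiv.hasSum_iff.mp hsplit)

/-- Weierstrass' three-term identity: the Plücker relation for the three `2 × 2` minors of
`theta_add_mul_theta_sub`. -/
theorem theta_three_term {τ : ℂ} (hτ : 0 < τ.im) (x y z w : ℂ) :
    theta τ (x + y) * theta τ (x - y) * (theta τ (z + w) * theta τ (z - w)) +
      theta τ (x + z) * theta τ (x - z) * (theta τ (w + y) * theta τ (w - y)) +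
      theta τ (x + w) * theta τ (x - w) * (theta τ (y + z) * theta τ (y - z)) = 0 := by
  simp only [theta_add_mul_theta_sub hτ]
  ring

theorem differentiable_thetaEven {τ : ℂ} (hτ : 0 < τ.im) : Differentiable ℂ (thetaEven τ) :=
  fun x => (differentiableAt_jacobiTheta₂_fst (2 * x) (by simpa using hτ)).comp x
    (by fun_prop : DifferentiableAt ℂ (fun u : ℂ => 2 * u) x)

theorem differentiable_thetaOdd {τ : ℂ} (hτ : 0 < τ.im) : Differentiable ℂ (thetaOdd τ) := by
  intro x
  have hjacobi := (differentiableAt_jacobiTheta₂_fst (2 * x + τ)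
    (by simpa using hτ : 0 < (2 * τ).im)).comp x
    (by fun_prop : DifferentiableAt ℂ (fun u : ℂ => 2 * u + τ) x)
  exact DifferentiableAt.mul (by fun_prop) hjacobi

theorem wronskian_thetaEven_thetaOdd {τ : ℂ} (hτ : 0 < τ.im) (z : ℂ) :
    deriv (thetaEven τ) z * thetaOdd τ z - thetaEven τ z * deriv (thetaOdd τ) z =
      theta τ (2 * z) * deriv (theta τ) 0 := by
  have hd := differentiable_theta hτ
  have hleft : HasDerivAt (fun x => theta τ (x + z) * theta τ (x - z))
      (deriv (theta τ) (z + z) * theta τ (z - z) + theta τ (z + z) * deriv (theta τ) (z - z)) z :=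
    ((hd _).hasDerivAt.comp_add_const z z).mul ((hd _).hasDerivAt.comp_sub_const z z)
  have hright : HasDerivAt (fun x => theta τ (x + z) * theta τ (x - z))
      (deriv (thetaEven τ) z * thetaOdd τ z - deriv (thetaOdd τ) z * thetaEven τ z) z := by
    simp only [theta_add_mul_theta_sub hτ]
    exact ((differentiable_thetaEven hτ z).hasDerivAt.mul_const _).sub
      ((differentiable_thetaOdd hτ z).hasDerivAt.mul_const _)
  have h := hleft.unique hright
  rw [sub_self, theta_zero, ← two_mul] at h
  linear_combination -h

/-- If `θ'(0) = 0`, then the Wronskian of the two theta functions of degree two vanishes, and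
with it all products `θ(x + y) θ(x - y)`. -/
theorem deriv_theta_zero_ne_zero {τ : ℂ} (hτ : 0 < τ.im) : deriv (theta τ) 0 ≠ 0 := by
  intro h₀
  obtain ⟨u, hu⟩ := exists_theta_ne_zero hτ
  refine mul_ne_zero hu hu ?_
  have hprod := theta_add_mul_theta_sub hτ u 0
  rw [add_zero, sub_zero] at hprod
  rw [hprod]
  by_cases hO : ∃ p, thetaOdd τ p ≠ 0
  · obtain ⟨p, hp⟩ := hO
    obtain ⟨a, ha⟩ := exists_eq_const_mul_of_wronskian_eq_zero (differentiable_thetaEven hτ)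
      (differentiable_thetaOdd hτ)
      (fun z => sub_eq_zero.mp (by rw [wronskian_thetaEven_thetaOdd hτ, h₀, mul_zero])) hp
    rw [ha, ha]
    ring
  · push Not at hO
    simp [hO]

theorem theta_translate_mul_of_theta_eq_zero {τ : ℂ} (hτ : 0 < τ.im) {a : ℂ} (ha : theta τ a = 0)
    (p q s : ℂ) :
    theta τ (a + p) * theta τ (a + q) * (theta τ (p + s) * theta τ (q - s)) =
      theta τ (a + p + s) * theta τ (a + q - s) * (theta τ p * theta τ q) := by
  have h := theta_three_term hτ ((p + q) / 2 + a) ((p + q) / 2) ((p - q) / 2) ((p - q) / 2 + s)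
  rw [show (p + q) / 2 + a - (p + q) / 2 = a by ring, ha,
    show (p + q) / 2 + a + (p - q) / 2 = a + p by ring,
    show (p + q) / 2 + a - (p - q) / 2 = a + q by ring,
    show (p - q) / 2 + s + (p + q) / 2 = p + s by ring,
    show (p - q) / 2 + s - (p + q) / 2 = -(q - s) by ring,
    show (p + q) / 2 + a + ((p - q) / 2 + s) = a + p + s by ring,
    show (p + q) / 2 + a - ((p - q) / 2 + s) = a + q - s by ring,
    show (p + q) / 2 + (p - q) / 2 = p by ring,
    show (p + q) / 2 - (p - q) / 2 = q by ring, theta_neg] at h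
  linear_combination -h

theorem deriv_theta_translate_of_theta_eq_zero {τ : ℂ} (hτ : 0 < τ.im) {a : ℂ}
    (ha : theta τ a = 0) (p q : ℂ) :
    theta τ (a + p) * theta τ (a + q) *
        (deriv (theta τ) p * theta τ q - theta τ p * deriv (theta τ) q) =
      (deriv (theta τ) (a + p) * theta τ (a + q) - theta τ (a + p) * deriv (theta τ) (a + q)) *
        (theta τ p * theta τ q) := by
  have hd := differentiable_theta hτ
  have hprod : ∀ p q, HasDerivAt (fun s => theta τ (p + s) * theta τ (q - s))
      (deriv (theta τ) p * theta τ q - theta τ p * deriv (theta τ) q) 0 := fun p q => by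
    have h : HasDerivAt (fun s => theta τ (p + s) * theta τ (q - s))
        (deriv (theta τ) (p + 0) * theta τ (q - 0) +
          theta τ (p + 0) * -deriv (theta τ) (q - 0)) 0 :=
      ((hd _).hasDerivAt.comp_const_add p 0).mul ((hd _).hasDerivAt.comp_const_sub q 0)
    simpa only [add_zero, sub_zero, mul_neg, ← sub_eq_add_neg] using h
  have hleft := (hprod p q).const_mul (theta τ (a + p) * theta τ (a + q))
  simp only [theta_translate_mul_of_theta_eq_zero hτ ha] at hleft
  exact hleft.unique ((hprod (a + p) (a + q)).mul_const _)

/-- By the preceding identity, `θ(a + p) / θ(p)` has constant logarithmic derivative. -/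
theorem exists_theta_translate_eq_of_theta_eq_zero {τ : ℂ} (hτ : 0 < τ.im) {a : ℂ}
    (ha : theta τ a = 0) : ∃ A B : ℂ, ∀ p, theta τ (a + p) * cexp (B * p) = A * theta τ p := by
  have hd := differentiable_theta hτ
  obtain ⟨q, hq, haq⟩ := exists_theta_mul_theta_ne_zero hτ a
  rw [add_comm] at haq
  set B : ℂ := deriv (theta τ) q / theta τ q - deriv (theta τ) (a + q) / theta τ (a + q) with hB
  have hderiv : ∀ p, HasDerivAt (fun p => theta τ (a + p) * cexp (B * p))
      (deriv (theta τ) (a + p) * cexp (B * p) + theta τ (a + p) * (cexp (B * p) * (B * 1))) p :=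
    fun p => ((hd _).hasDerivAt.comp_const_add a p).mul ((hasDerivAt_id p).const_mul B).cexp
  have hwronskian : ∀ p, deriv (fun p => theta τ (a + p) * cexp (B * p)) p * theta τ p =
      theta τ (a + p) * cexp (B * p) * deriv (theta τ) p := fun p => by
    rw [(hderiv p).deriv]
    have hBq : B * (theta τ (a + q) * theta τ q) =
        deriv (theta τ) q * theta τ (a + q) - deriv (theta τ) (a + q) * theta τ q := by
      rw [hB]
      field_simp
    refine mul_right_cancel₀ (mul_ne_zero haq hq) ?_
    linear_combination -cexp (B * p) * deriv_theta_translate_of_theta_eq_zero hτ ha p q +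
      theta τ (a + p) * theta τ p * cexp (B * p) * hBq
  obtain ⟨A, hA⟩ := exists_eq_const_mul_of_wronskian_eq_zero
    (fun p => (hderiv p).differentiableAt) hd hwronskian hq
  exact ⟨A, B, hA⟩

/-- Comparing the multipliers of `θ(a + p) e^{Bp}` and of `θ(p)` under `p ↦ p + 1` and `p ↦ p + τ`
gives `B ∈ 2πiℤ` and `Bτ - 2πia ∈ 2πiℤ`. -/
theorem theta_ne_zero {τ : ℂ} (hτ : 0 < τ.im) {a : ℂ} (ha : a ∉ lattice τ) : theta τ a ≠ 0 := by
  intro h₀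
  obtain ⟨A, B, hAB⟩ := exists_theta_translate_eq_of_theta_eq_zero hτ h₀
  obtain ⟨q, -, haq⟩ := exists_theta_mul_theta_ne_zero hτ a
  rw [add_comm] at haq
  have hE := mul_ne_zero haq (Complex.exp_ne_zero (B * q))
  have hone : cexp B = 1 := by
    have h := hAB (q + 1)
    rw [← add_assoc, theta_add_one, theta_add_one, mul_add B, mul_one, Complex.exp_add] at h
    refine mul_left_cancel₀ hE ?_
    linear_combination -h - hAB q
  have htau : cexp (B * τ + -(2 * Real.pi * I * a)) = 1 := by
    have h := hAB (q + τ)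
    rw [← add_assoc, theta_add_tau, theta_add_tau, mul_add B, Complex.exp_add,
      show -(Real.pi * I * (τ + 2 * (a + q))) =
        -(Real.pi * I * (τ + 2 * q)) + -(2 * Real.pi * I * a) by ring, Complex.exp_add] at h
    rw [Complex.exp_add]
    refine mul_left_cancel₀
      (mul_ne_zero hE (Complex.exp_ne_zero (-(Real.pi * I * (τ + 2 * q))))) ?_
    linear_combination -h - cexp (-(Real.pi * I * (τ + 2 * q))) * hAB q
  obtain ⟨k, hk⟩ := Complex.exp_eq_one_iff.mp hone
  obtain ⟨m, hm⟩ := Complex.exp_eq_one_iff.mp htau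
  refine ha ⟨-m, k, mul_left_cancel₀ Complex.two_pi_I_ne_zero ?_⟩
  push_cast
  linear_combination -hm + τ * hk

end Theta

/-! ### The symmetry of the sums over splittings -/

theorem tendsto_sub_const_nhdsNE (z₀ : ℂ) : Tendsto (fun z => z - z₀) (𝓝[≠] z₀) (𝓝[≠] 0) := by
  simpa using ((hasDerivAt_id z₀).sub_const z₀).tendsto_nhdsNE one_ne_zero

theorem tendsto_sub_mul_of_continuousAt {F : ℂ → ℂ} {z₀ : ℂ} (hF : ContinuousAt F z₀) :
    Tendsto (fun z => (z - z₀) * F z) (𝓝[≠] z₀) (𝓝 0) := by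
  have h := ((continuous_sub_right z₀).tendsto' z₀ 0 (sub_self z₀)).mul hF.tendsto
  rw [zero_mul] at h
  exact tendsto_nhdsWithin_of_tendsto_nhds h

theorem tendsto_sub_mul_of_periodic {F : ℂ → ℂ} {ω z₀ L : ℂ} (hF : Function.Periodic F ω)
    (h : Tendsto (fun z => (z - z₀) * F z) (𝓝[≠] z₀) (𝓝 L)) :
    Tendsto (fun z => (z - (z₀ + ω)) * F z) (𝓝[≠] (z₀ + ω)) (𝓝 L) := by
  rw [← map_add_right_nhdsNE, tendsto_map'_iff]
  exact h.congr fun z => by simp only [Function.comp_apply, hF z, add_sub_add_right_eq_sub]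

theorem periodic_comp_neg {F : ℂ → ℂ} {ω : ℂ} (hF : Function.Periodic F ω) :
    Function.Periodic (fun z => F (-z)) ω := fun z => by
  simp only [neg_add, ← sub_eq_add_neg, hF.sub_eq]

/-- Elliptic functions symmetric about `h / 2`, with simple poles at `0` and `h`. -/
structure IsSplitKernel (τ h ρ : ℂ) (G : ℂ → ℂ) : Prop where
  periodic_one : Function.Periodic G 1
  periodic_tau : Function.Periodic G τ
  sub_left : ∀ w, G (h - w) = G w
  differentiableAt : ∀ {w}, theta τ w ≠ 0 → theta τ (w - h) ≠ 0 → DifferentiableAt ℂ G w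
  residue : Tendsto (fun w => w * G w) (𝓝[≠] 0) (𝓝 ρ)

/-- No two of the points `λ_i`, for `i ∈ s`, differ by a lattice point plus `e h`, where
`|e| ≤ 2`. For `|e| ≤ 1` this keeps `λ` off the poles of `splitSum`; the bound `2` keeps the poles
in one variable apart. -/
def IsGeneric {ι : Type*} (τ h : ℂ) (s : Finset ι) (l : ι → ℂ) : Prop :=
  ∀ i ∈ s, ∀ j ∈ s, i ≠ j → ∀ e ∈ Finset.Icc (-2 : ℤ) 2, theta τ (l i - l j - e * h) ≠ 0

namespace IsSplitKernel

variable {τ h ρ : ℂ} {G : ℂ → ℂ}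

theorem comp_neg (hG : IsSplitKernel τ h ρ G) :
    IsSplitKernel τ (-h) (-ρ) (fun z => G (-z)) where
  periodic_one := periodic_comp_neg hG.periodic_one
  periodic_tau := periodic_comp_neg hG.periodic_tau
  sub_left z := by rw [← hG.sub_left, neg_sub, sub_neg_eq_add, sub_add_cancel_right]
  differentiableAt {z} h₀ h₁ := by
    refine (hG.differentiableAt (w := -z) ?_ ?_).comp z (by fun_prop)
    · rwa [theta_neg, neg_ne_zero]
    · rwa [← neg_add', theta_neg, neg_ne_zero, ← sub_neg_eq_add]
  residue := by
    have hneg : Tendsto (fun z : ℂ => -z) (𝓝[≠] 0) (𝓝[≠] 0) := by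
      simpa using (hasDerivAt_neg (0 : ℂ)).tendsto_nhdsNE (neg_ne_zero.mpr one_ne_zero)
    exact (hG.residue.comp hneg).neg.congr fun z => by simp

theorem tendsto_sub_mul_sub (hG : IsSplitKernel τ h ρ G) (y : ℂ) :
    Tendsto (fun z => (z - y) * G (z - y)) (𝓝[≠] y) (𝓝 ρ) :=
  hG.residue.comp (tendsto_sub_const_nhdsNE y)

theorem tendsto_sub_mul_const_sub (hG : IsSplitKernel τ h ρ G) (y : ℂ) :
    Tendsto (fun z => (z - y) * G (y - z)) (𝓝[≠] y) (𝓝 (-ρ)) := by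
  simpa only [neg_sub] using hG.comp_neg.tendsto_sub_mul_sub y

theorem continuousAt_neg (hG : IsSplitKernel τ h ρ G) (hh : theta τ h ≠ 0)
    (hh2 : theta τ (2 * h) ≠ 0) : ContinuousAt G (-h) := by
  refine (hG.differentiableAt ?_ ?_).continuousAt
  · rwa [theta_neg, neg_ne_zero]
  · rwa [← neg_add', ← two_mul, theta_neg, neg_ne_zero]

theorem continuousAt_of_isGeneric (hG : IsSplitKernel τ h ρ G) {ι : Type*}
    {s : Finset ι} {l : ι → ℂ} (hl : IsGeneric τ h s l) {i j : ι} (hi : i ∈ s) (hj : j ∈ s)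
    (hij : i ≠ j) {e : ℤ} (he : e ∈ Finset.Icc (-1) 1) :
    ContinuousAt G (l i - (l j + e * h)) ∧ ContinuousAt G (l j + e * h - l i) := by
  have hne (m : ℤ) (hm : m ∈ Finset.Icc (-2) 2) := hl i hi j hj hij m hm
  rw [Finset.mem_Icc] at he
  refine ⟨(hG.differentiableAt ?_ ?_).continuousAt, (hG.differentiableAt ?_ ?_).continuousAt⟩
  · simpa only [sub_sub] using hne e (Finset.mem_Icc.mpr ⟨by lia, by lia⟩)
  · convert hne (e + 1) (Finset.mem_Icc.mpr ⟨by lia, by lia⟩) using 2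
    push_cast
    ring
  · rw [← neg_sub, theta_neg, neg_ne_zero]
    simpa only [sub_sub] using hne e (Finset.mem_Icc.mpr ⟨by lia, by lia⟩)
  · rw [← neg_ne_zero, ← theta_neg]
    convert hne (e - 1) (Finset.mem_Icc.mpr ⟨by lia, by lia⟩) using 2
    push_cast
    ring

end IsSplitKernel

section SplitSum

variable {ι : Type*} [DecidableEq ι]

/-- The sum `∑_{P ⊆ s} w(|P|) ∏_{i ∈ P, k ∈ s \ P} G(λ_k - λ_i)` over the splittings of `s` into
two parts; the coefficients of products of the commuting difference operators have this form. -/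
def splitSum (G : ℂ → ℂ) (w : ℕ → ℂ) (s : Finset ι) (l : ι → ℂ) : ℂ :=
  ∑ P ∈ s.powerset, w P.card * ∏ i ∈ P, ∏ k ∈ s \ P, G (l k - l i)

/-- The difference of `splitSum` for the kernels `G(z)` and `G(-z)`. It is shown to vanish by
Liouville's theorem in each of the variables. -/
def splitDiff (G : ℂ → ℂ) (w : ℕ → ℂ) (s : Finset ι) (l : ι → ℂ) : ℂ :=
  splitSum G w s l - splitSum (fun z => G (-z)) w s l

theorem splitSum_neg (G : ℂ → ℂ) (w : ℕ → ℂ) (s : Finset ι) (l : ι → ℂ) :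
    splitSum G w s (-l) = splitSum (fun z => G (-z)) w s l := by
  simp only [splitSum, Pi.neg_apply, neg_sub, neg_sub_neg]

theorem splitDiff_neg (G : ℂ → ℂ) (w : ℕ → ℂ) (s : Finset ι) (l : ι → ℂ) :
    splitDiff G w s (-l) = -splitDiff G w s l := by
  simp only [splitDiff, splitSum_neg, neg_neg, neg_sub]

theorem splitSum_compl (G : ℂ → ℂ) (w : ℕ → ℂ) (s : Finset ι) (l : ι → ℂ) :
    splitSum G (fun m => w (s.card - m)) s l = splitSum (fun z => G (-z)) w s l := by
  refine Finset.sum_nbij' (s \ ·) (s \ ·) (by simp) (by simp) ?_ ?_ fun P hP => ?_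
  · exact fun P hP => Finset.sdiff_sdiff_eq_self (Finset.mem_powerset.mp hP)
  · exact fun P hP => Finset.sdiff_sdiff_eq_self (Finset.mem_powerset.mp hP)
  · have hPs := Finset.mem_powerset.mp hP
    simp only [Finset.card_sdiff_of_subset hPs, Finset.sdiff_sdiff_eq_self hPs, neg_sub]
    rw [Finset.prod_comm]

theorem splitSum_congr (G : ℂ → ℂ) (w : ℕ → ℂ) {s : Finset ι} {l l' : ι → ℂ}
    (h : ∀ i ∈ s, l i = l' i) : splitSum G w s l = splitSum G w s l' := by
  refine Finset.sum_congr rfl fun P hP => congrArg _ ?_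
  refine Finset.prod_congr rfl fun i hi => Finset.prod_congr rfl fun k hk => ?_
  rw [h i (Finset.mem_powerset.mp hP hi), h k (Finset.mem_sdiff.mp hk).1]

theorem splitSum_update_add {G : ℂ → ℂ} {ω : ℂ} (hG : Function.Periodic G ω) (w : ℕ → ℂ)
    (s : Finset ι) (l : ι → ℂ) (a : ι) :
    Function.Periodic (fun z => splitSum G w s (Function.update l a z)) ω := by
  intro z
  refine Finset.sum_congr rfl fun P _ => congrArg _ ?_
  refine Finset.prod_congr rfl fun i hi => Finset.prod_congr rfl fun k hk => ?_
  have hki : k ≠ i := fun h => (Finset.mem_sdiff.mp hk).2 (h ▸ hi)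
  obtain rfl | hia := eq_or_ne i a
  · simp only [Function.update_self, Function.update_of_ne hki, ← sub_sub, hG.sub_eq]
  obtain rfl | hka := eq_or_ne k a
  · simp only [Function.update_self, Function.update_of_ne hia, add_sub_right_comm, hG _]
  · simp only [Function.update_of_ne hia, Function.update_of_ne hka]

theorem splitDiff_update_add {G : ℂ → ℂ} {ω : ℂ} (hG : Function.Periodic G ω) (w : ℕ → ℂ)
    (s : Finset ι) (l : ι → ℂ) (a : ι) :
    Function.Periodic (fun z => splitDiff G w s (Function.update l a z)) ω :=
  (splitSum_update_add hG w s l a).sub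
    (splitSum_update_add (periodic_comp_neg hG) w s l a)

theorem differentiableAt_splitSum_update {G : ℂ → ℂ} (w : ℕ → ℂ) {s : Finset ι} {l : ι → ℂ}
    {a : ι} {z : ℂ}
    (hG : ∀ k ∈ s.erase a, DifferentiableAt ℂ G (l k - z) ∧ DifferentiableAt ℂ G (z - l k)) :
    DifferentiableAt ℂ (fun z => splitSum G w s (Function.update l a z)) z := by
  refine DifferentiableAt.fun_sum fun P hP => DifferentiableAt.const_mul ?_ _
  refine DifferentiableAt.fun_finsetProd fun i hi => DifferentiableAt.fun_finsetProd fun k hk => ?_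
  have his := Finset.mem_powerset.mp hP hi
  obtain ⟨hks, hkP⟩ := Finset.mem_sdiff.mp hk
  have hki : k ≠ i := fun h => hkP (h ▸ hi)
  obtain rfl | hia := eq_or_ne i a
  · simp only [Function.update_self, Function.update_of_ne hki]
    exact (hG k (Finset.mem_erase.mpr ⟨hki, hks⟩)).1.comp z (by fun_prop)
  obtain rfl | hka := eq_or_ne k a
  · simp only [Function.update_self, Function.update_of_ne hia]
    exact (hG i (Finset.mem_erase.mpr ⟨hia, his⟩)).2.comp z (by fun_prop)
  · simp only [Function.update_of_ne hia, Function.update_of_ne hka, differentiableAt_const]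

theorem splitSum_insert_insert (G : ℂ → ℂ) (w : ℕ → ℂ) {s : Finset ι} {a b : ι}
    (hab : a ≠ b) (ha : a ∉ s) (hb : b ∉ s) (l : ι → ℂ) :
    splitSum G w (insert a (insert b s)) l =
      ∑ P ∈ s.powerset, (∏ i ∈ P, ∏ k ∈ s \ P, G (l k - l i)) *
        (w P.card * ∏ i ∈ P, (G (l a - l i) * G (l b - l i)) +
          w (P.card + 1) *
            (G (l b - l a) * ((∏ k ∈ s \ P, G (l k - l a)) * ∏ i ∈ P, G (l b - l i)) +
              G (l a - l b) * ((∏ k ∈ s \ P, G (l k - l b)) * ∏ i ∈ P, G (l a - l i))) +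
          w (P.card + 2) * ∏ k ∈ s \ P, (G (l k - l a) * G (l k - l b))) := by
  have ha' : a ∉ insert b s := by simp [hab, ha]
  simp only [splitSum, Finset.sum_powerset_insert ha', Finset.sum_powerset_insert hb,
    ← Finset.sum_add_distrib]
  refine Finset.sum_congr rfl fun P hP => ?_
  have hPs := Finset.mem_powerset.mp hP
  have haP : a ∉ P := fun h => ha (hPs h)
  have hbP : b ∉ P := fun h => hb (hPs h)
  have haP' : a ∉ insert b P := by simp [hab, haP]
  have has : a ∉ s \ P := fun h => ha (Finset.mem_sdiff.mp h).1
  have hbs : b ∉ s \ P := fun h => hb (Finset.mem_sdiff.mp h).1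
  have has' : a ∉ insert b (s \ P) := by simp [hab, ha]
  have sdiff_none : insert a (insert b s) \ P = insert a (insert b (s \ P)) := by grind
  have sdiff_b : insert a (insert b s) \ insert b P = insert a (s \ P) := by grind
  have sdiff_a : insert a (insert b s) \ insert a P = insert b (s \ P) := by grind
  have sdiff_both : insert a (insert b s) \ insert a (insert b P) = s \ P := by grind
  rw [sdiff_none, sdiff_b, sdiff_a, sdiff_both]
  simp only [Finset.card_insert_of_notMem haP', Finset.card_insert_of_notMem haP,
    Finset.card_insert_of_notMem hbP, Finset.prod_insert haP', Finset.prod_insert haP,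
    Finset.prod_insert hbP, Finset.prod_insert has, Finset.prod_insert hbs,
    Finset.prod_insert has', Finset.prod_mul_distrib]
  ring

theorem splitSum_update_insert_insert (G : ℂ → ℂ) (w : ℕ → ℂ) {s : Finset ι} {a b : ι}
    (hab : a ≠ b) (ha : a ∉ s) (hb : b ∉ s) (l : ι → ℂ) (z : ℂ) :
    splitSum G w (insert a (insert b s)) (Function.update l a z) =
      ∑ P ∈ s.powerset, (∏ i ∈ P, ∏ k ∈ s \ P, G (l k - l i)) *
        (w P.card * ∏ i ∈ P, (G (z - l i) * G (l b - l i)) +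
          w (P.card + 1) *
            (G (l b - z) * ((∏ k ∈ s \ P, G (l k - z)) * ∏ i ∈ P, G (l b - l i)) +
              G (z - l b) * ((∏ k ∈ s \ P, G (l k - l b)) * ∏ i ∈ P, G (z - l i))) +
          w (P.card + 2) * ∏ k ∈ s \ P, (G (l k - z) * G (l k - l b))) := by
  rw [splitSum_insert_insert G w hab ha hb]
  refine Finset.sum_congr rfl fun P hP => ?_
  have update_P (i) (hi : i ∈ P) : Function.update l a z i = l i :=
    Function.update_of_ne (ne_of_mem_of_not_mem (Finset.mem_powerset.mp hP hi) ha) z l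
  have update_sdiff (k) (hk : k ∈ s \ P) : Function.update l a z k = l k :=
    Function.update_of_ne (ne_of_mem_of_not_mem (Finset.mem_sdiff.mp hk).1 ha) z l
  simp +contextual only [Function.update_self, Function.update_of_ne hab.symm, update_P,
    update_sdiff]

theorem tendsto_sub_mul_splitSum_update (G : ℂ → ℂ) (w : ℕ → ℂ) {s : Finset ι} {a b : ι}
    (hab : a ≠ b) (ha : a ∉ s) (hb : b ∉ s) (l : ι → ℂ) {z₀ r r' : ℂ}
    (hG : ∀ k ∈ s, ContinuousAt G (l k - z₀) ∧ ContinuousAt G (z₀ - l k))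
    (hr : Tendsto (fun z => (z - z₀) * G (l b - z)) (𝓝[≠] z₀) (𝓝 r))
    (hr' : Tendsto (fun z => (z - z₀) * G (z - l b)) (𝓝[≠] z₀) (𝓝 r')) :
    Tendsto (fun z => (z - z₀) * splitSum G w (insert a (insert b s)) (Function.update l a z))
      (𝓝[≠] z₀)
      (𝓝 (∑ P ∈ s.powerset, (∏ i ∈ P, ∏ k ∈ s \ P, G (l k - l i)) *
        (w (P.card + 1) *
            (r * ((∏ k ∈ s \ P, G (l k - z₀)) * ∏ i ∈ P, G (l b - l i)) +
              r' * ((∏ k ∈ s \ P, G (l k - l b)) * ∏ i ∈ P, G (z₀ - l i)))))) := by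
  have hz : Tendsto (fun z : ℂ => z - z₀) (𝓝[≠] z₀) (𝓝 0) :=
    (tendsto_sub_const_nhdsNE z₀).mono_right nhdsWithin_le_nhds
  have hleft (k) (hk : k ∈ s) : Tendsto (fun z => G (l k - z)) (𝓝[≠] z₀) (𝓝 (G (l k - z₀))) :=
    tendsto_nhdsWithin_of_tendsto_nhds
      ((hG k hk).1.comp (f := fun z => l k - z) (by fun_prop))
  have hright (k) (hk : k ∈ s) : Tendsto (fun z => G (z - l k)) (𝓝[≠] z₀) (𝓝 (G (z₀ - l k))) :=
    tendsto_nhdsWithin_of_tendsto_nhds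
      ((hG k hk).2.comp (f := fun z => z - l k) (by fun_prop))
  simp only [splitSum_update_insert_insert G w hab ha hb, Finset.mul_sum]
  refine tendsto_finsetSum _ fun P hP => ?_
  have hP_mem (i) (hi : i ∈ P) : i ∈ s := Finset.mem_powerset.mp hP hi
  have hsdiff (k) (hk : k ∈ s \ P) : k ∈ s := (Finset.mem_sdiff.mp hk).1
  have hnone := hz.mul ((tendsto_finsetProd P fun i hi =>
    (hright i (hP_mem i hi)).mul_const (G (l b - l i))).const_mul (w P.card))
  have hboth := hz.mul ((tendsto_finsetProd (s \ P) fun k hk =>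
    (hleft k (hsdiff k hk)).mul_const (G (l k - l b))).const_mul (w (P.card + 2)))
  have hone := (hr.mul ((tendsto_finsetProd (s \ P) fun k hk =>
    hleft k (hsdiff k hk)).mul_const (∏ i ∈ P, G (l b - l i)))).add (hr'.mul
      ((tendsto_finsetProd P fun i hi =>
        hright i (hP_mem i hi)).const_mul (∏ k ∈ s \ P, G (l k - l b))))
  have hsum := ((hnone.add (hone.const_mul (w (P.card + 1)))).add hboth).const_mul
    (∏ i ∈ P, ∏ k ∈ s \ P, G (l k - l i))
  rw [zero_mul, zero_mul, zero_add, add_zero] at hsum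
  exact hsum.congr fun z => by ring

namespace IsSplitKernel

variable {τ h ρ : ℂ} {G : ℂ → ℂ} {s : Finset ι} {a b : ι} {l : ι → ℂ}

theorem tendsto_sub_mul_splitSum_self (hG : IsSplitKernel τ h ρ G) (w : ℕ → ℂ) (hab : a ≠ b)
    (ha : a ∉ s) (hb : b ∉ s) (hl : IsGeneric τ h (insert b s) l) :
    Tendsto (fun z => (z - l b) * splitSum G w (insert a (insert b s)) (Function.update l a z))
      (𝓝[≠] l b) (𝓝 0) := by
  convert tendsto_sub_mul_splitSum_update G w hab ha hb l (z₀ := l b) (fun k hk => by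
    simpa using hG.continuousAt_of_isGeneric hl (Finset.mem_insert_of_mem hk)
      (Finset.mem_insert_self b s) (ne_of_mem_of_not_mem hk hb) (e := 0) (by simp))
    (hG.tendsto_sub_mul_const_sub (l b)) (hG.tendsto_sub_mul_sub (l b)) using 2
  exact (Finset.sum_eq_zero fun P _ => by ring).symm

theorem tendsto_sub_mul_splitSum_add (hG : IsSplitKernel τ h ρ G) (hh : theta τ h ≠ 0)
    (hh2 : theta τ (2 * h) ≠ 0) (w : ℕ → ℂ) (hab : a ≠ b) (ha : a ∉ s) (hb : b ∉ s)
    (hl : IsGeneric τ h (insert b s) l) :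
    Tendsto
      (fun z => (z - (l b + h)) * splitSum G w (insert a (insert b s)) (Function.update l a z))
      (𝓝[≠] (l b + h))
      (𝓝 (-ρ * (∏ k ∈ s, G (l k - l b)) * splitSum G (fun m => w (m + 1)) s l)) := by
  have hreflect (z : ℂ) : G (l b + h - z) = G (z - l b) := by
    rw [← hG.sub_left]
    congr 1
    ring
  have hregular : ContinuousAt (fun z => G (l b - z)) (l b + h) :=
    ContinuousAt.comp (by simpa using hG.continuousAt_neg hh hh2) (by fun_prop)
  convert tendsto_sub_mul_splitSum_update G w hab ha hb l (z₀ := l b + h) (fun k hk => by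
    simpa using hG.continuousAt_of_isGeneric hl (Finset.mem_insert_of_mem hk)
      (Finset.mem_insert_self b s) (ne_of_mem_of_not_mem hk hb) (e := 1) (by simp))
    (tendsto_sub_mul_of_continuousAt hregular)
    ((hG.tendsto_sub_mul_const_sub (l b + h)).congr fun z => by rw [hreflect]) using 2
  simp only [splitSum, Finset.mul_sum, hreflect]
  refine Finset.sum_congr rfl fun P hP => ?_
  rw [Finset.prod_sdiff (Finset.mem_powerset.mp hP)]
  ring

theorem tendsto_sub_mul_splitSum_sub (hG : IsSplitKernel τ h ρ G) (hh : theta τ h ≠ 0)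
    (hh2 : theta τ (2 * h) ≠ 0) (w : ℕ → ℂ) (hab : a ≠ b) (ha : a ∉ s) (hb : b ∉ s)
    (hl : IsGeneric τ h (insert b s) l) :
    Tendsto
      (fun z => (z - (l b - h)) * splitSum G w (insert a (insert b s)) (Function.update l a z))
      (𝓝[≠] (l b - h))
      (𝓝 (ρ * (∏ k ∈ s, G (l b - l k)) * splitSum G (fun m => w (m + 1)) s l)) := by
  have hreflect (z : ℂ) : G (z - (l b - h)) = G (l b - z) := by
    rw [← hG.sub_left]
    congr 1
    ring
  have hregular : ContinuousAt (fun z => G (z - l b)) (l b - h) :=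
    ContinuousAt.comp (by simpa using hG.continuousAt_neg hh hh2) (by fun_prop)
  convert tendsto_sub_mul_splitSum_update G w hab ha hb l (z₀ := l b - h) (fun k hk => by
    simpa [← sub_eq_add_neg] using hG.continuousAt_of_isGeneric hl (Finset.mem_insert_of_mem hk)
      (Finset.mem_insert_self b s) (ne_of_mem_of_not_mem hk hb) (e := -1) (by simp))
    ((hG.tendsto_sub_mul_sub (l b - h)).congr fun z => by rw [hreflect])
    (tendsto_sub_mul_of_continuousAt hregular) using 2
  simp only [splitSum, Finset.mul_sum, hreflect]
  refine Finset.sum_congr rfl fun P hP => ?_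
  rw [Finset.prod_sdiff (Finset.mem_powerset.mp hP)]
  ring

end IsSplitKernel

end SplitSum

section SplitDiff

theorem IsGeneric.mono {ι : Type*} {τ h : ℂ} {s t : Finset ι} {l : ι → ℂ}
    (hl : IsGeneric τ h s l) (hts : t ⊆ s) : IsGeneric τ h t l :=
  fun i hi j hj => hl i (hts hi) j (hts hj)

theorem IsGeneric.neg {ι : Type*} {τ h : ℂ} {s : Finset ι} {l : ι → ℂ}
    (hl : IsGeneric τ h s l) : IsGeneric τ h s (-l) := fun i hi j hj hij e he => by
  simpa only [Pi.neg_apply, neg_sub_neg] using hl j hj i hi hij.symm e he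

theorem IsGeneric.neg_step {ι : Type*} {τ h : ℂ} {s : Finset ι} {l : ι → ℂ}
    (hl : IsGeneric τ h s l) : IsGeneric τ (-h) s l := fun i hi j hj hij e he => by
  simpa using hl i hi j hj hij (-e) (by rw [Finset.mem_Icc] at he ⊢; lia)

theorem eventually_isGeneric_affine {ι : Type*} {τ : ℂ} (hτ : 0 < τ.im) (h : ℂ) {s : Finset ι}
    {α β : ι → ℂ}
    (hαβ : ∀ i ∈ s, ∀ j ∈ s, i ≠ j → α i = α j →
      ∀ e ∈ Finset.Icc (-2 : ℤ) 2, theta τ (β i - β j - e * h) ≠ 0) :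
    ∀ᶠ y in 𝓝[≠] (0 : ℂ), IsGeneric τ h s (fun i => α i * y + β i) := by
  simp only [IsGeneric, eventually_all_finset, eventually_all]
  intro i hi j hj hij e he
  have hsub (y : ℂ) : α i * y + β i - (α j * y + β j) - e * h =
      (α i - α j) * y + (β i - β j - e * h) := by ring
  simp only [hsub]
  by_cases hα : α i = α j
  · simpa only [hα, sub_self, zero_mul, zero_add] using
      Eventually.of_forall fun _ => hαβ i hi j hj hij hα e he
  · exact eventually_theta_affine_ne_zero hτ (sub_ne_zero.mpr hα) _ 0

variable {ι : Type*} [DecidableEq ι]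

theorem eventually_isGeneric_piecewise {τ : ℂ} (hτ : 0 < τ.im) (h : ℂ) {s : Finset ι}
    {f : ι → ℂ} (hf : Set.InjOn f s) (hf0 : ∀ i, f i ≠ 0) {l : ι → ℂ} (hl : IsGeneric τ h s l)
    (t : Finset ι) :
    ∀ᶠ y in 𝓝[≠] (0 : ℂ), IsGeneric τ h s (t.piecewise (fun i => f i * y) l) := by
  have hline (y : ℂ) : t.piecewise (fun i => f i * y) l =
      fun i => t.piecewise f (0 : ι → ℂ) i * y + t.piecewise (0 : ι → ℂ) l i := by
    funext i
    by_cases hi : i ∈ t <;> simp [hi]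
  simp only [hline]
  refine eventually_isGeneric_affine hτ h fun i hi j hj hij heq => ?_
  have hit : i ∉ t := fun hit => by
    by_cases hjt : j ∈ t
    · exact hij (hf hi hj (by simpa [hit, hjt] using heq))
    · exact hf0 i (by simpa [hit, hjt] using heq)
  have hjt : j ∉ t := fun hjt => hf0 j (by simpa [hit, hjt] using heq.symm)
  simpa [hit, hjt] using hl i hi j hj hij

theorem exists_isGeneric_piecewise {τ : ℂ} (hτ : 0 < τ.im) (h : ℂ) {s : Finset ι}
    {l l' : ι → ℂ} (hl : IsGeneric τ h s l) (hl' : IsGeneric τ h s l') :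
    ∃ ν : ι → ℂ, ∀ t ⊆ s, IsGeneric τ h s (t.piecewise ν l) ∧
      IsGeneric τ h s (t.piecewise ν l') := by
  obtain ⟨f, hf⟩ := Set.countable_iff_exists_injOn.mp s.countable_toSet
  have hf' : Set.InjOn (fun i => (f i + 1 : ℂ)) s := fun i hi j hj hij =>
    hf hi hj (by simpa using hij)
  have hf0 (i : ι) : (f i + 1 : ℂ) ≠ 0 := Nat.cast_add_one_ne_zero (f i)
  have hev : ∀ᶠ y in 𝓝[≠] (0 : ℂ), ∀ t ∈ s.powerset,
      IsGeneric τ h s (t.piecewise (fun i => (f i + 1) * y) l) ∧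
      IsGeneric τ h s (t.piecewise (fun i => (f i + 1) * y) l') :=
    (eventually_all_finset _).mpr fun t _ =>
      (eventually_isGeneric_piecewise hτ h hf' hf0 hl t).and
        (eventually_isGeneric_piecewise hτ h hf' hf0 hl' t)
  obtain ⟨y, hy⟩ := hev.exists
  exact ⟨_, fun t ht => hy t (Finset.mem_powerset.mpr ht)⟩

namespace IsSplitKernel

variable {τ h ρ : ℂ} {G : ℂ → ℂ} {s : Finset ι} {a b : ι} {l : ι → ℂ}

theorem differentiableAt_splitSum_update (hG : IsSplitKernel τ h ρ G) (w : ℕ → ℂ) {z : ℂ}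
    (hz : ∀ k ∈ s.erase a, ∀ e ∈ Finset.Icc (-1 : ℤ) 1, theta τ (z - (l k + e * h)) ≠ 0) :
    DifferentiableAt ℂ (fun z => splitSum G w s (Function.update l a z)) z := by
  refine EllipticCM.differentiableAt_splitSum_update w fun k hk => ?_
  have h₀ := hz k hk 0 (by simp)
  have h₁ := hz k hk 1 (by simp)
  have h₂ := hz k hk (-1) (by simp)
  simp only [Int.cast_zero, Int.cast_one, Int.cast_neg, zero_mul, one_mul, neg_mul, add_zero,
    ← sub_eq_add_neg] at h₀ h₁ h₂
  refine ⟨hG.differentiableAt ?_ ?_, hG.differentiableAt h₀ (by rwa [sub_sub])⟩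
  · rwa [← neg_sub, theta_neg, neg_ne_zero]
  · rwa [sub_right_comm, ← neg_sub, theta_neg, neg_ne_zero]

theorem differentiableAt_splitDiff_update (hG : IsSplitKernel τ h ρ G) (w : ℕ → ℂ) {z : ℂ}
    (hz : ∀ k ∈ s.erase a, ∀ e ∈ Finset.Icc (-1 : ℤ) 1, theta τ (z - (l k + e * h)) ≠ 0) :
    DifferentiableAt ℂ (fun z => splitDiff G w s (Function.update l a z)) z := by
  refine (hG.differentiableAt_splitSum_update w hz).sub
    (hG.comp_neg.differentiableAt_splitSum_update w fun k hk e he => ?_)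
  simpa using hz k hk (-e) (by rw [Finset.mem_Icc] at he ⊢; lia)

theorem tendsto_sub_mul_splitDiff (hG : IsSplitKernel τ h ρ G) (hh : theta τ h ≠ 0)
    (hh2 : theta τ (2 * h) ≠ 0) (w : ℕ → ℂ) (hab : a ≠ b) (ha : a ∉ s) (hb : b ∉ s)
    (hl : IsGeneric τ h (insert b s) l)
    (ih : ∀ w, splitSum G w s l = splitSum (fun z => G (-z)) w s l)
    {e : ℤ} (he : e ∈ Finset.Icc (-1) 1) :
    Tendsto (fun z => (z - (l b + e * h)) *
      splitDiff G w (insert a (insert b s)) (Function.update l a z)) (𝓝[≠] (l b + e * h))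
      (𝓝 0) := by
  have hnh : theta τ (-h) ≠ 0 := by rwa [theta_neg, neg_ne_zero]
  have hnh2 : theta τ (2 * -h) ≠ 0 := by rwa [mul_neg, theta_neg, neg_ne_zero]
  have hl' := hl.neg_step
  simp only [splitDiff, mul_sub]
  obtain rfl | rfl | rfl : e = -1 ∨ e = 0 ∨ e = 1 := by rw [Finset.mem_Icc] at he; lia
  · have hres := hG.tendsto_sub_mul_splitSum_sub hh hh2 w hab ha hb hl
    have hres' := hG.comp_neg.tendsto_sub_mul_splitSum_add hnh hnh2 w hab ha hb hl'
    simp only [neg_neg, neg_sub, ← sub_eq_add_neg, ← ih] at hres'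
    simpa only [Int.cast_neg, Int.cast_one, neg_mul, one_mul, ← sub_eq_add_neg, sub_self]
      using hres.sub hres'
  · have hres := hG.tendsto_sub_mul_splitSum_self w hab ha hb hl
    have hres' := hG.comp_neg.tendsto_sub_mul_splitSum_self w hab ha hb hl'
    simpa only [Int.cast_zero, zero_mul, add_zero, sub_self] using hres.sub hres'
  · have hres := hG.tendsto_sub_mul_splitSum_add hh hh2 w hab ha hb hl
    have hres' := hG.comp_neg.tendsto_sub_mul_splitSum_sub hnh hnh2 w hab ha hb hl'
    simp only [sub_neg_eq_add, neg_sub, ← ih] at hres'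
    simpa only [Int.cast_one, one_mul, sub_self] using hres.sub hres'

theorem tendsto_sub_mul_splitDiff_of_mem_lattice (hG : IsSplitKernel τ h ρ G)
    (hh : theta τ h ≠ 0) (hh2 : theta τ (2 * h) ≠ 0) (w : ℕ → ℂ) (hl : IsGeneric τ h s l)
    (ih : ∀ t ⊂ s, ∀ w, splitSum G w t l = splitSum (fun z => G (-z)) w t l) (ha : a ∈ s)
    (hb : b ∈ s.erase a) {e : ℤ} (he : e ∈ Finset.Icc (-1) 1) {z₀ : ℂ}
    (hz₀ : z₀ - (l b + e * h) ∈ lattice τ) :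
    Tendsto (fun z => (z - z₀) * splitDiff G w s (Function.update l a z)) (𝓝[≠] z₀) (𝓝 0) := by
  obtain ⟨p, q, hpq⟩ := hz₀
  have hz₀ : z₀ = l b + e * h + (p * 1 + q * τ) := by rw [mul_one, ← hpq, add_sub_cancel]
  have hperiod : Function.Periodic (fun z => splitDiff G w s (Function.update l a z))
      (p * 1 + q * τ) :=
    ((splitDiff_update_add hG.periodic_one w s l a).int_mul p).add_period
      ((splitDiff_update_add hG.periodic_tau w s l a).int_mul q)
  have hs : insert a (insert b ((s.erase a).erase b)) = s := by
    rw [Finset.insert_erase hb, Finset.insert_erase ha]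
  have hsub : (s.erase a).erase b ⊂ s :=
    (Finset.erase_subset _ _).trans_ssubset (Finset.erase_ssubset ha)
  rw [hz₀]
  refine tendsto_sub_mul_of_periodic hperiod ?_
  simpa only [hs] using hG.tendsto_sub_mul_splitDiff hh hh2 w (Finset.ne_of_mem_erase hb).symm
    (by simp) (by simp) (hl.mono (by simp [Finset.insert_erase hb, Finset.erase_subset]))
    (ih _ hsub) he

theorem splitDiff_update (hτ : 0 < τ.im) (hG : IsSplitKernel τ h ρ G) (hh : theta τ h ≠ 0)
    (hh2 : theta τ (2 * h) ≠ 0) (w : ℕ → ℂ) (hl : IsGeneric τ h s l)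
    (ih : ∀ t ⊂ s, ∀ w, splitSum G w t l = splitSum (fun z => G (-z)) w t l) (ha : a ∈ s) {z : ℂ}
    (hz : IsGeneric τ h s (Function.update l a z)) :
    splitDiff G w s (Function.update l a z) = splitDiff G w s l := by
  have hregular (z : ℂ) (hz : IsGeneric τ h s (Function.update l a z)) :
      ContinuousAt (fun z => splitDiff G w s (Function.update l a z)) z := by
    refine (hG.differentiableAt_splitDiff_update w fun k hk e he => ?_).continuousAt
    obtain ⟨hka, hks⟩ := Finset.mem_erase.mp hk
    have hak := hz a ha k hks hka.symm e (Finset.Icc_subset_Icc (by simp) (by simp) he)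
    rwa [Function.update_self, Function.update_of_ne hka, sub_sub] at hak
  have hev (z₀ : ℂ) : ∀ᶠ z in 𝓝[≠] z₀,
      DifferentiableAt ℂ (fun z => splitDiff G w s (Function.update l a z)) z := by
    have hne : ∀ᶠ z in 𝓝[≠] z₀, ∀ k ∈ s.erase a, ∀ e ∈ Finset.Icc (-1 : ℤ) 1,
        theta τ (z - (l k + e * h)) ≠ 0 := by
      simp only [eventually_all_finset]
      exact fun k _ e _ => by
        simpa [sub_eq_add_neg] using
          eventually_theta_affine_ne_zero hτ one_ne_zero (-(l k + e * h)) z₀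
    exact hne.mono fun z hz => hG.differentiableAt_splitDiff_update w hz
  have hres (z₀ : ℂ) : Tendsto (fun z => (z - z₀) * splitDiff G w s (Function.update l a z))
      (𝓝[≠] z₀) (𝓝 0) := by
    by_cases hpole : ∀ k ∈ s.erase a, ∀ e ∈ Finset.Icc (-1 : ℤ) 1,
        theta τ (z₀ - (l k + e * h)) ≠ 0
    · exact tendsto_sub_mul_of_continuousAt
        (hG.differentiableAt_splitDiff_update w hpole).continuousAt
    · push Not at hpole
      obtain ⟨b, hb, e, he, hzero⟩ := hpole
      exact hG.tendsto_sub_mul_splitDiff_of_mem_lattice hh hh2 w hl ih ha hb he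
        (by_contra fun hmem => theta_ne_zero hτ hmem hzero)
  obtain ⟨c, hc⟩ := exists_const_of_elliptic hτ (splitDiff_update_add hG.periodic_one w s l a)
    (splitDiff_update_add hG.periodic_tau w s l a) hev hres
  rw [hc z (hregular z hz)]
  simpa using (hc (l a) (hregular (l a) (by simpa using hl))).symm

theorem splitDiff_piecewise (hτ : 0 < τ.im) (hG : IsSplitKernel τ h ρ G) (hh : theta τ h ≠ 0)
    (hh2 : theta τ (2 * h) ≠ 0) (w : ℕ → ℂ)
    (ih : ∀ t ⊂ s, ∀ l, IsGeneric τ h t l → ∀ w,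
      splitSum G w t l = splitSum (fun z => G (-z)) w t l)
    {ν : ι → ℂ} (hl : ∀ t ⊆ s, IsGeneric τ h s (t.piecewise ν l)) :
    ∀ t ⊆ s, splitDiff G w s (t.piecewise ν l) = splitDiff G w s l := by
  intro t
  induction t using Finset.induction_on with
  | empty => exact fun _ => by rw [Finset.piecewise_empty]
  | insert a t _ iht =>
    intro hts
    have ht : t ⊆ s := (Finset.subset_insert a t).trans hts
    have hins := hl _ hts
    rw [Finset.piecewise_insert] at hins ⊢
    rw [← iht ht]
    exact hG.splitDiff_update hτ hh hh2 w (hl t ht)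
      (fun t' ht' => ih t' ht' _ ((hl t ht).mono ht'.1)) (hts (Finset.mem_insert_self a t)) hins

/- `splitDiff` is constant along a path that moves `l` to a generic point `ν`, and then `ν` to
`-l`, one coordinate at a time; on the other hand it is odd. -/
theorem splitSum_comp_neg (hτ : 0 < τ.im) (hG : IsSplitKernel τ h ρ G) (hh : theta τ h ≠ 0)
    (hh2 : theta τ (2 * h) ≠ 0) (s : Finset ι) :
    ∀ l, IsGeneric τ h s l → ∀ w, splitSum (fun z => G (-z)) w s l = splitSum G w s l := by
  induction s using Finset.strongInduction with
  | H s ih =>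
    intro l hl w
    replace ih : ∀ t ⊂ s, ∀ l, IsGeneric τ h t l → ∀ w,
        splitSum G w t l = splitSum (fun z => G (-z)) w t l :=
      fun t ht l hl w => (ih t ht l hl w).symm
    obtain ⟨ν, hν⟩ := exists_isGeneric_piecewise hτ h hl hl.neg
    have hpath := hG.splitDiff_piecewise hτ hh hh2 w ih (fun t ht => (hν t ht).1) s subset_rfl
    have hpath' := hG.splitDiff_piecewise hτ hh hh2 w ih (fun t ht => (hν t ht).2) s subset_rfl
    have hν' : ∀ i ∈ s, s.piecewise ν l i = s.piecewise ν (-l) i := fun i hi => by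
      simp only [Finset.piecewise_eq_of_mem _ _ _ hi]
    have hodd : splitDiff G w s l = -splitDiff G w s l := by
      rw [← splitDiff_neg, ← hpath, ← hpath', splitDiff, splitDiff, splitSum_congr _ _ hν',
        splitSum_congr _ _ hν']
    exact (sub_eq_zero.mp (self_eq_neg.mp hodd)).symm

end IsSplitKernel

end SplitDiff

/-! ### Commuting difference operators -/

/-- The ratio `θ(γ + w) / θ(w)`, out of which the coefficients of the difference operators are
built. -/
def thetaRatio (τ γ w : ℂ) : ℂ := theta τ (γ + w) / theta τ w

section ThetaRatio

variable {τ : ℂ}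

theorem thetaRatio_add_one (τ γ w : ℂ) : thetaRatio τ γ (w + 1) = thetaRatio τ γ w := by
  rw [thetaRatio, ← add_assoc, theta_add_one, theta_add_one, neg_div_neg_eq, thetaRatio]

theorem thetaRatio_add_tau (τ γ w : ℂ) :
    thetaRatio τ γ (w + τ) = cexp (-(2 * Real.pi * I * γ)) * thetaRatio τ γ w := by
  have hexp : cexp (-(Real.pi * I * (τ + 2 * (γ + w)))) =
      cexp (-(2 * Real.pi * I * γ)) * cexp (-(Real.pi * I * (τ + 2 * w))) := by
    rw [← Complex.exp_add]
    ring_nf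
  rw [thetaRatio, ← add_assoc, theta_add_tau, theta_add_tau, hexp, neg_mul, neg_mul,
    neg_div_neg_eq, mul_assoc, mul_div_assoc, mul_div_mul_left _ _ (Complex.exp_ne_zero _),
    thetaRatio]

theorem differentiableAt_thetaRatio (hτ : 0 < τ.im) (γ : ℂ) {w : ℂ} (hw : theta τ w ≠ 0) :
    DifferentiableAt ℂ (thetaRatio τ γ) w :=
  ((differentiable_theta hτ _).comp w (by fun_prop : DifferentiableAt ℂ (γ + ·) w)).div
    (differentiable_theta hτ w) hw

theorem tendsto_mul_thetaRatio (hτ : 0 < τ.im) (γ : ℂ) :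
    Tendsto (fun w => w * thetaRatio τ γ w) (𝓝[≠] 0) (𝓝 (theta τ γ / deriv (theta τ) 0)) := by
  have hslope : Tendsto (fun w => w⁻¹ * theta τ w) (𝓝[≠] 0) (𝓝 (deriv (theta τ) 0)) := by
    simpa [theta_zero] using (differentiable_theta hτ 0).hasDerivAt.tendsto_slope_zero
  have hnum : Tendsto (fun w => theta τ (γ + w)) (𝓝[≠] 0) (𝓝 (theta τ γ)) :=
    ((differentiable_theta hτ).continuous.comp (continuous_const_add γ)).tendsto' 0 _
      (by simp) |>.mono_left nhdsWithin_le_nhds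
  refine (hnum.div hslope (deriv_theta_zero_ne_zero hτ)).congr fun w => ?_
  simp only [Pi.div_apply, thetaRatio, div_eq_mul_inv, mul_inv, inv_inv]
  ring

theorem isSplitKernel_thetaRatio (hτ : 0 < τ.im) (γ : ℂ) {h : ℂ} (hh : theta τ h ≠ 0) :
    IsSplitKernel τ h (theta τ γ / deriv (theta τ) 0 * thetaRatio τ γ h)
      (fun w => thetaRatio τ γ w * thetaRatio τ γ (h - w)) where
  periodic_one w := by
    have hsub := thetaRatio_add_one τ γ (h - (w + 1))
    rw [← sub_sub, sub_add_cancel] at hsub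
    change thetaRatio τ γ (w + 1) * thetaRatio τ γ (h - (w + 1)) = _
    rw [thetaRatio_add_one, ← sub_sub, ← hsub]
  periodic_tau w := by
    have hsub := thetaRatio_add_tau τ γ (h - w - τ)
    rw [sub_add_cancel] at hsub
    change thetaRatio τ γ (w + τ) * thetaRatio τ γ (h - (w + τ)) =
      thetaRatio τ γ w * thetaRatio τ γ (h - w)
    rw [thetaRatio_add_tau, ← sub_sub, hsub]
    ring
  sub_left w := by rw [sub_sub_cancel, mul_comm]
  differentiableAt {w} hw hwh := by
    have hhw : theta τ (h - w) ≠ 0 := by rwa [← neg_sub, theta_neg, neg_ne_zero]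
    exact (differentiableAt_thetaRatio hτ γ hw).mul
      ((differentiableAt_thetaRatio hτ γ hhw).comp w (by fun_prop))
  residue := by
    have hcont : Tendsto (fun w => thetaRatio τ γ (h - w)) (𝓝[≠] 0) (𝓝 (thetaRatio τ γ h)) :=
      tendsto_nhdsWithin_of_tendsto_nhds
        ((differentiableAt_thetaRatio hτ γ hh).continuousAt.tendsto.comp
          ((continuous_sub_left h).tendsto' 0 h (sub_zero h)))
    exact ((tendsto_mul_thetaRatio hτ γ).mul hcont).congr fun w => mul_assoc _ _ _

end ThetaRatio

section Splitting

variable {ι : Type*} [Fintype ι] [DecidableEq ι]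

theorem sum_sum_eq_sum_disjoint_sum_powerset {M : Type*} [AddCommMonoid M]
    (F : Finset ι → Finset ι → M) :
    ∑ I, ∑ J, F I J = ∑ y : Finset ι × Finset ι with Disjoint y.1 y.2,
      ∑ P ∈ y.2.powerset, F (y.1 ∪ P) (y.1 ∪ (y.2 \ P)) := by
  rw [← Fintype.sum_prod_type', Finset.sum_sigma']
  refine Finset.sum_nbij' (fun p => ⟨(p.1 ∩ p.2, (p.1 \ p.2) ∪ (p.2 \ p.1)), p.1 \ p.2⟩)
    (fun q => (q.1.1 ∪ q.2, q.1.1 ∪ (q.1.2 \ q.2))) ?_ ?_ ?_ ?_ ?_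
  · rintro ⟨I, J⟩ -
    simp only [Finset.mem_sigma, Finset.mem_filter_univ, Finset.mem_powerset,
      Finset.disjoint_left]
    grind
  · simp
  · rintro ⟨I, J⟩ -
    rw [Prod.mk.injEq]
    grind
  · rintro ⟨⟨C, K⟩, P⟩ h
    simp only [Finset.mem_sigma, Finset.mem_filter_univ, Finset.mem_powerset,
      Finset.disjoint_left] at h
    simp only [Sigma.mk.injEq, Prod.mk.injEq, heq_eq_eq]
    grind
  · rintro ⟨I, J⟩ -
    congr 1 <;> grind

theorem prod_union_prod_compl_union {M : Type*} [CommMonoid M] {C K P : Finset ι}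
    (hCK : Disjoint C K) (hP : P ⊆ K) (F : ι → ι → M) :
    ∏ i ∈ C ∪ P, ∏ k ∈ (C ∪ P)ᶜ, F i k =
      ((∏ i ∈ C, ∏ k ∈ K \ P, F i k) * ∏ i ∈ C, ∏ k ∈ (C ∪ K)ᶜ, F i k) *
        ((∏ i ∈ P, ∏ k ∈ K \ P, F i k) * ∏ i ∈ P, ∏ k ∈ (C ∪ K)ᶜ, F i k) := by
  have hcompl : (C ∪ P)ᶜ = K \ P ∪ (C ∪ K)ᶜ := by
    rw [Finset.disjoint_left] at hCK
    grind [Finset.mem_compl]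
  have hdisj : Disjoint (K \ P) (C ∪ K)ᶜ :=
    disjoint_compl_right.mono_left (Finset.sdiff_subset.trans Finset.subset_union_right)
  rw [hcompl, Finset.prod_union (hCK.mono_right hP)]
  simp only [Finset.prod_union hdisj, Finset.prod_mul_distrib]

/-- The coefficient `∏_{i ∈ I, k ∉ I} g(λ_k - λ_i)` of the shift `∏_{i ∈ I} T_i`. -/
def shiftCoeff (g : ℂ → ℂ) (I : Finset ι) (l : ι → ℂ) : ℂ :=
  ∏ i ∈ I, ∏ k ∈ Iᶜ, g (l k - l i)

/-- The factor of the product of the coefficients of `∏_{i ∈ I} T_i` and `∏_{i ∈ J} T_i` which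
depends on `C = I ∩ J` and `K = (I ∪ J) \ (I ∩ J)` only. -/
def pairCoeff (g : ℂ → ℂ) (h : ℂ) (C K : Finset ι) (l : ι → ℂ) : ℂ :=
  (∏ i ∈ C, ∏ k ∈ K, g (l k - l i)) *
    (∏ i ∈ C, ∏ k ∈ (C ∪ K)ᶜ, g (l k - l i) * g (l k - l i - h)) *
    ∏ i ∈ K, ∏ k ∈ (C ∪ K)ᶜ, g (l k - l i)

theorem shiftCoeff_union_sdiff (g : ℂ → ℂ) {h : ℂ} {l l' : ι → ℂ} {C K P : Finset ι}
    (hCK : Disjoint C K) (hP : P ⊆ K)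
    (hl' : ∀ i k, l' k - l' i =
      l k - l i + h * ((if k ∈ C ∪ P then 1 else 0) - if i ∈ C ∪ P then 1 else 0)) :
    shiftCoeff g (C ∪ K \ P) l' =
      ((∏ i ∈ C, ∏ k ∈ P, g (l k - l i)) * ∏ i ∈ C, ∏ k ∈ (C ∪ K)ᶜ, g (l k - l i - h)) *
        ((∏ i ∈ P, ∏ k ∈ K \ P, g (h - (l k - l i))) *
          ∏ i ∈ K \ P, ∏ k ∈ (C ∪ K)ᶜ, g (l k - l i)) := by
  have mem_C (i) (hi : i ∈ C) : i ∈ C ∪ P := Finset.mem_union_left P hi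
  have mem_P (i) (hi : i ∈ P) : i ∈ C ∪ P := Finset.mem_union_right C hi
  have notMem_sdiff (i) (hi : i ∈ K \ P) : i ∉ C ∪ P := by
    rw [Finset.disjoint_left] at hCK
    grind
  have notMem_compl (i) (hi : i ∈ (C ∪ K)ᶜ) : i ∉ C ∪ P := fun h =>
    Finset.mem_compl.mp hi (Finset.union_subset_union_right hP h)
  rw [shiftCoeff, prod_union_prod_compl_union hCK Finset.sdiff_subset,
    Finset.sdiff_sdiff_eq_self hP, Finset.prod_comm (s := K \ P)]
  refine congrArg₂ _ (congrArg₂ _ ?_ ?_) (congrArg₂ _ ?_ ?_) <;>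
    refine Finset.prod_congr rfl fun i hi => Finset.prod_congr rfl fun k hk => ?_ <;>
    rw [hl']
  · rw [if_pos (mem_C i hi), if_pos (mem_P k hk), sub_self, mul_zero, add_zero]
  · rw [if_pos (mem_C i hi), if_neg (notMem_compl k hk), zero_sub, mul_neg, mul_one,
      ← sub_eq_add_neg]
  · rw [if_pos (mem_P i hi), if_neg (notMem_sdiff k hk)]
    congr 1
    ring
  · rw [if_neg (notMem_sdiff i hi), if_neg (notMem_compl k hk), sub_self, mul_zero, add_zero]

theorem shiftCoeff_mul_shiftCoeff (g : ℂ → ℂ) {h : ℂ} {l l' : ι → ℂ} {C K P : Finset ι}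
    (hCK : Disjoint C K) (hP : P ⊆ K)
    (hl' : ∀ i k, l' k - l' i =
      l k - l i + h * ((if k ∈ C ∪ P then 1 else 0) - if i ∈ C ∪ P then 1 else 0)) :
    shiftCoeff g (C ∪ P) l * shiftCoeff g (C ∪ K \ P) l' =
      pairCoeff g h C K l *
        ∏ i ∈ P, ∏ k ∈ K \ P, g (l k - l i) * g (h - (l k - l i)) := by
  have hC : ∏ i ∈ C, ∏ k ∈ K, g (l k - l i) =
      (∏ i ∈ C, ∏ k ∈ K \ P, g (l k - l i)) * ∏ i ∈ C, ∏ k ∈ P, g (l k - l i) := by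
    simp only [← Finset.prod_mul_distrib, Finset.prod_sdiff hP]
  have hK := Finset.prod_sdiff (f := fun i => ∏ k ∈ (C ∪ K)ᶜ, g (l k - l i)) hP
  rw [shiftCoeff_union_sdiff g hCK hP hl', shiftCoeff, prod_union_prod_compl_union hCK hP,
    pairCoeff, hC, ← hK]
  simp only [Finset.prod_mul_distrib]
  ring

end Splitting

section Directions

variable {ι : Type*} [DecidableEq ι] {S : Submodule ℂ (ι → ℂ)}

/-- The directions `e_i` have the same differences of coordinates as the standard basis; this is
the common property of the two realizations. -/
def IsDirections (e : ι → S) : Prop :=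
  ∀ i k l, (e i).1 k - (e i).1 l = (if i = k then 1 else 0) - if i = l then 1 else 0

theorem Realization.isDirections_dir {n : ℕ} (r : Realization) : IsDirections (r.dir n) := by
  intro i k l
  cases r <;> simp [Realization.dir, Pi.single_apply, eq_comm]

theorem IsDirections.add_smul_sum {e : ι → S} (he : IsDirections e) (x : S) (h : ℂ)
    (I : Finset ι) (i k : ι) :
    (x + h • ∑ j ∈ I, e j).1 k - (x + h • ∑ j ∈ I, e j).1 i =
      x.1 k - x.1 i + h * ((if k ∈ I then 1 else 0) - if i ∈ I then 1 else 0) := by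
  have hsum : ∑ j ∈ I, (e j).1 k - ∑ j ∈ I, (e j).1 i =
      (if k ∈ I then 1 else 0) - if i ∈ I then 1 else 0 := by
    rw [← Finset.sum_sub_distrib, Finset.sum_congr rfl fun j _ => he j k i,
      Finset.sum_sub_distrib]
    simp
  rw [← hsum]
  simp only [Submodule.coe_add, Submodule.coe_smul, Submodule.coe_sum, Pi.add_apply,
    Pi.smul_apply, Finset.sum_apply, smul_eq_mul]
  ring

variable [Fintype ι]

/-- The difference operator `∑_I w(|I|) ∏_{i ∈ I, k ∉ I} g(λ_k - λ_i) ∏_{i ∈ I} T_i`, with an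
arbitrary weight `w` instead of the restriction to the `I` of a given cardinality. -/
def shiftSum (e : ι → S) (g : ℂ → ℂ) (h : ℂ) (w : ℕ → ℂ) (f : S → ℂ) (x : S) : ℂ :=
  ∑ I : Finset ι, w I.card * shiftCoeff g I x.1 * f (x + h • ∑ i ∈ I, e i)

theorem IsDirections.shiftSum_shiftSum {e : ι → S} (he : IsDirections e) (g : ℂ → ℂ) (h : ℂ)
    (w w' : ℕ → ℂ) (f : S → ℂ) (x : S) :
    shiftSum e g h w (shiftSum e g h w' f) x =
      ∑ y : Finset ι × Finset ι with Disjoint y.1 y.2,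
        pairCoeff g h y.1 y.2 x.1 * f (x + h • (2 • ∑ i ∈ y.1, e i + ∑ i ∈ y.2, e i)) *
          splitSum (fun z => g z * g (h - z))
            (fun m => w (y.1.card + m) * w' (y.1.card + (y.2.card - m))) y.2 x.1 := by
  have hexpand : shiftSum e g h w (shiftSum e g h w' f) x = ∑ I, ∑ J,
      w I.card * w' J.card * (shiftCoeff g I x.1 * shiftCoeff g J (x + h • ∑ i ∈ I, e i).1) *
        f (x + h • (∑ i ∈ I, e i + ∑ i ∈ J, e i)) := by
    refine Finset.sum_congr rfl fun I _ => ?_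
    rw [shiftSum, Finset.mul_sum]
    refine Finset.sum_congr rfl fun J _ => ?_
    rw [smul_add, add_assoc]
    ring
  rw [hexpand, sum_sum_eq_sum_disjoint_sum_powerset]
  refine Finset.sum_congr rfl fun ⟨C, K⟩ hCK => ?_
  replace hCK : Disjoint C K := (Finset.mem_filter.mp hCK).2
  rw [splitSum, Finset.mul_sum]
  refine Finset.sum_congr rfl fun P hP => ?_
  have hPK := Finset.mem_powerset.mp hP
  have hsum : ∑ i ∈ C ∪ P, e i + ∑ i ∈ C ∪ K \ P, e i = 2 • ∑ i ∈ C, e i + ∑ i ∈ K, e i := by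
    rw [Finset.sum_union (hCK.mono_right hPK),
      Finset.sum_union (hCK.mono_right Finset.sdiff_subset), ← Finset.sum_sdiff hPK]
    abel
  rw [hsum, shiftCoeff_mul_shiftCoeff g hCK hPK (he.add_smul_sum x h _),
    Finset.card_union_of_disjoint (hCK.mono_right hPK),
    Finset.card_union_of_disjoint (hCK.mono_right Finset.sdiff_subset),
    Finset.card_sdiff_of_subset hPK]
  ring

theorem IsDirections.shiftSum_comm {e : ι → S} (he : IsDirections e) {τ : ℂ} (hτ : 0 < τ.im)
    (γ : ℂ) {h : ℂ} (hh : theta τ h ≠ 0) (hh2 : theta τ (2 * h) ≠ 0) (w w' : ℕ → ℂ) (f : S → ℂ)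
    {x : S} (hx : IsGeneric τ h Finset.univ x.1) :
    shiftSum e (thetaRatio τ γ) h w (shiftSum e (thetaRatio τ γ) h w' f) x =
      shiftSum e (thetaRatio τ γ) h w' (shiftSum e (thetaRatio τ γ) h w f) x := by
  rw [he.shiftSum_shiftSum, he.shiftSum_shiftSum]
  refine Finset.sum_congr rfl fun ⟨C, K⟩ _ => congrArg _ ?_
  rw [← (isSplitKernel_thetaRatio hτ γ hh).splitSum_comp_neg hτ hh hh2 K x.1
    (hx.mono (Finset.subset_univ K)),
    ← splitSum_compl (fun z => thetaRatio τ γ z * thetaRatio τ γ (h - z))]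
  refine Finset.sum_congr rfl fun P hP => ?_
  simp only [Nat.sub_sub_self (Finset.card_le_card (Finset.mem_powerset.mp hP)), mul_comm (w' _)]

end Directions

/-! ### The Frobenius determinant -/

/-- The points `λ` at which the functions `1 / θ(λ_i - λ_j)`, for `i ≠ j`, have no pole. -/
def IsRegular {ι : Type*} (τ : ℂ) (l : ι → ℂ) : Prop :=
  Pairwise fun i j => theta τ (l i - l j) ≠ 0

theorem IsRegular.update {ι : Type*} [DecidableEq ι] {τ : ℂ} {l : ι → ℂ} (hl : IsRegular τ l)
    {a : ι} {y : ℂ} (hy : ∀ i, i ≠ a → theta τ (l i - y) ≠ 0) :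
    IsRegular τ (Function.update l a y) := by
  intro i j hij
  rcases eq_or_ne i a with rfl | hia
  · rw [Function.update_self, Function.update_of_ne hij.symm, ← neg_sub, theta_neg, neg_ne_zero]
    exact hy j hij.symm
  · rw [Function.update_of_ne hia]
    rcases eq_or_ne j a with rfl | hja
    · rw [Function.update_self]
      exact hy i hij
    · rw [Function.update_of_ne hja]
      exact hl hij

section Vandermonde

variable {ι : Type*} [Fintype ι] [LinearOrder ι] [LocallyFiniteOrderTop ι]

theorem prod_prod_Ioi_eq_prod_prod_compl {M : Type*} [CommMonoid M] {q : ι → ι → M}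
    (hq : ∀ i j, q i j = q j i) (I : Finset ι)
    (hI : ∀ i j, i ≠ j → (i ∈ I ↔ j ∈ I) → q i j = 1) :
    ∏ i, ∏ j ∈ Finset.Ioi i, q i j = ∏ i ∈ I, ∏ k ∈ Iᶜ, q i k := by
  rw [Finset.prod_sigma', Finset.prod_sigma']
  symm
  refine Finset.prod_of_injOn (fun p => ⟨min p.1 p.2, max p.1 p.2⟩) ?_ ?_ ?_ ?_
  · rintro ⟨i, k⟩ hik ⟨i', k'⟩ hik' h
    simp only [Finset.coe_sigma, Set.mem_sigma_iff, Finset.mem_coe, Finset.mem_compl] at hik hik'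
    simp only [Sigma.mk.injEq, heq_eq_eq] at h ⊢
    grind
  · rintro ⟨i, k⟩ hik
    simp only [Finset.coe_sigma, Set.mem_sigma_iff, Finset.mem_coe, Finset.mem_compl] at hik
    have hne : i ≠ k := fun h => hik.2 (h ▸ hik.1)
    simpa [eq_comm] using hne
  · rintro ⟨i, j⟩ hij hnot
    have hlt : i < j := by simpa using hij
    refine hI i j hlt.ne (Classical.not_not.mp fun h => hnot ?_)
    by_cases hi : i ∈ I
    · exact ⟨⟨i, j⟩, by simp_all, by simp [hlt.le]⟩
    · exact ⟨⟨j, i⟩, by simp_all, by simp [hlt.le]⟩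
  · rintro ⟨i, k⟩ -
    rcases le_total i k with h | h
    · simp only [min_eq_left h, max_eq_right h]
    · simp only [min_eq_right h, max_eq_left h, hq i k]

/-- The product `∏_{i<j} θ(λ_i - λ_j)`. -/
def thetaVandermonde (τ : ℂ) (l : ι → ℂ) : ℂ :=
  ∏ i, ∏ j ∈ Finset.Ioi i, theta τ (l i - l j)

theorem thetaVandermonde_ne_zero {τ : ℂ} {l : ι → ℂ} (hl : IsRegular τ l) :
    thetaVandermonde τ l ≠ 0 :=
  Finset.prod_ne_zero_iff.mpr fun _ _ => Finset.prod_ne_zero_iff.mpr fun _ hj =>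
    hl (Finset.mem_Ioi.mp hj).ne

theorem thetaVandermonde_div_thetaVandermonde {τ : ℂ} {l l' : ι → ℂ} (hl : IsRegular τ l)
    (I : Finset ι) (hI : ∀ i j, (i ∈ I ↔ j ∈ I) → l' i - l' j = l i - l j) :
    thetaVandermonde τ l' / thetaVandermonde τ l =
      ∏ i ∈ I, ∏ k ∈ Iᶜ, theta τ (l' k - l' i) / theta τ (l k - l i) := by
  rw [← prod_prod_Ioi_eq_prod_prod_compl (q := fun i k =>
    theta τ (l' k - l' i) / theta τ (l k - l i))]
  · simp only [thetaVandermonde, ← Finset.prod_div_distrib]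
    refine Finset.prod_congr rfl fun i _ => Finset.prod_congr rfl fun j _ => ?_
    rw [← neg_sub (l' j), ← neg_sub (l j), theta_neg, theta_neg, neg_div_neg_eq]
  · intro i j
    rw [← neg_sub (l' i), ← neg_sub (l i), theta_neg, theta_neg, neg_div_neg_eq]
  · intro i j hij h
    rw [hI j i h.symm, div_self (hl hij.symm)]

theorem thetaVandermonde_update_div {τ : ℂ} {l : ι → ℂ} (hl : IsRegular τ l) (a : ι) (y : ℂ) :
    thetaVandermonde τ (Function.update l a y) / thetaVandermonde τ l =
      ∏ k ∈ Finset.univ.erase a, theta τ (l k - y) / theta τ (l k - l a) := by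
  rw [thetaVandermonde_div_thetaVandermonde hl {a}, Finset.prod_singleton,
    Finset.compl_singleton, Function.update_self]
  · refine Finset.prod_congr rfl fun k hk => ?_
    rw [Function.update_of_ne (Finset.ne_of_mem_erase hk)]
  · intro i j hij
    rw [Finset.mem_singleton, Finset.mem_singleton] at hij
    grind [Function.update_apply]

theorem thetaVandermonde_div_eq_shiftCoeff {τ h : ℂ} {l l' : ι → ℂ} (hl : IsRegular τ l)
    (I : Finset ι) (hl' : ∀ i k, l' k - l' i =
      l k - l i + h * ((if k ∈ I then 1 else 0) - if i ∈ I then 1 else 0)) :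
    thetaVandermonde τ l' / thetaVandermonde τ l = shiftCoeff (thetaRatio τ (-h)) I l := by
  rw [thetaVandermonde_div_thetaVandermonde hl I]
  · refine Finset.prod_congr rfl fun i hi => Finset.prod_congr rfl fun k hk => ?_
    rw [hl', if_pos hi, if_neg (Finset.mem_compl.mp hk), zero_sub, mul_neg, mul_one, add_comm,
      thetaRatio]
  · intro i j hij
    simp only [hl', hij, sub_self, mul_zero, add_zero]

end Vandermonde

theorem det_mul_updateRow_one {ι R : Type*} [Fintype ι] [DecidableEq ι] [CommRing R]
    (N : Matrix ι ι R) (a : ι) (r : ι → R) :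
    (Matrix.of fun i j => N i a * r j + if j = a then 0 else N i j).det = r a * N.det := by
  have hfactor : (Matrix.of fun i j => N i a * r j + if j = a then 0 else N i j) =
      N * (1 : Matrix ι ι R).updateRow a r := by
    ext i j
    rw [Matrix.mul_apply, Matrix.of_apply, ← Finset.add_sum_erase _ _ (Finset.mem_univ a),
      Matrix.updateRow_self]
    congr 1
    rw [Finset.sum_congr rfl fun k hk => by
      rw [Matrix.updateRow_ne (Finset.ne_of_mem_erase hk), Matrix.one_apply, mul_ite, mul_one,
        mul_zero], Finset.sum_ite_eq']
    simp only [Finset.mem_erase, Finset.mem_univ, and_true, ite_not]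
  rw [hfactor, Matrix.det_mul, ← Matrix.cramer_transpose_apply, Matrix.transpose_one,
    Matrix.cramer_one, mul_comm, Module.End.one_apply]

theorem prod_update_sub_div {ι : Type*} [DecidableEq ι] (τ : ℂ) (l : ι → ℂ) {s : Finset ι} {a : ι}
    (ha : a ∉ s) (y z z' : ℂ) :
    ∏ k ∈ s, theta τ (Function.update l a y k - z) / theta τ (Function.update l a y k - z') =
      ∏ k ∈ s, theta τ (l k - z) / theta τ (l k - z') :=
  Finset.prod_congr rfl fun k hk => by
    rw [Function.update_of_ne fun h : k = a => ha (h ▸ hk)]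

theorem prod_theta_div_mul_prod_theta_div {ι : Type*} {τ : ℂ} {l : ι → ℂ} {s : Finset ι} {y : ℂ}
    (hy : ∀ k ∈ s, theta τ (l k - y) ≠ 0) (z z' : ℂ) :
    (∏ k ∈ s, theta τ (l k - z) / theta τ (l k - y)) *
      ∏ k ∈ s, theta τ (l k - y) / theta τ (l k - z') =
        ∏ k ∈ s, theta τ (l k - z) / theta τ (l k - z') := by
  rw [← Finset.prod_mul_distrib]
  exact Finset.prod_congr rfl fun k hk => div_mul_div_cancel₀ (hy k hk)

section Lagrange

variable {ι : Type*} [Fintype ι] [DecidableEq ι] {τ u : ℂ} {l : ι → ℂ}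

/-- The theta function of degree `n` with value `1` at `λ_j` and `0` at the other `λ_k`. -/
def lagrange (τ u : ℂ) (l : ι → ℂ) (j : ι) (z : ℂ) : ℂ :=
  theta τ (u + (l j - z)) / theta τ u *
    ∏ k ∈ Finset.univ.erase j, theta τ (l k - z) / theta τ (l k - l j)

theorem lagrange_node (hu : theta τ u ≠ 0) (hl : IsRegular τ l) (i j : ι) :
    lagrange τ u l j (l i) = if i = j then 1 else 0 := by
  rw [lagrange]
  split_ifs with h
  · rw [h, sub_self, add_zero, div_self hu, one_mul]
    exact Finset.prod_eq_one fun k hk => div_self (hl (Finset.ne_of_mem_erase hk))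
  · rw [Finset.prod_eq_zero (Finset.mem_erase.mpr ⟨h, Finset.mem_univ i⟩), mul_zero]
    rw [sub_self, theta_zero, zero_div]

theorem lagrange_eq_update_self {a : ι} {y : ℂ} (hy : ∀ i, i ≠ a → theta τ (l i - y) ≠ 0)
    (hu' : theta τ (u + (l a - y)) ≠ 0) (z : ℂ) :
    lagrange τ u l a z =
      lagrange τ (u + (l a - y)) (Function.update l a y) a z * lagrange τ u l a y := by
  simp only [lagrange, Function.update_self]
  rw [prod_update_sub_div τ l (Finset.notMem_erase a _), add_assoc, sub_add_sub_cancel,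
    ← prod_theta_div_mul_prod_theta_div (fun k hk => hy k (Finset.ne_of_mem_erase hk)) z (l a)]
  field_simp

theorem theta_four_points (hτ : 0 < τ.im) (u a b y z : ℂ) :
    theta τ (u + (a - y) + (b - z)) * theta τ u * (theta τ (a - b) * theta τ (y - z)) +
      theta τ (u + (a - y)) * theta τ (u + (b - z)) * (theta τ (a - z) * theta τ (b - y)) =
    theta τ (u + (a - z)) * theta τ (u + (b - y)) * (theta τ (a - y) * theta τ (b - z)) := by
  have h := theta_three_term hτ (u + (a + b - y - z) / 2) ((a + b - y - z) / 2)
    ((a - b + y - z) / 2) ((a - b - y + z) / 2)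
  have hneg : theta τ (z - b) = -theta τ (b - z) := by rw [← theta_neg, neg_sub]
  ring_nf at h hneg ⊢
  rw [hneg] at h
  linear_combination h

theorem lagrange_eq_update_of_ne (hτ : 0 < τ.im) (hu : theta τ u ≠ 0) (hl : IsRegular τ l)
    {a j : ι} (hja : j ≠ a) {y : ℂ} (hy : ∀ i, i ≠ a → theta τ (l i - y) ≠ 0)
    (hu' : theta τ (u + (l a - y)) ≠ 0) (z : ℂ) :
    lagrange τ u l j z =
      lagrange τ (u + (l a - y)) (Function.update l a y) a z * lagrange τ u l j y +
        lagrange τ (u + (l a - y)) (Function.update l a y) j z := by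
  set s := (Finset.univ.erase j).erase a with hs
  have ha : insert a s = Finset.univ.erase j :=
    Finset.insert_erase (Finset.mem_erase.mpr ⟨hja.symm, Finset.mem_univ a⟩)
  have hj : insert j s = Finset.univ.erase a := by
    rw [hs, Finset.erase_right_comm]
    exact Finset.insert_erase (Finset.mem_erase.mpr ⟨hja, Finset.mem_univ j⟩)
  have has : a ∉ s := Finset.notMem_erase a _
  have hjs : j ∉ s := fun h => Finset.notMem_erase j _ (Finset.mem_of_mem_erase h)
  have hprod := prod_theta_div_mul_prod_theta_div (l := l) (s := s)
    (fun k hk => hy k (Finset.ne_of_mem_erase hk)) z (l j)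
  simp only [lagrange, Function.update_self, ← ha, ← hj, Finset.prod_insert has,
    Finset.prod_insert hjs, Function.update_of_ne hja, prod_update_sub_div τ l has, ← hprod]
  have haj := hl hja.symm
  have hjy := hy j hja
  have hyj : theta τ (y - l j) = -theta τ (l j - y) := by rw [← theta_neg, neg_sub]
  have hthree := theta_four_points hτ u (l a) (l j) y z
  rw [hyj, show u + (l a - y) + (y - z) = u + (l a - z) by ring]
  generalize ∏ k ∈ s, theta τ (l k - z) / theta τ (l k - y) = P
  generalize ∏ k ∈ s, theta τ (l k - y) / theta τ (l k - l j) = Q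
  field_simp
  linear_combination P * Q * hthree

theorem det_lagrange_eq_det_lagrange_update (hτ : 0 < τ.im) (hu : theta τ u ≠ 0)
    (hl : IsRegular τ l) {a : ι} {y : ℂ} (hy : ∀ i, i ≠ a → theta τ (l i - y) ≠ 0)
    (hu' : theta τ (u + (l a - y)) ≠ 0) (ν : ι → ℂ) :
    (Matrix.of fun i j => lagrange τ u l j (ν i)).det = lagrange τ u l a y *
      (Matrix.of fun i j =>
        lagrange τ (u + (l a - y)) (Function.update l a y) j (ν i)).det := by
  rw [← det_mul_updateRow_one _ a fun j => lagrange τ u l j y]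
  congr 1
  ext i j
  simp only [Matrix.of_apply]
  split_ifs with hja
  · rw [hja, add_zero, lagrange_eq_update_self hy hu']
  · exact lagrange_eq_update_of_ne hτ hu hl hja hy hu' _

end Lagrange

-- The nodes `λ_i` are moved to the points `μ_i` one at a time, until the matrix is the identity.
theorem det_lagrange {ι : Type*} [Fintype ι] [LinearOrder ι] [LocallyFiniteOrderTop ι] {τ : ℂ}
    (hτ : 0 < τ.im) {μ : ι → ℂ} (hμ : IsRegular τ μ) (I : Finset ι) :
    ∀ (u : ℂ) (l : ι → ℂ), (∀ t ⊆ I, theta τ (u + ∑ i ∈ t, (l i - μ i)) ≠ 0) →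
      IsRegular τ l → (∀ i j, i ≠ j → theta τ (l i - μ j) ≠ 0) →
      (Matrix.of fun i j => lagrange τ u l j (I.piecewise μ l i)).det =
        theta τ (u + ∑ i ∈ I, (l i - μ i)) / theta τ u *
          (thetaVandermonde τ (I.piecewise μ l) / thetaVandermonde τ l) := by
  induction I using Finset.induction_on with
  | empty =>
    intro u l hu hl _
    have hu₀ : theta τ u ≠ 0 := by simpa using hu ∅ subset_rfl
    simp only [Finset.piecewise_empty, lagrange_node hu₀ hl, Finset.sum_empty, add_zero,
      div_self hu₀, div_self (thetaVandermonde_ne_zero hl), mul_one]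
    exact Matrix.det_one
  | insert a I haI ih =>
    intro u l hu hl hlμ
    have hu₀ : theta τ u ≠ 0 := by simpa using hu ∅ (Finset.empty_subset _)
    have hua : theta τ (u + (l a - μ a)) ≠ 0 := by simpa using hu {a} (by simp)
    set l' := Function.update l a (μ a) with hl'
    have hreg : IsRegular τ l' := hl.update fun i hi => hlμ i a hi
    have hl'μ : ∀ i j, i ≠ j → theta τ (l' i - μ j) ≠ 0 := fun i j hij => by
      rcases eq_or_ne i a with rfl | hia
      · rw [hl', Function.update_self]
        exact hμ hij
      · rw [hl', Function.update_of_ne hia]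
        exact hlμ i j hij
    have hsum : ∀ t ⊆ I, u + (l a - μ a) + ∑ i ∈ t, (l' i - μ i) =
        u + ∑ i ∈ insert a t, (l i - μ i) := fun t ht => by
      rw [Finset.sum_insert fun h => haI (ht h), ← add_assoc, Finset.sum_congr rfl fun i hi => by
        rw [hl', Function.update_of_ne fun h : i = a => haI (h ▸ ht hi)]]
    have hdet := ih (u + (l a - μ a)) l'
      (fun t ht => hsum t ht ▸ hu _ (Finset.insert_subset_insert a ht)) hreg hl'μ
    have hpiecewise : (insert a I).piecewise μ l = I.piecewise μ l' := by
      rw [Finset.piecewise_insert, hl', Finset.update_piecewise_of_notMem _ _ _ haI]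
    rw [hpiecewise, det_lagrange_eq_det_lagrange_update hτ hu₀ hl (fun i hi => hlμ i a hi) hua,
      hdet, hsum I subset_rfl, lagrange, ← thetaVandermonde_update_div hl, ← hl']
    have hV := thetaVandermonde_ne_zero hl
    have hV' := thetaVandermonde_ne_zero hreg
    field_simp

/-! ### Holomorphic germs and divided differences -/

section Holomorphic

variable {E : Type*} [NormedAddCommGroup E] [NormedSpace ℂ E]

theorem norm_fderiv_le_of_forall_norm_le {F : Type*} [NormedAddCommGroup F] [NormedSpace ℂ F]
    {f : E → F} {p : E} {r C : ℝ} (hr : 0 < r) (hf : DifferentiableOn ℂ f (Metric.ball p r))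
    (hC : ∀ y ∈ Metric.ball p r, ‖f y‖ ≤ C) : ‖fderiv ℂ f p‖ ≤ (C + C) / r :=
  norm_fderiv_le_div_of_mapsTo_ball hf
    (fun y hy => mem_closedBall_iff_norm.mpr <|
      (norm_sub_le _ _).trans (add_le_add (hC y hy) (hC p (Metric.mem_ball_self hr)))) hr

theorem continuous_comp_circleMap {F X : Type*} [TopologicalSpace F] [TopologicalSpace X]
    {Ψ : X × ℂ → F} {p : X} {r : ℝ} (hr : 0 ≤ r)
    (hΨ : ∀ ζ ∈ Metric.sphere (0 : ℂ) r, ContinuousAt Ψ (p, ζ)) :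
    Continuous fun t : ℝ => Ψ (p, circleMap 0 r t) :=
  continuous_iff_continuousAt.mpr fun t =>
    ContinuousAt.comp (f := fun t : ℝ => (p, circleMap 0 r t))
      (hΨ _ (circleMap_mem_sphere 0 hr t)) (by fun_prop)

theorem stronglyMeasurable_fderiv_comp_inl [FiniteDimensional ℂ E] (Ψ : E × ℂ → ℂ) (p : E)
    {γ : ℝ → ℂ} (hγ : Continuous γ) :
    MeasureTheory.StronglyMeasurable fun t : ℝ =>
      (fderiv ℂ Ψ (p, γ t)).comp (ContinuousLinearMap.inl ℂ E ℂ) := by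
  have : ProperSpace E := FiniteDimensional.proper ℂ E
  have : ProperSpace (E × ℂ →L[ℂ] ℂ) := FiniteDimensional.proper ℂ _
  borelize E
  have hmeas : Measurable fun t : ℝ => fderiv ℂ Ψ (p, γ t) :=
    (measurable_fderiv ℂ Ψ).comp (by fun_prop : Continuous fun t : ℝ => (p, γ t)).measurable
  have hcont : Continuous fun A : E × ℂ →L[ℂ] ℂ => A.comp (ContinuousLinearMap.inl ℂ E ℂ) := by
    fun_prop
  exact hcont.comp_stronglyMeasurable hmeas.stronglyMeasurable

theorem exists_norm_fderiv_le [ProperSpace E] {X : Type*} [TopologicalSpace X]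
    {Ψ : E × X → ℂ} {K : Set X} (hK : IsCompact K) {p₀ : E} {ε : ℝ} (hε : 0 < ε)
    (hΨ : ∀ p ∈ Metric.ball p₀ ε, ∀ ζ ∈ K, ContinuousAt Ψ (p, ζ))
    (hd : ∀ ζ ∈ K, DifferentiableOn ℂ (fun p => Ψ (p, ζ)) (Metric.ball p₀ ε)) :
    ∃ C, ∀ p ∈ Metric.ball p₀ (ε / 4), ∀ ζ ∈ K, ‖fderiv ℂ (fun p => Ψ (p, ζ)) p‖ ≤ C := by
  obtain ⟨C, hC⟩ := ((isCompact_closedBall p₀ (ε / 2)).prod hK).exists_bound_of_continuousOn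
    (f := Ψ) fun q hq => (hΨ q.1 (Metric.closedBall_subset_ball (by linarith) hq.1) q.2
      hq.2).continuousWithinAt
  refine ⟨(C + C) / (ε / 4), fun p hp ζ hζ => ?_⟩
  have hball : Metric.ball p (ε / 4) ⊆ Metric.ball p₀ (ε / 2) :=
    Metric.ball_subset_ball' (by linarith [Metric.mem_ball.mp hp])
  exact norm_fderiv_le_of_forall_norm_le (by positivity)
    ((hd ζ hζ).mono (hball.trans (Metric.ball_subset_ball (by linarith))))
    fun y hy => hC (y, ζ) ⟨Metric.ball_subset_closedBall (hball hy), hζ⟩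

theorem differentiableAt_circleIntegral [FiniteDimensional ℂ E] {Ψ : E × ℂ → ℂ} {r : ℝ}
    (hr : 0 ≤ r) {p₀ : E} {ε : ℝ} (hε : 0 < ε)
    (hΨ : ∀ p ∈ Metric.ball p₀ ε, ∀ ζ ∈ Metric.sphere (0 : ℂ) r, DifferentiableAt ℂ Ψ (p, ζ)) :
    DifferentiableAt ℂ (fun p => ∮ ζ in C(0, r), Ψ (p, ζ)) p₀ := by
  have : ProperSpace E := FiniteDimensional.proper ℂ E
  have hmem : ∀ t : ℝ, circleMap 0 r t ∈ Metric.sphere (0 : ℂ) r :=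
    circleMap_mem_sphere 0 hr
  have hderiv : Continuous fun t : ℝ => deriv (circleMap 0 r) t := by
    simp only [deriv_circleMap]
    fun_prop
  have hcont : ∀ p ∈ Metric.ball p₀ ε, Continuous fun t : ℝ =>
      deriv (circleMap 0 r) t • Ψ (p, circleMap 0 r t) := fun p hp =>
    hderiv.smul (continuous_comp_circleMap hr fun ζ hζ => (hΨ p hp ζ hζ).continuousAt)
  have hfderiv : ∀ p ∈ Metric.ball p₀ ε, ∀ ζ ∈ Metric.sphere (0 : ℂ) r,
      HasFDerivAt (fun p => Ψ (p, ζ))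
        ((fderiv ℂ Ψ (p, ζ)).comp (ContinuousLinearMap.inl ℂ E ℂ)) p :=
    fun p hp ζ hζ => (hΨ p hp ζ hζ).hasFDerivAt.comp p (hasFDerivAt_prodMk_left p ζ)
  obtain ⟨C, hC⟩ := exists_norm_fderiv_le (isCompact_sphere (0 : ℂ) r) hε
    (fun p hp ζ hζ => (hΨ p hp ζ hζ).continuousAt)
    fun ζ hζ p hp => (hfderiv p hp ζ hζ).differentiableAt.differentiableWithinAt
  have hsub : Metric.ball p₀ (ε / 4) ⊆ Metric.ball p₀ ε := Metric.ball_subset_ball (by linarith)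
  refine (intervalIntegral.hasFDerivAt_integral_of_dominated_of_fderiv_le
    (s := Metric.ball p₀ (ε / 4)) (bound := fun _ => r * C)
    (F' := fun p t => deriv (circleMap 0 r) t •
      (fderiv ℂ Ψ (p, circleMap 0 r t)).comp (ContinuousLinearMap.inl ℂ E ℂ))
    (Metric.ball_mem_nhds _ (by positivity)) ?_
    ((hcont p₀ (Metric.mem_ball_self hε)).intervalIntegrable _ _) ?_ (.of_forall fun t _ p hp => ?_)
    (by simp) (.of_forall fun t _ p hp =>
      (hfderiv p (hsub hp) _ (hmem t)).fun_const_smul _)).differentiableAt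
  · filter_upwards [Metric.ball_mem_nhds p₀ hε] with p hp
    exact (hcont p hp).aestronglyMeasurable
  · exact hderiv.aestronglyMeasurable.smul
      (stronglyMeasurable_fderiv_comp_inl Ψ p₀ (continuous_circleMap 0 r)).aestronglyMeasurable
  · rw [norm_smul, ← (hfderiv p (hsub hp) _ (hmem t)).fderiv]
    have hspeed : ‖deriv (circleMap 0 r) t‖ = r := by
      simp [deriv_circleMap, abs_of_nonneg hr]
    rw [hspeed]
    exact mul_le_mul_of_nonneg_left (hC p hp _ (hmem t)) hr

/-- Germs of holomorphic functions: `f` is complex differentiable in a neighbourhood of `x`. -/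
def HolAt (f : E → ℂ) (x : E) : Prop := ∀ᶠ y in 𝓝 x, DifferentiableAt ℂ f y

/-- The divided difference `(G(ħ, y + ħ v) - G(ħ, y)) / ħ` of a family of functions, whose limit
at `ħ = 0` is a partial derivative. At `ħ = 0` it is by definition the derivative of `G(0, ·)` in
the direction `v`, so that divided differences of holomorphic families are holomorphic. -/
def divDiff (v : E) (G : ℂ × E → ℂ) (p : ℂ × E) : ℂ :=
  if p.1 = 0 then lineDeriv ℂ (fun y => G (0, y)) p.2 v
  else (G (p.1, p.2 + p.1 • v) - G p) / p.1

theorem circleIntegral_inv_mul_sub_mul {φ : ℂ → ℂ} {R : ℝ}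
    (hφ : DifferentiableOn ℂ φ (Metric.closedBall 0 R)) {h : ℂ}
    (hh : h ∈ Metric.ball (0 : ℂ) R) (h0 : h ≠ 0) :
    (2 * Real.pi * I : ℂ)⁻¹ * (∮ ζ in C(0, R), (ζ * (ζ - h))⁻¹ * φ ζ) = (φ h - φ 0) / h := by
  have hR : 0 < R := Metric.pos_of_mem_ball hh
  have h0R : (0 : ℂ) ∈ Metric.ball 0 R := Metric.mem_ball_self hR
  have hne : ∀ w ∈ Metric.ball (0 : ℂ) R, ∀ ζ ∈ Metric.sphere (0 : ℂ) R, ζ - w ≠ 0 :=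
    fun w hw ζ hζ => sub_ne_zero.mpr (Metric.sphere_disjoint_ball.ne_of_mem hζ hw)
  have hint : ∀ w ∈ Metric.ball (0 : ℂ) R, CircleIntegrable (fun ζ => (ζ - w)⁻¹ • φ ζ) 0 R :=
    fun w hw => ContinuousOn.circleIntegrable hR.le
      (((by fun_prop : ContinuousOn (fun ζ : ℂ => ζ - w) _).inv₀ (hne w hw)).smul
        (hφ.continuousOn.mono Metric.sphere_subset_closedBall))
  have partial_fractions : (∮ ζ in C(0, R), (ζ * (ζ - h))⁻¹ * φ ζ) =
      ∮ ζ in C(0, R), h⁻¹ * ((ζ - h)⁻¹ • φ ζ - (ζ - 0)⁻¹ • φ ζ) := by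
    refine circleIntegral.integral_congr hR.le fun ζ hζ => ?_
    have hζh := hne h hh ζ hζ
    have hζ0 := hne 0 h0R ζ hζ
    simp only [smul_eq_mul, sub_zero] at hζ0 ⊢
    field_simp
    ring
  rw [partial_fractions, circleIntegral.integral_const_mul,
    circleIntegral.integral_sub (hint h hh) (hint 0 h0R),
    hφ.circleIntegral_sub_inv_smul hh, hφ.circleIntegral_sub_inv_smul h0R]
  simp only [smul_eq_mul]
  field_simp [two_pi_I_ne_zero]

theorem divDiff_eq_circleIntegral {G : ℂ × E → ℂ} {v : E} {R : ℝ} {U : Set ℂ} (hU : IsOpen U)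
    (hRU : Metric.closedBall 0 R ⊆ U) {p : ℂ × E}
    (hG : ∀ ζ ∈ U, DifferentiableAt ℂ G (p.1, p.2 + ζ • v)) (hp : p.1 ∈ Metric.ball (0 : ℂ) R) :
    divDiff v G p =
      (2 * Real.pi * I : ℂ)⁻¹ * ∮ ζ in C(0, R), (ζ * (ζ - p.1))⁻¹ * G (p.1, p.2 + ζ • v) := by
  have hd : DifferentiableOn ℂ (fun ζ => G (p.1, p.2 + ζ • v)) U := fun ζ hζ =>
    (DifferentiableAt.comp ζ (hG ζ hζ) (by fun_prop : DifferentiableAt ℂ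
      (fun ζ : ℂ => (p.1, p.2 + ζ • v)) ζ)).differentiableWithinAt
  rw [divDiff]
  split_ifs with h0
  · have hcauchy := two_pi_I_inv_smul_circleIntegral_sub_sq_inv_smul_of_differentiable hU hRU hd
      (Metric.mem_ball_self (Metric.pos_of_mem_ball hp))
    simp only [sub_zero, smul_eq_mul, h0, sq] at hcauchy ⊢
    exact hcauchy.symm
  · rw [circleIntegral_inv_mul_sub_mul (φ := fun ζ => G (p.1, p.2 + ζ • v)) (hd.mono hRU) hp h0,
      zero_smul, add_zero]

theorem differentiableAt_of_mem_ball_of_norm_mul_lt {G : ℂ × E → ℂ} {x v : E} {ε : ℝ}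
    (hG : ∀ q ∈ Metric.ball ((0 : ℂ), x) ε, DifferentiableAt ℂ G q) {p : ℂ × E}
    (hp : p ∈ Metric.ball ((0 : ℂ), x) (ε / 2)) {ζ : ℂ} (hζ : ‖ζ‖ * ‖v‖ < ε / 2) :
    DifferentiableAt ℂ G (p.1, p.2 + ζ • v) := by
  refine hG _ ?_
  rw [← ball_prod_same] at hp ⊢
  have hε : 0 < ε / 2 := Metric.pos_of_mem_ball hp.1
  refine ⟨Metric.ball_subset_ball (by linarith) hp.1, Metric.mem_ball.mpr ?_⟩
  calc dist (p.2 + ζ • v) x ≤ dist (p.2 + ζ • v) p.2 + dist p.2 x := dist_triangle _ _ _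
    _ = ‖ζ‖ * ‖v‖ + dist p.2 x := by rw [dist_eq_norm, add_sub_cancel_left, norm_smul]
    _ < ε := by linarith [Metric.mem_ball.mp hp.2]

theorem HolAt.divDiff [FiniteDimensional ℂ E] {G : ℂ × E → ℂ} {x : E} (hG : HolAt G (0, x))
    (v : E) : HolAt (divDiff v G) (0, x) := by
  obtain ⟨ε, hε, hball⟩ := Metric.eventually_nhds_iff_ball.mp hG
  obtain ⟨R, hR, hRv⟩ := exists_pos_mul_lt (half_pos hε) ‖v‖
  have hRU : Metric.closedBall (0 : ℂ) R ⊆ {ζ | ‖ζ‖ * ‖v‖ < ε / 2} := fun ζ hζ =>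
    (mul_le_mul_of_nonneg_right (mem_closedBall_zero_iff.mp hζ) (norm_nonneg v)).trans_lt
      (mul_comm R _ ▸ hRv)
  set δ := min R (ε / 2)
  have hGδ : ∀ p ∈ Metric.ball ((0 : ℂ), x) δ, ∀ ζ ∈ {ζ : ℂ | ‖ζ‖ * ‖v‖ < ε / 2},
      DifferentiableAt ℂ G (p.1, p.2 + ζ • v) := fun p hp ζ hζ =>
    differentiableAt_of_mem_ball_of_norm_mul_lt hball
      (Metric.ball_subset_ball (min_le_right _ _) hp) hζ
  have hfst : ∀ p ∈ Metric.ball ((0 : ℂ), x) δ, p.1 ∈ Metric.ball (0 : ℂ) R := fun p hp =>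
    Metric.ball_subset_ball (min_le_left _ _) (ball_prod_same (0 : ℂ) x δ ▸ hp).1
  filter_upwards [Metric.ball_mem_nhds _ (by positivity : 0 < δ)] with p hp
  have hnhds := Metric.isOpen_ball.mem_nhds hp
  obtain ⟨η, hη, hηδ⟩ := Metric.mem_nhds_iff.mp hnhds
  have hdiff := differentiableAt_circleIntegral (Ψ := fun q : (ℂ × E) × ℂ =>
      (q.2 * (q.2 - q.1.1))⁻¹ * G (q.1.1, q.1.2 + q.2 • v)) hR.le hη fun q hq ζ hζ => by
    have hζ0 : ζ ≠ 0 := Metric.sphere_disjoint_ball.ne_of_mem hζ (Metric.mem_ball_self hR)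
    have hζq : ζ - q.1 ≠ 0 := sub_ne_zero.mpr
      (Metric.sphere_disjoint_ball.ne_of_mem hζ (hfst q (hηδ hq)))
    have hker : DifferentiableAt ℂ (fun q : (ℂ × E) × ℂ => q.2 * (q.2 - q.1.1)) (q, ζ) := by
      fun_prop
    exact (hker.inv (mul_ne_zero hζ0 hζq)).mul
      (DifferentiableAt.comp (q, ζ)
        (hGδ q (hηδ hq) ζ (hRU (Metric.sphere_subset_closedBall hζ)))
        (by fun_prop : DifferentiableAt ℂ
          (fun q : (ℂ × E) × ℂ => (q.1.1, q.1.2 + q.2 • v)) (q, ζ)))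
  refine (hdiff.const_mul (2 * Real.pi * I : ℂ)⁻¹).congr_of_eventuallyEq ?_
  filter_upwards [hnhds] with q hq
  exact divDiff_eq_circleIntegral (isOpen_lt (by fun_prop) (by fun_prop)) hRU (hGδ q hq)
    (hfst q hq)

end Holomorphic

namespace HolAt

variable {E E' : Type*} [NormedAddCommGroup E] [NormedSpace ℂ E] [NormedAddCommGroup E']
  [NormedSpace ℂ E'] {x : E}

theorem comp {f : E' → ℂ} {g : E → E'} (hf : HolAt f (g x)) (hg : Differentiable ℂ g) :
    HolAt (fun y => f (g y)) x := by
  filter_upwards [hg.continuous.continuousAt.eventually hf] with y hy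
  exact hy.comp y (hg y)

theorem congr {f g : E → ℂ} (hf : HolAt f x) (h : g =ᶠ[𝓝 x] f) : HolAt g x := by
  filter_upwards [hf, h.eventuallyEq_nhds] with y hfy hgy using hfy.congr_of_eventuallyEq hgy

theorem const (c : ℂ) (x : E) : HolAt (fun _ => c) x :=
  .of_forall fun _ => differentiableAt_const c

theorem mul {f g : E → ℂ} (hf : HolAt f x) (hg : HolAt g x) : HolAt (fun y => f y * g y) x := by
  filter_upwards [hf, hg] with y hfy hgy using hfy.mul hgy

theorem div {f g : E → ℂ} (hf : HolAt f x) (hg : HolAt g x) (h0 : g x ≠ 0) :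
    HolAt (fun y => f y / g y) x := by
  filter_upwards [hf, hg, hg.self_of_nhds.continuousAt.eventually_ne h0] with y hfy hgy hy0
  simp only [div_eq_mul_inv]
  exact hfy.mul (hgy.inv hy0)

theorem sum {ι : Type*} {s : Finset ι} {f : ι → E → ℂ} (hf : ∀ i ∈ s, HolAt (f i) x) :
    HolAt (fun y => ∑ i ∈ s, f i y) x := by
  filter_upwards [(Filter.eventually_all_finset s).mpr hf] with y hy
  exact DifferentiableAt.fun_sum hy

theorem tendsto_nhdsNE {G : ℂ × E → ℂ} (hG : HolAt G (0, x)) :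
    Tendsto (fun h : ℂ => G (h, x)) (𝓝[≠] 0) (𝓝 (G (0, x))) := by
  have hcont : ContinuousAt (fun h : ℂ => G (h, x)) 0 :=
    ContinuousAt.comp (f := fun h : ℂ => (h, x)) hG.self_of_nhds.continuousAt (by fun_prop)
  exact hcont.tendsto.mono_left nhdsWithin_le_nhds

theorem lineDeriv [FiniteDimensional ℂ E] {f : E → ℂ} (hf : HolAt f x) (v : E) :
    HolAt (fun y => lineDeriv ℂ f y v) x := by
  have hconst : HolAt (fun p : ℂ × E => f p.2) (0, x) := hf.comp (g := Prod.snd) differentiable_snd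
  refine ((hconst.divDiff v).comp (g := fun y : E => ((0 : ℂ), y)) (by fun_prop)).congr
    (.of_forall fun y => ?_)
  simp only [EllipticCM.divDiff, if_true]

end HolAt

/-! ### Products of operators indexed by a set -/

section OpListProd

variable {ι X : Type*} [DecidableEq ι]

/-- The composition of the maps `A i`, `i ∈ J`, in the order in which the indices stand in the
list `l`. It extends `opProd` to maps of an arbitrary type and allows for induction on `l`. -/
def opListProd (A : ι → X → X) (l : List ι) (J : Finset ι) (f : X) : X :=
  l.foldr (fun i g => if i ∈ J then A i g else g) f

variable (A : ι → X → X) {i : ι} {l : List ι} {J : Finset ι}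

theorem opListProd_cons_of_mem (hi : i ∈ J) (l : List ι) (f : X) :
    opListProd A (i :: l) J f = A i (opListProd A l J f) :=
  if_pos hi

theorem opListProd_cons_of_notMem (hi : i ∉ J) (l : List ι) (f : X) :
    opListProd A (i :: l) J f = opListProd A l J f :=
  if_neg hi

theorem opListProd_congr {J' : Finset ι} (h : ∀ i ∈ l, i ∈ J ↔ i ∈ J') (f : X) :
    opListProd A l J f = opListProd A l J' f := by
  induction l with
  | nil => rfl
  | cons i l ih =>
    have hl := ih fun j hj => h j (List.mem_cons_of_mem _ hj)
    by_cases hi : i ∈ J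
    · rw [opListProd_cons_of_mem A hi,
        opListProd_cons_of_mem A ((h i List.mem_cons_self).mp hi), hl]
    · rw [opListProd_cons_of_notMem A hi,
        opListProd_cons_of_notMem A (mt (h i List.mem_cons_self).mpr hi), hl]

theorem opListProd_insert_of_notMem (hi : i ∉ l) (J : Finset ι) (f : X) :
    opListProd A l (insert i J) f = opListProd A l J f :=
  opListProd_congr A (fun j hj => by
    rw [Finset.mem_insert, or_iff_right (ne_of_mem_of_not_mem hj hi)]) f

theorem opListProd_empty (l : List ι) (f : X) : opListProd A l ∅ f = f := by
  induction l with
  | nil => rfl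
  | cons i l ih => rw [opListProd_cons_of_notMem A (Finset.notMem_empty i), ih]

theorem opListProd_singleton (hl : l.Nodup) (hi : i ∈ l) (f : X) :
    opListProd A l {i} f = A i f := by
  induction l with
  | nil => exact absurd hi List.not_mem_nil
  | cons k l ih =>
    obtain ⟨hkl, hl⟩ := List.nodup_cons.mp hl
    rcases eq_or_ne k i with rfl | hki
    · rw [opListProd_cons_of_mem A (Finset.mem_singleton_self k), ← insert_empty_eq,
        opListProd_insert_of_notMem A hkl, opListProd_empty]
    · rw [opListProd_cons_of_notMem A (by simpa using hki),
        ih hl ((List.mem_cons.mp hi).resolve_left hki.symm)]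

end OpListProd

theorem opProd_eq_opListProd {n : ℕ} {S : Submodule ℂ (Fin n → ℂ)}
    (A : Fin n → (S → ℂ) → S → ℂ) (J : Finset (Fin n)) (f : S → ℂ) :
    opProd A J f = opListProd A (List.finRange n) J f := by
  unfold opProd opMonomial opListProd
  congr 1
  funext i g
  split_ifs with hi <;> simp [hi]

/-! ### Iterated derivatives and divided differences -/

section DirDerivs

variable {ι E : Type*} [DecidableEq ι] [NormedAddCommGroup E] [NormedSpace ℂ E]

/-- The iterated derivative of `f` in the directions `v i`, `i ∈ J`, taken in the order of the
list `l`. -/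
def dirDerivs (v : ι → E) (l : List ι) (J : Finset ι) (f : E → ℂ) : E → ℂ :=
  opListProd (fun i g y => lineDeriv ℂ g y (v i)) l J f

/-- The iterated divided difference of the family `G` in the directions `v i`, `i ∈ J`, taken in
the order of the list `l`: a holomorphic deformation of `dirDerivs`. -/
def divDiffs (v : ι → E) (l : List ι) (J : Finset ι) (G : ℂ × E → ℂ) : ℂ × E → ℂ :=
  opListProd (fun i => divDiff (v i)) l J G

variable {v : ι → E} {i : ι} {J : Finset ι}

theorem dirDerivs_nil (v : ι → E) (J : Finset ι) (f : E → ℂ) : dirDerivs v [] J f = f := rfl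

theorem dirDerivs_cons_of_mem (hi : i ∈ J) (l : List ι) (f : E → ℂ) :
    dirDerivs v (i :: l) J f = fun y => lineDeriv ℂ (dirDerivs v l J f) y (v i) :=
  opListProd_cons_of_mem _ hi l f

theorem dirDerivs_cons_of_notMem (hi : i ∉ J) (l : List ι) (f : E → ℂ) :
    dirDerivs v (i :: l) J f = dirDerivs v l J f :=
  opListProd_cons_of_notMem _ hi l f

theorem dirDerivs_insert_of_notMem {l : List ι} (hi : i ∉ l) (J : Finset ι) (f : E → ℂ) :
    dirDerivs v l (insert i J) f = dirDerivs v l J f :=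
  opListProd_insert_of_notMem _ hi J f

theorem dirDerivs_congr {f g : E → ℂ} {x : E} (h : f =ᶠ[𝓝 x] g) (v : ι → E) (l : List ι)
    (J : Finset ι) : dirDerivs v l J f =ᶠ[𝓝 x] dirDerivs v l J g := by
  induction l with
  | nil => exact h
  | cons i l ih =>
    by_cases hi : i ∈ J
    · rw [dirDerivs_cons_of_mem hi, dirDerivs_cons_of_mem hi]
      filter_upwards [ih.eventuallyEq_nhds] with y hy using hy.lineDeriv_eq
    · rwa [dirDerivs_cons_of_notMem hi, dirDerivs_cons_of_notMem hi]

theorem HolAt.dirDerivs [FiniteDimensional ℂ E] {f : E → ℂ} {x : E} (hf : HolAt f x)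
    (v : ι → E) (l : List ι) (J : Finset ι) : HolAt (dirDerivs v l J f) x := by
  induction l with
  | nil => exact hf
  | cons i l ih =>
    by_cases hi : i ∈ J
    · rw [dirDerivs_cons_of_mem hi]
      exact ih.lineDeriv (v i)
    · rwa [dirDerivs_cons_of_notMem hi]

theorem HolAt.divDiffs [FiniteDimensional ℂ E] {G : ℂ × E → ℂ} {x : E} (hG : HolAt G (0, x))
    (v : ι → E) (l : List ι) (J : Finset ι) : HolAt (divDiffs v l J G) (0, x) := by
  induction l with
  | nil => exact hG
  | cons i l ih =>
    rw [EllipticCM.divDiffs] at ih ⊢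
    by_cases hi : i ∈ J
    · rw [opListProd_cons_of_mem _ hi]
      exact ih.divDiff (v i)
    · rwa [opListProd_cons_of_notMem _ hi]

theorem divDiffs_zero (v : ι → E) (l : List ι) (J : Finset ι) (G : ℂ × E → ℂ) (y : E) :
    divDiffs v l J G (0, y) = dirDerivs v l J (fun y => G (0, y)) y := by
  induction l generalizing y with
  | nil => rfl
  | cons i l ih =>
    rw [divDiffs] at ih ⊢
    by_cases hi : i ∈ J
    · rw [opListProd_cons_of_mem _ hi, dirDerivs_cons_of_mem hi, divDiff, if_pos rfl]
      simp only [ih]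
    · rw [opListProd_cons_of_notMem _ hi, dirDerivs_cons_of_notMem hi, ih]

theorem tendsto_divDiffs [FiniteDimensional ℂ E] {f : E → ℂ} {x : E} (hf : HolAt f x)
    (v : ι → E) (l : List ι) (J : Finset ι) :
    Tendsto (fun h : ℂ => divDiffs v l J (fun p => f p.2) (h, x)) (𝓝[≠] 0)
      (𝓝 (dirDerivs v l J f x)) := by
  have hconst : HolAt (fun p : ℂ × E => f p.2) (0, x) := hf.comp (g := Prod.snd) differentiable_snd
  have hlim := (hconst.divDiffs v l J).tendsto_nhdsNE
  rwa [divDiffs_zero] at hlim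

end DirDerivs

/-! ### The Leibniz rule -/

section LineDeriv

variable {E E' ι : Type*} [NormedAddCommGroup E] [NormedSpace ℂ E] [NormedAddCommGroup E']
  [NormedSpace ℂ E']

theorem differentiableAt_comp_line {f : E → ℂ} {p : E} (hf : DifferentiableAt ℂ f p) (v : E) :
    DifferentiableAt ℂ (fun t : ℂ => f (p + t • v)) 0 := by
  refine DifferentiableAt.comp (g := f) (f := fun t : ℂ => p + t • v) 0 ?_ (by fun_prop)
  simpa only [zero_smul, add_zero] using hf

theorem lineDeriv_const_mul (c : ℂ) (f : E → ℂ) (p v : E) :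
    lineDeriv ℂ (fun y => c * f y) p v = c * lineDeriv ℂ f p v :=
  deriv_const_mul_field c

theorem lineDeriv_sum {s : Finset ι} {f : ι → E → ℂ} {p : E}
    (hf : ∀ i ∈ s, DifferentiableAt ℂ (f i) p) (v : E) :
    lineDeriv ℂ (fun p => ∑ i ∈ s, f i p) p v = ∑ i ∈ s, lineDeriv ℂ (f i) p v :=
  deriv_fun_sum fun i hi => differentiableAt_comp_line (hf i hi) v

theorem lineDeriv_mul_prod {a : E → ℂ} {b : E' → ℂ} {p : E × E'} (ha : DifferentiableAt ℂ a p.1)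
    (hb : DifferentiableAt ℂ b p.2) (v : E) (w : E') :
    lineDeriv ℂ (fun p : E × E' => a p.1 * b p.2) p (v, w) =
      lineDeriv ℂ a p.1 v * b p.2 + a p.1 * lineDeriv ℂ b p.2 w := by
  have hmul := deriv_fun_mul (differentiableAt_comp_line ha v) (differentiableAt_comp_line hb w)
  simp only [zero_smul, add_zero] at hmul
  exact hmul

theorem lineDeriv_sum_mul_prod {s : Finset ι} {a : ι → E → ℂ} {b : ι → E' → ℂ} {p : E × E'}
    (ha : ∀ i ∈ s, DifferentiableAt ℂ (a i) p.1) (hb : ∀ i ∈ s, DifferentiableAt ℂ (b i) p.2)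
    (v : E) (w : E') :
    lineDeriv ℂ (fun p : E × E' => ∑ i ∈ s, a i p.1 * b i p.2) p (v, w) =
      ∑ i ∈ s, (a i p.1 * lineDeriv ℂ (b i) p.2 w + lineDeriv ℂ (a i) p.1 v * b i p.2) := by
  have hab : ∀ i ∈ s, DifferentiableAt ℂ (fun p : E × E' => a i p.1 * b i p.2) p := fun i hi =>
    ((ha i hi).comp p differentiableAt_fst).mul ((hb i hi).comp p differentiableAt_snd)
  rw [lineDeriv_sum hab]
  exact Finset.sum_congr rfl fun i hi => by rw [lineDeriv_mul_prod (ha i hi) (hb i hi), add_comm]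

end LineDeriv

section Leibniz

variable {ι E E' : Type*} [DecidableEq ι] [NormedAddCommGroup E] [NormedSpace ℂ E]
  [NormedAddCommGroup E'] [NormedSpace ℂ E']

theorem dirDerivs_cons_sum_powerset_insert {v : ι → E} {w : ι → E'} {i : ι} {l : List ι}
    {J : Finset ι} (hil : i ∉ l) (hiJ : i ∉ J) (a : E → ℂ) (b : E' → ℂ) (p : E × E') :
    ∑ K ∈ (insert i J).powerset,
        dirDerivs v (i :: l) K a p.1 * dirDerivs w (i :: l) (insert i J \ K) b p.2 =
      ∑ K ∈ J.powerset,
        (dirDerivs v l K a p.1 * lineDeriv ℂ (dirDerivs w l (J \ K) b) p.2 (w i) +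
          lineDeriv ℂ (dirDerivs v l K a) p.1 (v i) * dirDerivs w l (J \ K) b p.2) := by
  rw [Finset.sum_powerset_insert hiJ, ← Finset.sum_add_distrib]
  refine Finset.sum_congr rfl fun K hK => ?_
  have hiK : i ∉ K := fun h => hiJ (Finset.mem_powerset.mp hK h)
  have hiJK : i ∉ J \ K := fun h => hiJ (Finset.mem_sdiff.mp h).1
  have hsdiff : insert i J \ insert i K = J \ K := by
    rw [Finset.insert_sdiff_insert, Finset.sdiff_insert, Finset.erase_eq_of_notMem hiJK]
  rw [Finset.insert_sdiff_of_notMem _ hiK, hsdiff, dirDerivs_cons_of_notMem hiK,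
    dirDerivs_cons_of_notMem hiJK, dirDerivs_cons_of_mem (Finset.mem_insert_self i K),
    dirDerivs_cons_of_mem (Finset.mem_insert_self i (J \ K)), dirDerivs_insert_of_notMem hil,
    dirDerivs_insert_of_notMem hil]

theorem dirDerivs_mul [FiniteDimensional ℂ E] [FiniteDimensional ℂ E'] {a : E → ℂ} {b : E' → ℂ}
    {x : E} {y : E'} (ha : HolAt a x) (hb : HolAt b y) (v : ι → E) (w : ι → E')
    {l : List ι} (hl : l.Nodup) {J : Finset ι} (hJ : J ⊆ l.toFinset) :
    dirDerivs (fun i => (v i, w i)) l J (fun p : E × E' => a p.1 * b p.2) =ᶠ[𝓝 (x, y)]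
      fun p => ∑ K ∈ J.powerset, dirDerivs v l K a p.1 * dirDerivs w l (J \ K) b p.2 := by
  induction l generalizing J with
  | nil =>
    obtain rfl : J = ∅ := Finset.subset_empty.mp hJ
    exact .of_forall fun p => (Finset.sum_singleton _ _).symm
  | cons i l ih =>
    obtain ⟨hil, hl⟩ := List.nodup_cons.mp hl
    rw [List.toFinset_cons, Finset.subset_insert_iff] at hJ
    by_cases hi : i ∈ J
    · have hev_a : ∀ᶠ p : E × E' in 𝓝 (x, y), ∀ K ∈ (J.erase i).powerset,
          DifferentiableAt ℂ (dirDerivs v l K a) p.1 :=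
        (Filter.eventually_all_finset _).mpr fun K _ =>
          continuous_fst.continuousAt.eventually (ha.dirDerivs v l K)
      have hev_b : ∀ᶠ p : E × E' in 𝓝 (x, y), ∀ K ∈ (J.erase i).powerset,
          DifferentiableAt ℂ (dirDerivs w l (J.erase i \ K) b) p.2 :=
        (Filter.eventually_all_finset _).mpr fun K _ =>
          continuous_snd.continuousAt.eventually (hb.dirDerivs w l (J.erase i \ K))
      filter_upwards [(ih hl hJ).eventuallyEq_nhds, hev_a, hev_b] with p hp hpa hpb
      rw [← Finset.insert_erase hi, dirDerivs_cons_of_mem (Finset.mem_insert_self i _),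
        dirDerivs_insert_of_notMem hil,
        dirDerivs_cons_sum_powerset_insert hil (Finset.notMem_erase i J),
        ← lineDeriv_sum_mul_prod hpa hpb]
      exact hp.lineDeriv_eq
    · rw [Finset.erase_eq_of_notMem hi] at hJ
      filter_upwards [ih hl hJ] with p hp
      rw [dirDerivs_cons_of_notMem hi, hp]
      refine Finset.sum_congr rfl fun K hK => ?_
      rw [dirDerivs_cons_of_notMem fun h => hi (Finset.mem_powerset.mp hK h),
        dirDerivs_cons_of_notMem fun h => hi (Finset.mem_sdiff.mp h).1]

theorem dirDerivs_smul (v : ι → E) (c : ℂ) (l : List ι) (J : Finset ι) (f : E → ℂ) :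
    dirDerivs (fun i => c • v i) l J f =
      fun y => c ^ l.countP (· ∈ J) * dirDerivs v l J f y := by
  induction l with
  | nil =>
    funext y
    rw [List.countP_nil, pow_zero, one_mul, dirDerivs_nil, dirDerivs_nil]
  | cons i l ih =>
    by_cases hi : i ∈ J
    · rw [dirDerivs_cons_of_mem hi, dirDerivs_cons_of_mem hi, ih,
        List.countP_cons_of_pos (by simpa only [decide_eq_true_eq] using hi)]
      funext y
      rw [lineDeriv_smul, smul_eq_mul, lineDeriv_const_mul, pow_succ', mul_assoc]
    · rw [dirDerivs_cons_of_notMem hi, dirDerivs_cons_of_notMem hi, ih,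
        List.countP_cons_of_neg (by simpa only [decide_eq_true_eq] using hi)]

theorem dirDerivs_one (l : List ι) (J : Finset ι) (f : ℂ → ℂ) :
    dirDerivs (fun _ => (1 : ℂ)) l J f = iteratedDeriv (l.countP (· ∈ J)) f := by
  induction l with
  | nil => rw [List.countP_nil, iteratedDeriv_zero, dirDerivs_nil]
  | cons i l ih =>
    by_cases hi : i ∈ J
    · rw [dirDerivs_cons_of_mem hi, ih,
        List.countP_cons_of_pos (by simpa only [decide_eq_true_eq] using hi), iteratedDeriv_succ]
      funext y
      unfold lineDeriv
      simp only [smul_eq_mul, mul_one]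
      rw [deriv_comp_const_add, add_zero]
    · rw [dirDerivs_cons_of_notMem hi, ih,
        List.countP_cons_of_neg (by simpa only [decide_eq_true_eq] using hi)]

theorem dirDerivs_sum [FiniteDimensional ℂ E] {κ : Type*} {s : Finset κ} {f : κ → E → ℂ} {x : E}
    (hf : ∀ k ∈ s, HolAt (f k) x) (v : ι → E) (l : List ι) (J : Finset ι) :
    dirDerivs v l J (fun y => ∑ k ∈ s, f k y) =ᶠ[𝓝 x]
      fun y => ∑ k ∈ s, dirDerivs v l J (f k) y := by
  induction l with
  | nil => rfl
  | cons i l ih =>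
    by_cases hi : i ∈ J
    · have hev : ∀ᶠ y in 𝓝 x, ∀ k ∈ s, DifferentiableAt ℂ (dirDerivs v l J (f k)) y :=
        (Filter.eventually_all_finset _).mpr fun k hk => (hf k hk).dirDerivs v l J
      filter_upwards [ih.eventuallyEq_nhds, hev] with y hy hdiff
      simp only [dirDerivs_cons_of_mem hi]
      rw [hy.lineDeriv_eq, lineDeriv_sum hdiff]
    · simpa only [dirDerivs_cons_of_notMem hi] using ih

theorem dirDerivs_const_mul (c : ℂ) (v : ι → E) (l : List ι) (J : Finset ι) (f : E → ℂ) :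
    dirDerivs v l J (fun y => c * f y) = fun y => c * dirDerivs v l J f y := by
  induction l with
  | nil => rfl
  | cons i l ih =>
    by_cases hi : i ∈ J
    · simp only [dirDerivs_cons_of_mem hi, ih, lineDeriv_const_mul]
    · simp only [dirDerivs_cons_of_notMem hi, ih]

theorem countP_mem_of_nodup {l : List ι} (hl : l.Nodup) {J : Finset ι} (hJ : J ⊆ l.toFinset) :
    l.countP (· ∈ J) = J.card := by
  rw [List.countP_eq_length_filter, ← List.toFinset_card_of_nodup (hl.filter _)]
  congr 1
  ext i
  simpa using @hJ i

end Leibniz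

theorem countP_mem_finRange {n : ℕ} (J : Finset (Fin n)) :
    (List.finRange n).countP (· ∈ J) = J.card :=
  countP_mem_of_nodup (List.nodup_finRange n) (List.toFinset_finRange n ▸ J.subset_univ)

/-! ### Symbols of operators -/

/-- The linear functional on polynomials that sends the monomial `X^m` to `a m`: it turns the
symbol of an operator into the value of that operator. -/
def monomialFunctional {σ R : Type*} [CommSemiring R] (a : (σ →₀ ℕ) → R) :
    MvPolynomial σ R →ₗ[R] R :=
  (MvPolynomial.basisMonomials σ R).constr R a

section MonomialFunctional

variable {σ R : Type*} [CommSemiring R] (a : (σ →₀ ℕ) → R)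

theorem monomialFunctional_monomial (m : σ →₀ ℕ) (c : R) :
    monomialFunctional a (MvPolynomial.monomial m c) = c * a m := by
  have hbasis : MvPolynomial.monomial m c = c • MvPolynomial.basisMonomials σ R m := by
    rw [MvPolynomial.coe_basisMonomials, MvPolynomial.smul_monomial, smul_eq_mul, mul_one]
  rw [hbasis, map_smul, monomialFunctional, Module.Basis.constr_basis, smul_eq_mul]

theorem monomialFunctional_C_mul (c : R) (p : MvPolynomial σ R) :
    monomialFunctional a (MvPolynomial.C c * p) = c * monomialFunctional a p := by
  rw [← MvPolynomial.smul_eq_C_mul, map_smul, smul_eq_mul]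

theorem monomialFunctional_apply (p : MvPolynomial σ R) :
    monomialFunctional a p = ∑ m ∈ p.support, p.coeff m * a m := by
  conv_lhs => rw [p.as_sum]
  rw [map_sum]
  exact Finset.sum_congr rfl fun m _ => monomialFunctional_monomial a m _

theorem monomialFunctional_prod_X (J : Finset σ) :
    monomialFunctional a (∏ i ∈ J, MvPolynomial.X i) = a (∑ i ∈ J, Finsupp.single i 1) := by
  have hprod : (∏ i ∈ J, MvPolynomial.X i : MvPolynomial σ R) =
      MvPolynomial.monomial (∑ i ∈ J, Finsupp.single i 1) 1 := by
    rw [MvPolynomial.monomial_sum_one]; rfl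
  rw [hprod, monomialFunctional_monomial, one_mul]

end MonomialFunctional

section NormalOp

variable {n : ℕ} {S : Submodule ℂ (Fin n → ℂ)}

/-- The symbol of a normally ordered expression at a point `x`: the polynomial obtained by
evaluating all coefficient functions at `x`. -/
def symbolAt (x : S) : OpSymbol S →+* MvPolynomial (Fin n) ℂ :=
  MvPolynomial.map (Pi.evalRingHom (fun _ : S => ℂ) x)

theorem normalOp_eq_monomialFunctional (A : Fin n → (S → ℂ) → S → ℂ) (p : OpSymbol S) (f : S → ℂ)
    (x : S) :
    normalOp A p f x = monomialFunctional (fun m => opMonomial A m f x) (symbolAt x p) := by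
  rw [normalOp, monomialFunctional_apply]
  refine (Finset.sum_subset_zero_on_sdiff (MvPolynomial.support_map_subset _ _) ?_ ?_).symm
  · intro m hm
    have hcoeff := (Finset.mem_sdiff.mp hm).2
    rw [MvPolynomial.notMem_support_iff, MvPolynomial.coeff_map] at hcoeff
    rw [show p.coeff m x = 0 from hcoeff, zero_mul]
  · intro m _
    rw [symbolAt, MvPolynomial.coeff_map]
    rfl

theorem monomialFunctional_opMonomial_prod_X (A : Fin n → (S → ℂ) → S → ℂ) (J : Finset (Fin n))
    (f : S → ℂ) (x : S) :
    monomialFunctional (fun m => opMonomial A m f x) (∏ i ∈ J, MvPolynomial.X i) =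
      opProd A J f x := by
  have hind : ⇑(∑ i ∈ J, Finsupp.single i 1 : Fin n →₀ ℕ) = fun i => if i ∈ J then 1 else 0 := by
    funext i
    simp only [Finsupp.finsetSum_apply, Finsupp.single_apply, Finset.sum_ite_eq']
  rw [monomialFunctional_prod_X, opProd, hind]

theorem opProd_empty (A : Fin n → (S → ℂ) → S → ℂ) (f : S → ℂ) : opProd A ∅ f = f := by
  rw [opProd_eq_opListProd, opListProd_empty]

theorem opProd_singleton (A : Fin n → (S → ℂ) → S → ℂ) (i : Fin n) (f : S → ℂ) :
    opProd A {i} f = A i f := by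
  rw [opProd_eq_opListProd,
    opListProd_singleton A (List.nodup_finRange n) (List.mem_finRange i)]

theorem opProd_pd (e : Fin n → S) (J : Finset (Fin n)) (f : S → ℂ) :
    opProd (pd e) J f = dirDerivs e (List.finRange n) J f :=
  opProd_eq_opListProd _ _ _

theorem opProd_smul_pd (e : Fin n → S) (a : ℂ) (J : Finset (Fin n)) (f : S → ℂ) (x : S) :
    opProd (fun i g => a • pd e i g) J f x = a ^ J.card * dirDerivs e (List.finRange n) J f x := by
  have hpd : (fun (i : Fin n) (g : S → ℂ) => a • pd e i g) = pd fun i => a • e i := by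
    funext i g y
    rw [pd, lineDeriv_smul]
    rfl
  rw [hpd, opProd_pd, dirDerivs_smul, countP_mem_finRange]

end NormalOp

/-! ### Divided differences as combinations of shifts -/

section ShiftValues

variable {ι E : Type*}

/-- The values of a function at the points `p + h ∑ m_i v_i`, that is, the values at `p` of its
images under the monomials in the shifts by `h v_i`. -/
def shiftValues [AddCommGroup E] [Module ℂ E] (f : E → ℂ) (h : ℂ) (v : ι → E) (p : E)
    (m : ι →₀ ℕ) : ℂ :=
  f (p + h • Finsupp.linearCombination ℕ v m)

theorem shiftValues_sum_single [AddCommGroup E] [Module ℂ E] (f : E → ℂ) (h : ℂ) (v : ι → E)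
    (p : E) (J : Finset ι) :
    shiftValues f h v p (∑ i ∈ J, Finsupp.single i 1) = f (p + h • ∑ i ∈ J, v i) := by
  simp only [shiftValues, map_sum, Finsupp.linearCombination_single, one_smul]

theorem iterate_shift {n : ℕ} {S : Submodule ℂ (Fin n → ℂ)} (e : Fin n → S) (h : ℂ) (i : Fin n)
    (k : ℕ) (f : S → ℂ) (x : S) : (shift e h i)^[k] f x = f (x + h • (k • e i)) := by
  induction k generalizing f x with
  | zero => rw [Function.iterate_zero, id_eq, zero_smul, smul_zero, add_zero]
  | succ k ih => rw [Function.iterate_succ_apply, ih, shift, succ_nsmul, smul_add, add_assoc]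

theorem opMonomial_shift {n : ℕ} {S : Submodule ℂ (Fin n → ℂ)} (e : Fin n → S) (h : ℂ)
    (m : Fin n →₀ ℕ) (f : S → ℂ) (x : S) :
    opMonomial (shift e h) m f x = shiftValues f h e x m := by
  have hfoldr : ∀ (l : List (Fin n)) (x : S),
      l.foldr (fun i g => (shift e h i)^[m i] g) f x =
        f (x + h • (l.map fun i => m i • e i).sum) := by
    intro l
    induction l with
    | nil => intro x; rw [List.foldr_nil, List.map_nil, List.sum_nil, smul_zero, add_zero]
    | cons i l ih =>
      intro x
      rw [List.foldr_cons, iterate_shift, ih, List.map_cons, List.sum_cons, smul_add, add_assoc]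
  rw [opMonomial, hfoldr, shiftValues, Finsupp.linearCombination_apply,
    Finsupp.sum_fintype _ _ fun i => zero_smul ℕ (e i), ← List.ofFn_eq_map, List.sum_ofFn]

theorem monomialFunctional_shiftValues_X_mul [AddCommGroup E] [Module ℂ E] (f : E → ℂ) (h : ℂ)
    (v : ι → E) (p : E) (i : ι) (q : MvPolynomial ι ℂ) :
    monomialFunctional (shiftValues f h v p) (MvPolynomial.X i * q) =
      monomialFunctional (shiftValues f h v (p + h • v i)) q := by
  induction q using MvPolynomial.induction_on' with
  | monomial m c =>
    rw [MvPolynomial.X, MvPolynomial.monomial_mul, one_mul, monomialFunctional_monomial,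
      monomialFunctional_monomial, shiftValues, shiftValues, map_add,
      Finsupp.linearCombination_single, one_smul, smul_add, add_assoc]
  | add p q hp hq => rw [mul_add, map_add, map_add, hp, hq]

/-- The symbol `h⁻¹ (X_i - 1)` of the divided difference `divDiff`. -/
def divDiffSymbol (h : ℂ) (i : ι) : MvPolynomial ι ℂ :=
  MvPolynomial.C h⁻¹ * (MvPolynomial.X i - 1)

theorem prod_divDiffSymbol (h : ℂ) (I : Finset ι) :
    ∏ i ∈ I, divDiffSymbol h i = ∑ K ∈ I.powerset,
      MvPolynomial.C (h⁻¹ ^ I.card * (-1) ^ (I.card - K.card)) * ∏ i ∈ K, MvPolynomial.X i := by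
  classical
  simp only [divDiffSymbol, sub_eq_add_neg]
  rw [Finset.prod_mul_distrib, Finset.prod_const, ← map_pow, Finset.prod_add, Finset.mul_sum]
  refine Finset.sum_congr rfl fun K hK => ?_
  rw [Finset.prod_const, Finset.card_sdiff_of_subset (Finset.mem_powerset.mp hK),
    map_mul, map_pow _ (-1 : ℂ), map_neg, MvPolynomial.C_1]
  ring

variable [DecidableEq ι] [NormedAddCommGroup E] [NormedSpace ℂ E]

theorem divDiffs_eq_monomialFunctional_list {h : ℂ} (hh : h ≠ 0) (v : ι → E) (G : ℂ × E → ℂ)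
    (l : List ι) (J : Finset ι) (p : E) :
    divDiffs v l J G (h, p) = monomialFunctional (shiftValues (fun y => G (h, y)) h v p)
      (l.map fun i => if i ∈ J then divDiffSymbol h i else 1).prod := by
  induction l generalizing p with
  | nil =>
    rw [List.map_nil, List.prod_nil, ← MvPolynomial.C_1, MvPolynomial.C_apply,
      monomialFunctional_monomial, one_mul, shiftValues, map_zero, smul_zero, add_zero]
    rfl
  | cons i l ih =>
    rw [divDiffs] at ih ⊢
    rw [List.map_cons, List.prod_cons]
    by_cases hi : i ∈ J
    · rw [opListProd_cons_of_mem _ hi, if_pos hi, divDiff, if_neg hh, ih, ih, divDiffSymbol,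
        mul_assoc, monomialFunctional_C_mul, sub_mul, one_mul, map_sub,
        monomialFunctional_shiftValues_X_mul, inv_mul_eq_div]
    · rw [opListProd_cons_of_notMem _ hi, if_neg hi, one_mul, ih]

theorem divDiffs_eq_monomialFunctional {h : ℂ} (hh : h ≠ 0) (v : ι → E) (G : ℂ × E → ℂ)
    {l : List ι} (hl : l.Nodup) {J : Finset ι} (hJ : J ⊆ l.toFinset) (p : E) :
    divDiffs v l J G (h, p) = monomialFunctional (shiftValues (fun y => G (h, y)) h v p)
      (∏ i ∈ J, divDiffSymbol h i) := by
  rw [divDiffs_eq_monomialFunctional_list hh, ← List.prod_toFinset _ hl, Finset.prod_ite_mem,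
    Finset.inter_eq_right.mpr hJ]

theorem divDiffs_eq_sum {h : ℂ} (hh : h ≠ 0) (v : ι → E) (G : ℂ × E → ℂ) {l : List ι}
    (hl : l.Nodup) {I : Finset ι} (hI : I ⊆ l.toFinset) (p : E) :
    divDiffs v l I G (h, p) = ∑ K ∈ I.powerset,
      h⁻¹ ^ I.card * (-1) ^ (I.card - K.card) * G (h, p + h • ∑ i ∈ K, v i) := by
  rw [divDiffs_eq_monomialFunctional hh v G hl hI, prod_divDiffSymbol, map_sum]
  refine Finset.sum_congr rfl fun K _ => ?_
  rw [monomialFunctional_C_mul, monomialFunctional_prod_X, shiftValues_sum_single]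

end ShiftValues

/-! ### Sums over subsets -/

section Counting

variable {ι R : Type*} [Fintype ι] [CommSemiring R]

theorem card_filter_subset_powersetCard [DecidableEq ι] {m : ℕ} (hm : m ≤ Fintype.card ι)
    (K : Finset ι) :
    ({I ∈ Finset.univ.powersetCard m | K ⊆ I} : Finset (Finset ι)).card =
      (Fintype.card ι - K.card).choose (Fintype.card ι - m) := by
  rw [← Finset.card_compl, ← Finset.card_powersetCard]
  refine Finset.card_nbij' (fun I => Iᶜ) (fun I => Iᶜ) ?_ ?_ (fun I _ => compl_compl I)
    fun I _ => compl_compl I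
  · intro I hI
    simp only [Finset.coe_filter, Finset.mem_powersetCard_univ, Set.mem_ofPred_eq] at hI
    rw [Finset.mem_coe, Finset.mem_powersetCard, Finset.card_compl, hI.1]
    exact ⟨Finset.compl_subset_compl.mpr hI.2, rfl⟩
  · intro I hI
    rw [Finset.mem_coe, Finset.mem_powersetCard] at hI
    simp only [Finset.coe_filter, Finset.mem_powersetCard_univ, Set.mem_ofPred_eq,
      Finset.card_compl, hI.2]
    exact ⟨Nat.sub_sub_self hm, Finset.subset_compl_comm.mp hI.1⟩

theorem sum_powersetCard_sum_powerset {m : ℕ} (hm : m ≤ Fintype.card ι) (F : Finset ι → R) :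
    ∑ I ∈ Finset.univ.powersetCard m, ∑ K ∈ I.powerset, F K =
      ∑ K, ((Fintype.card ι - K.card).choose (Fintype.card ι - m) : R) * F K := by
  classical
  rw [Finset.sum_comm' (t' := Finset.univ)
    (s' := fun K => {I ∈ Finset.univ.powersetCard m | K ⊆ I})]
  · refine Finset.sum_congr rfl fun K _ => ?_
    rw [Finset.sum_const, card_filter_subset_powersetCard hm, nsmul_eq_mul]
  · simp only [Finset.mem_powerset, Finset.mem_filter, Finset.mem_univ, and_true, implies_true]

theorem sum_powersetCard_sum_sdiff [DecidableEq ι] {d : ℕ} (hd : d ≤ Fintype.card ι) (G : ℕ → R)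
    (F : Finset ι → R) :
    ∑ I ∈ Finset.univ.powersetCard d, ∑ K ∈ I.powerset, G K.card * F (I \ K) =
      ∑ k ∈ Finset.range (d + 1), ((Fintype.card ι - d + k).choose k : R) * G k *
        ∑ I ∈ Finset.univ.powersetCard (d - k), F I := by
  have hreflect : ∀ I ∈ Finset.univ.powersetCard d,
      ∑ K ∈ I.powerset, G K.card * F (I \ K) = ∑ K ∈ I.powerset, G (d - K.card) * F K := by
    intro I hI
    rw [← (Finset.mem_powersetCard_univ.mp hI)]
    refine Finset.sum_nbij' (I \ ·) (I \ ·) ?_ ?_ ?_ ?_ ?_ <;> intro K hK <;>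
      have hKI := Finset.mem_powerset.mp hK
    · exact Finset.mem_powerset.mpr Finset.sdiff_subset
    · exact Finset.mem_powerset.mpr Finset.sdiff_subset
    · exact Finset.sdiff_sdiff_eq_self hKI
    · exact Finset.sdiff_sdiff_eq_self hKI
    · rw [Finset.card_sdiff_of_subset hKI, Nat.sub_sub_self (Finset.card_le_card hKI)]
  rw [Finset.sum_congr rfl hreflect, sum_powersetCard_sum_powerset hd, ← Finset.powerset_univ,
    Finset.sum_powerset, Finset.card_univ,
    ← Finset.sum_subset (Finset.range_subset_range.mpr (Nat.succ_le_succ hd)),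
    ← Finset.sum_range_reflect]
  · refine Finset.sum_congr rfl fun k hk => ?_
    have hkd : k ≤ d := Nat.lt_succ_iff.mp (Finset.mem_range.mp hk)
    rw [Nat.succ_sub_one, Finset.mul_sum]
    refine Finset.sum_congr rfl fun K hK => ?_
    rw [(Finset.mem_powersetCard.mp hK).2, Nat.sub_sub_self hkd,
      show Fintype.card ι - (d - k) = Fintype.card ι - d + k by lia, Nat.choose_symm_add,
      mul_assoc]
  · intro m hm hmd
    have hlt : Fintype.card ι - m < Fintype.card ι - d := by
      rw [Finset.mem_range] at hm hmd
      lia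
    refine Finset.sum_eq_zero fun K hK => ?_
    rw [(Finset.mem_powersetCard.mp hK).2, Nat.choose_eq_zero_of_lt hlt, Nat.cast_zero, zero_mul]

end Counting

/-! ### The commuting Calogero–Moser operators -/

section CalogeroMoser

variable {n : ℕ} {S : Submodule ℂ (Fin n → ℂ)}

theorem differentiable_finsetProd {ι E : Type*} [NormedAddCommGroup E] [NormedSpace ℂ E]
    {s : Finset ι} {g : ι → E → ℂ} (hg : ∀ i ∈ s, Differentiable ℂ (g i)) :
    Differentiable ℂ fun x => ∏ i ∈ s, g i x := by
  classical
  exact fun x => (HasFDerivAt.finsetProd fun i hi => (hg i hi x).hasFDerivAt).differentiableAt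

theorem differentiable_Delta {τ : ℂ} (hτ : 0 < τ.im) : Differentiable ℂ (Delta S τ) := by
  have hcoord : ∀ k, Differentiable ℂ fun x : S => x.1 k := fun k =>
    ((ContinuousLinearMap.proj (R := ℂ) (φ := fun _ : Fin n => ℂ) k).comp
      S.subtypeL).differentiable
  exact differentiable_finsetProd fun i _ => differentiable_finsetProd fun j _ =>
    (differentiable_theta hτ).comp ((hcoord i).sub (hcoord j))

theorem holAt_Delta {τ : ℂ} (hτ : 0 < τ.im) (x : S) : HolAt (Delta S τ) x :=
  .of_forall (differentiable_Delta hτ)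

theorem Delta_ne_zero {τ : ℂ} {x : S} (hx : IsRegular τ x.1) : Delta S τ x ≠ 0 :=
  thetaVandermonde_ne_zero hx

theorem IsDirections.Delta_div_Delta {e : Fin n → S} (he : IsDirections e) (τ b h : ℂ) {x : S}
    (hx : IsRegular τ x.1) (I : Finset (Fin n)) :
    Delta S τ (x + h • ∑ i ∈ I, b • e i) / Delta S τ x =
      shiftCoeff (thetaRatio τ (-(b * h))) I x.1 := by
  rw [← Finset.smul_sum, smul_smul, mul_comm h b]
  exact thetaVandermonde_div_eq_shiftCoeff hx I fun i k => he.add_smul_sum x (b * h) I i k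

/-- The differential operator `∑_{|I| = m} ∑_{J ⊆ I} b^{|J|} (∂^J Δ / Δ) ∂^{I \ J}` of order `m`,
an elliptic Calogero–Moser Hamiltonian. The coupling constant `b` is encoded in the directions
`b e_i` along which `Δ` is differentiated. -/
def calogeroMoserOp (e : Fin n → S) (τ b : ℂ) (m : ℕ) (f : S → ℂ) (x : S) : ℂ :=
  (∑ I ∈ Finset.univ.powersetCard m, ∑ J ∈ I.powerset,
    dirDerivs (fun i => b • e i) (List.finRange n) J (Delta S τ) x *
      dirDerivs e (List.finRange n) (I \ J) f x) / Delta S τ x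

/-- The deformation of `calogeroMoserOp` to a family of difference operators with step `p.1`, in
which divided differences replace the derivatives: by the Leibniz rule `calogeroMoserOp` is the
restriction of `∑_{|I| = m} Δ⁻¹ ∂^I (Δ ⊗ f)` to the diagonal, with `∂_i` along `(b e_i, e_i)`. -/
def ruijsenaarsFamily (e : Fin n → S) (τ b : ℂ) (m : ℕ) (F : ℂ × S → ℂ) (p : ℂ × S) : ℂ :=
  (∑ I ∈ Finset.univ.powersetCard m, divDiffs (fun i => (b • e i, e i)) (List.finRange n) I
    (fun q : ℂ × (S × S) => Delta S τ q.2.1 * F (q.1, q.2.2)) (p.1, (p.2, p.2))) / Delta S τ p.2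

theorem calogeroMoserOp_congr (e : Fin n → S) (τ b : ℂ) (m : ℕ) {f g : S → ℂ} {x : S}
    (h : f =ᶠ[𝓝 x] g) : calogeroMoserOp e τ b m f x = calogeroMoserOp e τ b m g x := by
  unfold calogeroMoserOp
  congr 1
  refine Finset.sum_congr rfl fun I _ => Finset.sum_congr rfl fun J _ => ?_
  rw [(dirDerivs_congr h e _ (I \ J)).self_of_nhds]

theorem HolAt.calogeroMoserOp {τ : ℂ} (hτ : 0 < τ.im) (e : Fin n → S) (b : ℂ) (m : ℕ)
    {f : S → ℂ} {x : S} (hf : HolAt f x) (hx : Delta S τ x ≠ 0) :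
    HolAt (calogeroMoserOp e τ b m f) x := by
  unfold EllipticCM.calogeroMoserOp
  refine HolAt.div (HolAt.sum fun I _ => HolAt.sum fun J _ => ?_) (holAt_Delta hτ x) hx
  exact ((holAt_Delta hτ x).dirDerivs _ _ _).mul (hf.dirDerivs _ _ _)

theorem HolAt.ruijsenaarsFamily {τ : ℂ} (hτ : 0 < τ.im) (e : Fin n → S) (b : ℂ) (m : ℕ)
    {F : ℂ × S → ℂ} {x : S} (hF : HolAt F (0, x)) (hx : Delta S τ x ≠ 0) :
    HolAt (ruijsenaarsFamily e τ b m F) (0, x) := by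
  have hprod : HolAt (fun q : ℂ × (S × S) => Delta S τ q.2.1 * F (q.1, q.2.2)) (0, (x, x)) :=
    ((holAt_Delta hτ _).comp (g := fun q : ℂ × (S × S) => q.2.1) (by fun_prop)).mul
      (HolAt.comp (g := fun q : ℂ × (S × S) => (q.1, q.2.2)) (x := (0, (x, x))) hF (by fun_prop))
  unfold EllipticCM.ruijsenaarsFamily
  refine HolAt.div (HolAt.sum fun I _ => ?_)
    ((holAt_Delta hτ _).comp (g := fun p : ℂ × S => p.2) (by fun_prop)) hx
  exact HolAt.comp (g := fun p : ℂ × S => (p.1, (p.2, p.2))) (x := (0, x))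
    (hprod.divDiffs _ _ I) (by fun_prop)

theorem ruijsenaarsFamily_zero {τ : ℂ} (hτ : 0 < τ.im) (e : Fin n → S) (b : ℂ) (m : ℕ)
    {F : ℂ × S → ℂ} {x : S} (hF : HolAt (fun y => F (0, y)) x) :
    (fun y => ruijsenaarsFamily e τ b m F (0, y)) =ᶠ[𝓝 x]
      calogeroMoserOp e τ b m fun y => F (0, y) := by
  have hleibniz : ∀ᶠ y : S in 𝓝 x, ∀ I ∈ Finset.univ.powersetCard m,
      dirDerivs (fun i => (b • e i, e i)) (List.finRange n) I
        (fun q : S × S => Delta S τ q.1 * F (0, q.2)) (y, y) =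
      ∑ J ∈ I.powerset, dirDerivs (fun i => b • e i) (List.finRange n) J (Delta S τ) y *
        dirDerivs e (List.finRange n) (I \ J) (fun y => F (0, y)) y := by
    rw [Filter.eventually_all_finset]
    intro I _
    have hdiag : ContinuousAt (fun y : S => (y, y)) x := by fun_prop
    exact hdiag.eventually (dirDerivs_mul (holAt_Delta hτ x) hF (fun i => b • e i) e
      (List.nodup_finRange n) (List.toFinset_finRange n ▸ I.subset_univ))
  filter_upwards [hleibniz] with y hy
  rw [ruijsenaarsFamily, calogeroMoserOp]
  congr 1
  exact Finset.sum_congr rfl fun I hI => by rw [divDiffs_zero, hy I hI]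

/-- The weight that turns `shiftSum` into `ruijsenaarsFamily`: the sign and the power of `h` come
from expanding `m` divided differences, the binomial coefficient counts the sets with `m` elements
that contain a given set with `k` elements. -/
def ruijsenaarsWeight (n m : ℕ) (h : ℂ) (k : ℕ) : ℂ :=
  h⁻¹ ^ m * (-1) ^ (m - k) * (n - k).choose (n - m)

theorem IsDirections.ruijsenaarsFamily_eq_shiftSum {e : Fin n → S} (he : IsDirections e)
    (τ b : ℂ) {m : ℕ} (hm : m ≤ n) (F : ℂ × S → ℂ) {h : ℂ} (hh : h ≠ 0) {x : S}
    (hx : IsRegular τ x.1) :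
    ruijsenaarsFamily e τ b m F (h, x) =
      shiftSum e (thetaRatio τ (-(b * h))) h (ruijsenaarsWeight n m h) (fun y => F (h, y)) x := by
  have hexpand : ∀ I ∈ Finset.univ.powersetCard m,
      divDiffs (fun i => (b • e i, e i)) (List.finRange n) I
        (fun q : ℂ × (S × S) => Delta S τ q.2.1 * F (q.1, q.2.2)) (h, (x, x)) =
      ∑ K ∈ I.powerset, h⁻¹ ^ m * (-1) ^ (m - K.card) *
        (Delta S τ (x + h • ∑ i ∈ K, b • e i) * F (h, x + h • ∑ i ∈ K, e i)) := by
    intro I hI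
    rw [divDiffs_eq_sum hh _ _ (List.nodup_finRange n)
      (List.toFinset_finRange n ▸ I.subset_univ), (Finset.mem_powersetCard.mp hI).2]
    refine Finset.sum_congr rfl fun K _ => ?_
    rw [← prod_mk_sum]
    rfl
  rw [ruijsenaarsFamily, Finset.sum_congr rfl hexpand,
    sum_powersetCard_sum_powerset (hm.trans_eq (Fintype.card_fin n).symm), Finset.sum_div, shiftSum,
    Fintype.card_fin]
  refine Finset.sum_congr rfl fun K _ => ?_
  rw [← he.Delta_div_Delta τ b h hx K, ruijsenaarsWeight]
  ring

theorem tendsto_ruijsenaarsFamily_comp {τ : ℂ} (hτ : 0 < τ.im) (e : Fin n → S) (b : ℂ) (m k : ℕ)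
    {f : S → ℂ} {x : S} (hf : HolAt f x) (hx : Delta S τ x ≠ 0) :
    Tendsto
      (fun h : ℂ => ruijsenaarsFamily e τ b m (ruijsenaarsFamily e τ b k fun p => f p.2) (h, x))
      (𝓝[≠] 0) (𝓝 (calogeroMoserOp e τ b m (calogeroMoserOp e τ b k f) x)) := by
  have hconst : HolAt (fun p : ℂ × S => f p.2) (0, x) := hf.comp (g := Prod.snd) differentiable_snd
  have hinner := hconst.ruijsenaarsFamily hτ e b k hx
  have hslice : HolAt (fun y => ruijsenaarsFamily e τ b k (fun p => f p.2) (0, y)) x :=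
    HolAt.comp (g := fun y : S => ((0 : ℂ), y)) hinner (by fun_prop)
  have hvalue : ruijsenaarsFamily e τ b m (ruijsenaarsFamily e τ b k fun p => f p.2) (0, x) =
      calogeroMoserOp e τ b m (calogeroMoserOp e τ b k f) x :=
    (ruijsenaarsFamily_zero hτ e b m hslice).self_of_nhds.trans
      (calogeroMoserOp_congr e τ b m (ruijsenaarsFamily_zero hτ e b k (F := fun p => f p.2) hf))
  rw [← hvalue]
  exact (hinner.ruijsenaarsFamily hτ e b m hx).tendsto_nhdsNE

theorem eventually_isGeneric {ι : Type*} {τ : ℂ} (hτ : 0 < τ.im) {l : ι → ℂ}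
    (hl : IsRegular τ l) (s : Finset ι) : ∀ᶠ h in 𝓝 (0 : ℂ), IsGeneric τ h s l := by
  unfold IsGeneric
  simp only [Filter.eventually_all_finset, Filter.eventually_all]
  intro i _ j _ hij e _
  have hcont : ContinuousAt (fun h : ℂ => theta τ (l i - l j - e * h)) 0 :=
    ((differentiable_theta hτ).continuous.comp (by fun_prop)).continuousAt
  exact hcont.eventually_ne (by simpa only [mul_zero, sub_zero] using hl hij)

theorem IsDirections.isRegular_add_smul_sum {e : Fin n → S} (he : IsDirections e) {τ h : ℂ} {x : S}
    (hx : IsGeneric τ h Finset.univ x.1) (I : Finset (Fin n)) :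
    IsRegular τ (x + h • ∑ i ∈ I, e i).1 := by
  intro i j hij
  have hdiff : (x + h • ∑ i ∈ I, e i).1 i - (x + h • ∑ i ∈ I, e i).1 j = x.1 i - x.1 j -
      (((if j ∈ I then 1 else 0) - if i ∈ I then 1 else 0 : ℤ) : ℂ) * h := by
    rw [he.add_smul_sum]
    push_cast
    ring
  rw [hdiff]
  refine hx i (Finset.mem_univ _) j (Finset.mem_univ _) hij _ ?_
  rw [Finset.mem_Icc]
  split_ifs <;> lia

theorem IsDirections.ruijsenaarsFamily_comp_eq_shiftSum {e : Fin n → S} (he : IsDirections e)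
    (τ b : ℂ) {m k : ℕ} (hm : m ≤ n) (hk : k ≤ n) (f : S → ℂ) {h : ℂ} (hh : h ≠ 0) {x : S}
    (hx : IsRegular τ x.1) (hgen : IsGeneric τ h Finset.univ x.1) :
    ruijsenaarsFamily e τ b m (ruijsenaarsFamily e τ b k fun p => f p.2) (h, x) =
      shiftSum e (thetaRatio τ (-(b * h))) h (ruijsenaarsWeight n m h)
        (shiftSum e (thetaRatio τ (-(b * h))) h (ruijsenaarsWeight n k h) f) x := by
  rw [he.ruijsenaarsFamily_eq_shiftSum τ b hm _ hh hx, shiftSum, shiftSum]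
  refine Finset.sum_congr rfl fun I _ => ?_
  rw [he.ruijsenaarsFamily_eq_shiftSum τ b hk _ hh (he.isRegular_add_smul_sum hgen I)]

theorem IsDirections.calogeroMoserOp_comm {e : Fin n → S} (he : IsDirections e) {τ : ℂ}
    (hτ : 0 < τ.im) (b : ℂ) {m k : ℕ} (hm : m ≤ n) (hk : k ≤ n) {f : S → ℂ} {x : S}
    (hf : HolAt f x) (hx : IsRegular τ x.1) :
    calogeroMoserOp e τ b m (calogeroMoserOp e τ b k f) x =
      calogeroMoserOp e τ b k (calogeroMoserOp e τ b m f) x := by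
  have hΔ := Delta_ne_zero hx
  refine tendsto_nhds_unique (tendsto_ruijsenaarsFamily_comp hτ e b m k hf hΔ)
    ((tendsto_ruijsenaarsFamily_comp hτ e b k m hf hΔ).congr' ?_)
  have htheta : ∀ᶠ h in 𝓝[≠] (0 : ℂ), theta τ h ≠ 0 := by
    simpa using eventually_theta_affine_ne_zero hτ one_ne_zero 0 0
  have htheta_two : ∀ᶠ h in 𝓝[≠] (0 : ℂ), theta τ (2 * h) ≠ 0 := by
    simpa using eventually_theta_affine_ne_zero hτ two_ne_zero 0 0
  filter_upwards [(eventually_isGeneric hτ hx Finset.univ).filter_mono nhdsWithin_le_nhds, htheta,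
    htheta_two, self_mem_nhdsWithin] with h hgen hθ hθ2 hh
  rw [he.ruijsenaarsFamily_comp_eq_shiftSum τ b hk hm f hh hx hgen,
    he.ruijsenaarsFamily_comp_eq_shiftSum τ b hm hk f hh hx hgen]
  exact he.shiftSum_comm hτ _ hθ hθ2 _ _ f hgen

end CalogeroMoser

/-! ### Normally ordered determinants -/

section RowMix

variable {ι R : Type*} [Fintype ι] [DecidableEq ι] [CommRing R]

/-- The determinant of the matrix whose rows in `J` are those of `A`, and the others those of
`B`; these are the coefficients in the expansion of a determinant along sums of rows. -/
def rowMix (J : Finset ι) (A B : ι → ι → R) : R :=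
  Matrix.det (Matrix.of (J.piecewise A B))

theorem det_row_mul_add (Y : ι → R) (A B : ι → ι → R) :
    (Matrix.of fun i j => Y i * A i j + B i j).det = ∑ J, rowMix J A B * ∏ i ∈ J, Y i := by
  have hrows : (Matrix.of fun i j => Y i * A i j + B i j).det =
      Matrix.detRowAlternating.toMultilinearMap ((fun i => Y i • A i) + B) := rfl
  rw [hrows, MultilinearMap.map_add_univ]
  refine Finset.sum_congr rfl fun J _ => ?_
  have hpiecewise : J.piecewise (fun i => Y i • A i) B =
      J.piecewise (fun i => Y i • J.piecewise A B i) (J.piecewise A B) := by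
    funext i
    by_cases hi : i ∈ J <;> simp [hi]
  rw [hpiecewise, MultilinearMap.map_piecewise_smul, smul_eq_mul, mul_comm]
  rfl

theorem rowMix_map {R' : Type*} [CommRing R'] (φ : R →+* R') (J : Finset ι) (A B : ι → ι → R) :
    rowMix J (fun i j => φ (A i j)) (fun i j => φ (B i j)) = φ (rowMix J A B) := by
  rw [rowMix, rowMix, RingHom.map_det]
  congr 1
  ext i j
  by_cases hi : i ∈ J <;> simp [hi]

theorem rowMix_mul (J : Finset ι) (a b : R) (A B : ι → ι → R) :
    rowMix J (fun i j => a * A i j) (fun i j => b * B i j) =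
      a ^ J.card * b ^ (Fintype.card ι - J.card) * rowMix J A B := by
  have hrows : rowMix J (fun i j => a * A i j) (fun i j => b * B i j) =
      (Matrix.of fun i j => J.piecewise (fun _ => a) (fun _ => b) i *
        Matrix.of (J.piecewise A B) i j).det := by
    rw [rowMix]
    congr 1
    ext i j
    by_cases hi : i ∈ J <;> simp [hi]
  rw [hrows, Matrix.det_mul_column, ← rowMix, Finset.prod_piecewise, Finset.prod_const,
    Finset.prod_const, Finset.univ_inter, ← Finset.compl_eq_univ_sdiff, Finset.card_compl]

theorem tendsto_rowMix [TopologicalSpace R] [IsTopologicalRing R] {α : Type*} {F : Filter α}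
    (J : Finset ι) {A B : α → ι → ι → R} {A' B' : ι → ι → R}
    (hA : ∀ i j, Tendsto (fun a => A a i j) F (𝓝 (A' i j)))
    (hB : ∀ i j, Tendsto (fun a => B a i j) F (𝓝 (B' i j))) :
    Tendsto (fun a => rowMix J (A a) (B a)) F (𝓝 (rowMix J A' B')) := by
  have hdet : Continuous fun M : Matrix ι ι R => M.det := Continuous.matrix_det continuous_id
  refine (hdet.tendsto _).comp (tendsto_pi_nhds.mpr fun i => tendsto_pi_nhds.mpr fun j => ?_)
  by_cases hi : i ∈ J
  · simpa [hi] using hA i j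
  · simpa [hi] using hB i j

end RowMix

section NormalDet

variable {n : ℕ} {S : Submodule ℂ (Fin n → ℂ)}

theorem symbolAt_C (x : S) (a : S → ℂ) :
    symbolAt x (MvPolynomial.C a) = MvPolynomial.C (a x) := by
  rw [symbolAt, MvPolynomial.map_C]
  rfl

theorem symbolAt_X (x : S) (i : Fin n) :
    symbolAt x (MvPolynomial.X i) = MvPolynomial.X i := by
  rw [symbolAt, MvPolynomial.map_X]

theorem smul_opSymbol (t : ℂ) (p : OpSymbol S) :
    t • p = MvPolynomial.C (fun _ : S => t) * p := by
  rw [← MvPolynomial.smul_eq_C_mul]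
  ext m
  simp only [MvPolynomial.coeff_smul]
  rfl

theorem symbolAt_smul (x : S) (t : ℂ) (p : OpSymbol S) :
    symbolAt x (t • p) = MvPolynomial.C t * symbolAt x p := by
  rw [smul_opSymbol, map_mul, symbolAt_C]

theorem symbolAt_one_apply (x : S) (i j : Fin n) :
    symbolAt x ((1 : Matrix (Fin n) (Fin n) (OpSymbol S)) i j) =
      MvPolynomial.C (if i = j then 1 else 0) := by
  rw [Matrix.one_apply]
  split_ifs <;> simp

theorem normalDet_eq_sum (A : Fin n → (S → ℂ) → S → ℂ) (N : Matrix (Fin n) (Fin n) (OpSymbol S))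
    (f : S → ℂ) (x : S) {Y : Fin n → MvPolynomial (Fin n) ℂ} {a b : Fin n → Fin n → ℂ}
    (hN : ∀ i j, symbolAt x (N i j) = Y i * MvPolynomial.C (a i j) + MvPolynomial.C (b i j)) :
    normalDet A N f x =
      ∑ J, rowMix J a b * monomialFunctional (fun m => opMonomial A m f x) (∏ i ∈ J, Y i) := by
  have hmap : (symbolAt x).mapMatrix N = Matrix.of fun i j =>
      Y i * MvPolynomial.C (a i j) + MvPolynomial.C (b i j) := by
    ext1 i j
    exact hN i j
  rw [normalDet, normalOp_eq_monomialFunctional, RingHom.map_det, hmap,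
    det_row_mul_add Y (fun i j => MvPolynomial.C (a i j)) fun i j => MvPolynomial.C (b i j),
    map_sum]
  refine Finset.sum_congr rfl fun J _ => ?_
  rw [rowMix_map MvPolynomial.C, monomialFunctional_C_mul]

end NormalDet

/-! ### The Lax matrix and its differential limit -/

section Lax

variable {n : ℕ} {S : Submodule ℂ (Fin n → ℂ)}

theorem laxCoeff_eq_lagrange (τ c u h : ℂ) (i j : Fin n) (x : S) :
    laxCoeff τ c u h i j x = lagrange τ u x.1 j (x.1 i - c * h / n) := by
  unfold laxCoeff lagrange
  congr 2
  · congr 1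
    ring
  · funext k
    congr 2
    ring

theorem laxCoeff_zero {τ c u : ℂ} (hu : theta τ u ≠ 0) {x : S} (hx : IsRegular τ x.1)
    (i j : Fin n) : laxCoeff τ c u 0 i j x = if i = j then 1 else 0 := by
  rw [laxCoeff_eq_lagrange, mul_zero, zero_div, sub_zero, lagrange_node hu hx]

theorem differentiable_laxCoeff {τ : ℂ} (hτ : 0 < τ.im) (c u : ℂ) (i j : Fin n) (x : S) :
    Differentiable ℂ fun h => laxCoeff τ c u h i j x := by
  have htheta : ∀ b : ℂ, Differentiable ℂ fun h : ℂ => theta τ (c * h / n + b) := fun b =>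
    (differentiable_theta hτ).comp (by fun_prop)
  unfold laxCoeff
  simp only [add_assoc]
  exact ((htheta _).div_const _).mul
    (differentiable_finsetProd fun k _ => (htheta _).div_const _)

/-- The matrix of the zeroth order terms of `laxDeriv` at the point `x`: the derivative at `ħ = 0`
of the coefficients of the Lax matrix. -/
def laxSlope (τ c u : ℂ) (x : S) (i j : Fin n) : ℂ :=
  deriv (fun h => laxCoeff τ c u h i j x) 0

theorem hasDerivAt_laxCoeff {τ : ℂ} (hτ : 0 < τ.im) (c u : ℂ) (i j : Fin n) (x : S) :
    HasDerivAt (fun h => laxCoeff τ c u h i j x) (laxSlope τ c u x i j) 0 :=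
  (differentiable_laxCoeff hτ c u i j x 0).hasDerivAt

theorem symbolAt_lax (τ c u h : ℂ) (x : S) (i j : Fin n) :
    symbolAt x (lax S τ c u h i j) =
      MvPolynomial.C (laxCoeff τ c u h i j x) * MvPolynomial.X i := by
  rw [lax, Matrix.of_apply, map_mul, symbolAt_C, symbolAt_X]

theorem symbolAt_laxDeriv (τ c u : ℂ) (x : S) (i j : Fin n) :
    symbolAt x (laxDeriv S τ c u i j) = MvPolynomial.X i * MvPolynomial.C (if i = j then 1 else 0) +
      MvPolynomial.C (laxSlope τ c u x i j) := by
  rw [laxDeriv, Matrix.of_apply, map_add, symbolAt_C, add_comm]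
  congr 1
  split_ifs <;> simp [symbolAt_X]

theorem normalOp_lax (e : Fin n → S) (τ c u h : ℂ) (i j : Fin n) (f : S → ℂ) (x : S) :
    normalOp (shift e h) (lax S τ c u h i j) f x = laxCoeff τ c u h i j x * f (x + h • e i) := by
  rw [normalOp_eq_monomialFunctional, symbolAt_lax, monomialFunctional_C_mul,
    ← Finset.prod_singleton MvPolynomial.X i, monomialFunctional_opMonomial_prod_X,
    opProd_singleton, shift]

theorem normalOp_laxDeriv (e : Fin n → S) (τ c u : ℂ) (i j : Fin n) (f : S → ℂ) (x : S) :
    normalOp (pd e) (laxDeriv S τ c u i j) f x =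
      (if i = j then 1 else 0) * lineDeriv ℂ f x (e i) + laxSlope τ c u x i j * f x := by
  rw [normalOp_eq_monomialFunctional, symbolAt_laxDeriv, map_add, mul_comm (MvPolynomial.X i),
    monomialFunctional_C_mul, ← Finset.prod_singleton MvPolynomial.X i,
    monomialFunctional_opMonomial_prod_X, opProd_singleton, pd,
    ← mul_one (MvPolynomial.C (laxSlope τ c u x i j)), monomialFunctional_C_mul,
    ← Finset.prod_empty (f := MvPolynomial.X), monomialFunctional_opMonomial_prod_X, opProd_empty]

theorem hasDerivAt_normalOp_lax {τ : ℂ} (hτ : 0 < τ.im) (c : ℂ) {u : ℂ} (hu : theta τ u ≠ 0)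
    (e : Fin n → S) {f : S → ℂ} {x : S} (hf : DifferentiableAt ℂ f x) (hx : IsRegular τ x.1)
    (i j : Fin n) :
    HasDerivAt (fun h : ℂ => normalOp (shift e h) (lax S τ c u h i j) f x)
      (normalOp (pd e) (laxDeriv S τ c u i j) f x) 0 := by
  simp only [normalOp_lax, normalOp_laxDeriv]
  have hline : HasDerivAt (fun h : ℂ => f (x + h • e i)) (lineDeriv ℂ f x (e i)) 0 :=
    hf.lineDifferentiableAt.hasLineDerivAt
  have hmul := (hasDerivAt_laxCoeff hτ c u i j x).mul hline
  rw [laxCoeff_zero hu hx, zero_smul, add_zero] at hmul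
  rwa [add_comm]

theorem normalDet_laxDeriv (e : Fin n → S) (τ c u t : ℂ) (f : S → ℂ) (x : S) :
    normalDet (pd e) (laxDeriv S τ c u - t • 1) f x =
      ∑ J, rowMix J (fun i j => if i = j then 1 else 0)
        (fun i j => laxSlope τ c u x i j - t * if i = j then 1 else 0) *
          dirDerivs e (List.finRange n) J f x := by
  rw [normalDet_eq_sum (pd e) _ f x (Y := MvPolynomial.X)
    (a := fun i j => if i = j then 1 else 0)
    (b := fun i j => laxSlope τ c u x i j - t * if i = j then 1 else 0)]
  · simp only [monomialFunctional_opMonomial_prod_X, opProd_pd]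
  · intro i j
    rw [Matrix.sub_apply, Matrix.smul_apply, map_sub, symbolAt_laxDeriv, symbolAt_smul,
      symbolAt_one_apply, MvPolynomial.C_sub, MvPolynomial.C_mul]
    ring

theorem symbolAt_lax_sub (τ c u h t : ℂ) (x : S) (i j : Fin n) :
    symbolAt x ((h⁻¹ • (lax S τ c u h - (1 + h * t) • 1)) i j) =
      MvPolynomial.C h⁻¹ * (MvPolynomial.C (laxCoeff τ c u h i j x) * MvPolynomial.X i -
        MvPolynomial.C (1 + h * t) * MvPolynomial.C (if i = j then 1 else 0)) := by
  rw [Matrix.smul_apply, Matrix.sub_apply, Matrix.smul_apply, symbolAt_smul, map_sub, symbolAt_lax,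
    symbolAt_smul, symbolAt_one_apply]

theorem normalDet_lax_eq_sum_divDiffs (e : Fin n → S) (τ c u t : ℂ) {h : ℂ} (hh : h ≠ 0)
    (f : S → ℂ) (x : S) :
    normalDet (shift e h) (h⁻¹ • (lax S τ c u h - (1 + h * t) • 1)) f x =
      ∑ J, rowMix J (fun i j => laxCoeff τ c u h i j x)
        (fun i j => h⁻¹ * (laxCoeff τ c u h i j x - if i = j then 1 else 0) -
          t * if i = j then 1 else 0) *
        divDiffs e (List.finRange n) J (fun p => f p.2) (h, x) := by
  rw [normalDet_eq_sum (shift e h) _ f x (Y := divDiffSymbol h)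
    (a := fun i j => laxCoeff τ c u h i j x)
    (b := fun i j => h⁻¹ * (laxCoeff τ c u h i j x - if i = j then 1 else 0) -
      t * if i = j then 1 else 0)]
  · refine Finset.sum_congr rfl fun J _ => ?_
    rw [divDiffs_eq_monomialFunctional hh _ _ (List.nodup_finRange n)
      (List.toFinset_finRange n ▸ J.subset_univ)]
    simp only [opMonomial_shift]
  · intro i j
    have hcancel : (MvPolynomial.C h⁻¹ * MvPolynomial.C h : MvPolynomial (Fin n) ℂ) = 1 := by
      rw [← MvPolynomial.C_mul, inv_mul_cancel₀ hh, MvPolynomial.C_1]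
    rw [symbolAt_lax_sub, divDiffSymbol]
    simp only [MvPolynomial.C_sub, MvPolynomial.C_mul, MvPolynomial.C_add, MvPolynomial.C_1]
    linear_combination (-MvPolynomial.C t * MvPolynomial.C (if i = j then 1 else 0)) * hcancel

theorem tendsto_normalDet_lax {τ : ℂ} (hτ : 0 < τ.im) (c : ℂ) {u : ℂ} (hu : theta τ u ≠ 0)
    (e : Fin n → S) {f : S → ℂ} {x : S} (hf : HolAt f x) (hx : IsRegular τ x.1) (t : ℂ) :
    Tendsto (fun h : ℂ => normalDet (shift e h)
        (h⁻¹ • (lax S τ c u h - (1 + h * t) • 1)) f x) (𝓝[≠] 0)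
      (𝓝 (normalDet (pd e) (laxDeriv S τ c u - t • 1) f x)) := by
  have hcoeff : ∀ i j, Tendsto (fun h => laxCoeff τ c u h i j x) (𝓝[≠] 0)
      (𝓝 (if i = j then 1 else 0)) := by
    intro i j
    rw [← laxCoeff_zero hu hx i j]
    exact (differentiable_laxCoeff hτ c u i j x 0).continuousAt.tendsto.mono_left nhdsWithin_le_nhds
  have hslope : ∀ i j, Tendsto
      (fun h => h⁻¹ * (laxCoeff τ c u h i j x - if i = j then 1 else 0)) (𝓝[≠] 0)
      (𝓝 (laxSlope τ c u x i j)) := by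
    intro i j
    refine (hasDerivAt_iff_tendsto_slope.mp (hasDerivAt_laxCoeff hτ c u i j x)).congr fun h => ?_
    rw [slope_def_field, laxCoeff_zero hu hx, sub_zero, div_eq_inv_mul]
  rw [normalDet_laxDeriv]
  refine Tendsto.congr' ?_ (tendsto_finsetSum _ fun J _ =>
    (tendsto_rowMix J hcoeff fun i j => (hslope i j).sub_const _).mul
      (tendsto_divDiffs hf e (List.finRange n) J))
  filter_upwards [self_mem_nhdsWithin] with h hh
  rw [normalDet_lax_eq_sum_divDiffs e τ c u t hh]

end Lax

/-! ### The generating function of the operators `D_d` -/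

section CharacteristicPolynomial

variable {ι R : Type*} [Fintype ι] [DecidableEq ι] [CommRing R]

theorem natDegree_det_map_C_sub_X_smul_one_le (M : Matrix ι ι R) :
    (M.map Polynomial.C - (Polynomial.X : Polynomial R) • 1).det.natDegree ≤ Fintype.card ι := by
  have hneg : M.map Polynomial.C - (Polynomial.X : Polynomial R) • 1 =
      (Polynomial.X : Polynomial R) • (-1 : Matrix ι ι R).map Polynomial.C +
        M.map Polynomial.C := by
    ext1 i j
    rcases eq_or_ne i j with rfl | hij
    · simp [sub_eq_neg_add]
    · simp [hij]
  rw [hneg]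
  exact Polynomial.natDegree_det_X_add_C_le (-1) M

theorem det_sub_smul_one_eq_sum (M : Matrix ι ι R) (t : R) :
    (M - t • 1).det = ∑ k ∈ Finset.range (Fintype.card ι + 1),
      (M.map Polynomial.C - (Polynomial.X : Polynomial R) • 1).det.coeff k * t ^ k := by
  rw [← Polynomial.eval_eq_sum_range'
      (Nat.lt_succ_of_le (natDegree_det_map_C_sub_X_smul_one_le M)),
    ← Polynomial.coe_evalRingHom, RingHom.map_det]
  congr 1
  ext1 i j
  by_cases hij : i = j <;> simp [hij]

theorem eq_of_forall_sum_neg_pow_mul_eq [IsDomain R] [Infinite R] {n : ℕ} {a b : ℕ → R}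
    (h : ∀ t : R, ∑ d ∈ Finset.range (n + 1), (-t) ^ (n - d) * a d =
      ∑ d ∈ Finset.range (n + 1), (-t) ^ (n - d) * b d) {d : ℕ} (hd : d ≤ n) : a d = b d := by
  have hpoly : (∑ d ∈ Finset.range (n + 1), Polynomial.monomial (n - d) (a d)) =
      ∑ d ∈ Finset.range (n + 1), Polynomial.monomial (n - d) (b d) := by
    refine Polynomial.funext fun t => ?_
    simpa only [Polynomial.eval_finsetSum, Polynomial.eval_monomial, neg_neg, mul_comm]
      using h (-t)
  have hcoeff : ∀ a : ℕ → R, (∑ d ∈ Finset.range (n + 1),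
      Polynomial.monomial (n - d) (a d)).coeff (n - d) = a d := by
    intro a
    rw [Polynomial.finsetSum_coeff, Finset.sum_eq_single_of_mem d (Finset.mem_range.mpr (by lia)),
      Polynomial.coeff_monomial, if_pos rfl]
    intro k hk hkd
    have hkn := Finset.mem_range.mp hk
    rw [Polynomial.coeff_monomial, if_neg (by lia)]
  rw [← hcoeff a, hpoly, hcoeff b]

end CharacteristicPolynomial

section GeneratingFunction

variable {n : ℕ} {S : Submodule ℂ (Fin n → ℂ)}

theorem normalDet_eq_sum_diffOp (e : Fin n → S) (τ c u t : ℂ) (f : S → ℂ) (x : S) :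
    normalDet (pd e) (laxDeriv S τ c u - t • 1) f x =
      ∑ d ∈ Finset.range (n + 1), (-t) ^ (n - d) * diffOp e τ c u d f x := by
  have hscalar : laxDeriv S τ c u - t • 1 =
      laxDeriv S τ c u - (MvPolynomial.C fun _ : S => t : OpSymbol S) • 1 := by
    ext1 i j
    rw [Matrix.sub_apply, Matrix.sub_apply, Matrix.smul_apply, Matrix.smul_apply, smul_opSymbol,
      smul_eq_mul]
  rw [normalDet, normalOp_eq_monomialFunctional, hscalar, det_sub_smul_one_eq_sum, map_sum,
    map_sum, ← Finset.sum_range_reflect, Fintype.card_fin]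
  refine Finset.sum_congr rfl fun d _ => ?_
  rw [diffOp, normalOp_eq_monomialFunctional, show n + 1 - 1 - d = n - d by lia,
    map_mul (symbolAt x), map_mul (symbolAt x), map_pow (symbolAt x), map_pow (symbolAt x),
    symbolAt_C, map_neg (symbolAt x), map_one (symbolAt x), mul_comm, ← MvPolynomial.C_pow,
    monomialFunctional_C_mul, ← MvPolynomial.C_1, ← MvPolynomial.C_neg, ← MvPolynomial.C_pow,
    monomialFunctional_C_mul, ← mul_assoc, ← mul_pow, mul_neg_one, neg_neg]

theorem rowMix_lax {τ : ℂ} (hτ : 0 < τ.im) {c u h : ℂ} (hu : theta τ u ≠ 0) {x : S}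
    (hx : IsRegular τ x.1) (huh : ∀ k ≤ n, theta τ (u + k * (c * h / n)) ≠ 0)
    (hxh : ∀ i j, i ≠ j → theta τ (x.1 i - x.1 j + c * h / n) ≠ 0)
    {e : Fin n → S} (he : IsDirections e) (J : Finset (Fin n)) :
    rowMix J (fun i j => laxCoeff τ c u h i j x) (fun i j => if i = j then 1 else 0) =
      theta τ (u + J.card * (c * h / n)) / theta τ u *
        (Delta S τ (x + h • ∑ i ∈ J, (-(c / n)) • e i) / Delta S τ x) := by
  set μ : Fin n → ℂ := fun i => x.1 i - c * h / n with hμ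
  have hμ_regular : IsRegular τ μ := by
    intro i j hij
    simpa only [hμ, sub_sub_sub_cancel_right] using hx hij
  have hsum : ∀ t : Finset (Fin n), ∑ i ∈ t, (x.1 i - μ i) = t.card * (c * h / n) := by
    intro t
    simp only [hμ, sub_sub_cancel, Finset.sum_const, nsmul_eq_mul]
  have hlagrange : rowMix J (fun i j => laxCoeff τ c u h i j x)
      (fun i j => if i = j then 1 else 0) =
        (Matrix.of fun i j => lagrange τ u x.1 j (J.piecewise μ x.1 i)).det := by
    rw [rowMix]
    congr 1
    ext i j
    by_cases hi : i ∈ J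
    · simp [hi, laxCoeff_eq_lagrange, hμ]
    · simp [hi, lagrange_node hu hx]
  have hvandermonde : thetaVandermonde τ (J.piecewise μ x.1) / thetaVandermonde τ x.1 =
      Delta S τ (x + h • ∑ i ∈ J, (-(c / n)) • e i) / Delta S τ x := by
    rw [he.Delta_div_Delta τ _ _ hx]
    refine thetaVandermonde_div_eq_shiftCoeff hx J fun i j => ?_
    by_cases hi : i ∈ J <;> by_cases hj : j ∈ J <;> simp [hi, hj, hμ] <;> ring
  rw [hlagrange, det_lagrange hτ hμ_regular J u x.1 ?_ hx ?_,
    hsum, hvandermonde]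
  · intro t _
    rw [hsum]
    exact huh _ (by simpa using Finset.card_le_univ t)
  · intro i j hij
    rw [hμ, ← sub_add]
    exact hxh i j hij

/-- The function `(y, y', y'') ↦ θ(y) Δ(y') f(y'')`, whose shifts are the terms in the expansion of
the normally ordered determinant of the Lax matrix, up to the factor `θ(u) Δ(λ)`. -/
def generatingFun (S : Submodule ℂ (Fin n → ℂ)) (τ : ℂ) (f : S → ℂ) (p : ℂ × (S × S)) : ℂ :=
  theta τ p.1 * (Delta S τ p.2.1 * f p.2.2)

/-- The directions `(a, -a e_i, e_i)` in which `generatingFun` is shifted and differentiated; the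
Lax matrix corresponds to `a = c / n`. -/
def generatingDir (e : Fin n → S) (a : ℂ) (i : Fin n) : ℂ × (S × S) := (a, ((-a) • e i, e i))

theorem sum_generatingDir (e : Fin n → S) (a : ℂ) (J : Finset (Fin n)) :
    ∑ i ∈ J, generatingDir e a i = (J.card * a, (∑ i ∈ J, (-a) • e i, ∑ i ∈ J, e i)) := by
  simp only [generatingDir, Prod.ext_iff, Prod.fst_sum, Prod.snd_sum, Finset.sum_const,
    nsmul_eq_mul, and_self]

theorem normalDet_lax_eq_sum_rowMix (e : Fin n → S) (τ c u h t : ℂ) (f : S → ℂ) (x : S) :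
    normalDet (shift e h) (h⁻¹ • (lax S τ c u h - (1 + h * t) • 1)) f x =
      ∑ J : Finset (Fin n), h⁻¹ ^ J.card * (-(h⁻¹ * (1 + h * t))) ^ (n - J.card) *
        rowMix J (fun i j => laxCoeff τ c u h i j x) (fun i j => if i = j then 1 else 0) *
          f (x + h • ∑ i ∈ J, e i) := by
  rw [normalDet_eq_sum (shift e h) _ f x (Y := MvPolynomial.X)
    (a := fun i j => h⁻¹ * laxCoeff τ c u h i j x)
    (b := fun i j => -(h⁻¹ * (1 + h * t)) * if i = j then 1 else 0)]
  · refine Finset.sum_congr rfl fun J _ => ?_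
    rw [rowMix_mul, monomialFunctional_prod_X fun m => opMonomial (shift e h) m f x,
      opMonomial_shift, shiftValues_sum_single, Fintype.card_fin]
  · intro i j
    rw [symbolAt_lax_sub]
    simp only [MvPolynomial.C_neg, MvPolynomial.C_mul]
    ring

theorem sum_C_mul_prod_X_eq_sum_divDiffSymbol {ι : Type*} [Fintype ι] {h : ℂ}
    (hh : h ≠ 0) (t : ℂ) :
    ∑ J : Finset ι,
      MvPolynomial.C (h⁻¹ ^ J.card * (-(h⁻¹ * (1 + h * t))) ^ (Fintype.card ι - J.card)) *
        ∏ i ∈ J, MvPolynomial.X i =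
      ∑ J : Finset ι, MvPolynomial.C ((-t) ^ (Fintype.card ι - J.card)) *
        ∏ i ∈ J, divDiffSymbol h i := by
  classical
  have hfactor : ∀ i : ι, (MvPolynomial.C h⁻¹ * MvPolynomial.X i +
      MvPolynomial.C (-(h⁻¹ * (1 + h * t))) : MvPolynomial ι ℂ) =
        divDiffSymbol h i + MvPolynomial.C (-t) := by
    intro i
    have hconst : -(h⁻¹ * (1 + h * t)) = -h⁻¹ - t := by
      field_simp
      ring
    rw [hconst, divDiffSymbol, MvPolynomial.C_sub, MvPolynomial.C_neg, MvPolynomial.C_neg]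
    ring
  have hprod := Finset.prod_congr (rfl : (Finset.univ : Finset ι) = Finset.univ)
    fun i _ => hfactor i
  rw [Finset.prod_add, Finset.prod_add, Finset.powerset_univ] at hprod
  simp only [Finset.prod_mul_distrib, Finset.prod_const, ← Finset.compl_eq_univ_sdiff,
    Finset.card_compl] at hprod
  simp only [map_mul, map_pow]
  convert hprod using 2 <;> ring

theorem normalDet_lax_eq_sum_divDiffs_generatingFun {τ : ℂ} (hτ : 0 < τ.im) {c u h : ℂ}
    (hh : h ≠ 0) (hu : theta τ u ≠ 0) {x : S} (hx : IsRegular τ x.1)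
    (huh : ∀ k ≤ n, theta τ (u + k * (c * h / n)) ≠ 0)
    (hxh : ∀ i j, i ≠ j → theta τ (x.1 i - x.1 j + c * h / n) ≠ 0)
    {e : Fin n → S} (he : IsDirections e) (t : ℂ) (f : S → ℂ) :
    normalDet (shift e h) (h⁻¹ • (lax S τ c u h - (1 + h * t) • 1)) f x =
      (∑ J : Finset (Fin n), (-t) ^ (n - J.card) *
        divDiffs (generatingDir e (c / n)) (List.finRange n) J
          (fun p => generatingFun S τ f p.2) (h, (u, (x, x)))) / (theta τ u * Delta S τ x) := by
  have hsymbols := congrArg (monomialFunctional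
      (shiftValues (generatingFun S τ f) h (generatingDir e (c / n)) (u, (x, x))))
    (sum_C_mul_prod_X_eq_sum_divDiffSymbol hh t)
  simp only [map_sum, monomialFunctional_C_mul, Fintype.card_fin] at hsymbols
  simp only [divDiffs_eq_monomialFunctional hh _ _ (List.nodup_finRange n)
    (List.toFinset_finRange n ▸ Finset.subset_univ _)]
  rw [normalDet_lax_eq_sum_rowMix, ← hsymbols, Finset.sum_div]
  refine Finset.sum_congr rfl fun J _ => ?_
  rw [rowMix_lax hτ hu hx huh hxh he, monomialFunctional_prod_X, shiftValues_sum_single,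
    sum_generatingDir]
  simp only [generatingFun, Prod.smul_mk, Prod.mk_add_mk, smul_eq_mul]
  rw [show h * (J.card * (c / n)) = J.card * (c * h / n) by ring]
  ring

theorem HolAt.generatingFun {τ : ℂ} (hτ : 0 < τ.im) {f : S → ℂ} {x : S} (hf : HolAt f x) (u : ℂ) :
    HolAt (generatingFun S τ f) (u, (x, x)) := by
  have htheta : HolAt (theta τ) u := .of_forall (differentiable_theta hτ)
  exact (htheta.comp (g := fun p : ℂ × (S × S) => p.1) (x := (u, (x, x))) (by fun_prop)).mul
    (((holAt_Delta hτ x).comp (g := fun p : ℂ × (S × S) => p.2.1) (x := (u, (x, x)))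
      (by fun_prop)).mul
      (hf.comp (g := fun p : ℂ × (S × S) => p.2.2) (x := (u, (x, x))) (by fun_prop)))

theorem eventually_theta_add_mul_ne_zero {τ : ℂ} (hτ : 0 < τ.im) (c : ℂ) (n : ℕ) (k : ℂ) {b : ℂ}
    (hb : theta τ b ≠ 0) : ∀ᶠ h in 𝓝 (0 : ℂ), theta τ (b + k * (c * h / n)) ≠ 0 := by
  have hcont : ContinuousAt (fun h : ℂ => theta τ (b + k * (c * h / n))) 0 :=
    ((differentiable_theta hτ).continuous.comp (by fun_prop)).continuousAt
  exact hcont.eventually_ne (by simpa using hb)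

theorem normalDet_laxDeriv_eq_sum_dirDerivs_generatingFun {τ : ℂ} (hτ : 0 < τ.im) (c : ℂ) {u : ℂ}
    (hu : theta τ u ≠ 0) {e : Fin n → S} (he : IsDirections e) {f : S → ℂ} {x : S}
    (hf : HolAt f x) (hx : IsRegular τ x.1) (t : ℂ) :
    normalDet (pd e) (laxDeriv S τ c u - t • 1) f x =
      (∑ J : Finset (Fin n), (-t) ^ (n - J.card) * dirDerivs (generatingDir e (c / n))
        (List.finRange n) J (generatingFun S τ f) (u, (x, x))) / (theta τ u * Delta S τ x) := by
  refine tendsto_nhds_unique (tendsto_normalDet_lax hτ c hu e hf hx t) ?_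
  refine Tendsto.congr' ?_ (Tendsto.div_const (tendsto_finsetSum _ fun J _ =>
    (tendsto_divDiffs (hf.generatingFun hτ u) (generatingDir e (c / n)) (List.finRange n)
      J).const_mul _) _)
  have hpole : ∀ᶠ h in 𝓝 (0 : ℂ), ∀ k ∈ Finset.range (n + 1),
      theta τ (u + k * (c * h / n)) ≠ 0 :=
    (Filter.eventually_all_finset _).mpr fun k _ => eventually_theta_add_mul_ne_zero hτ c n k hu
  have hwall : ∀ᶠ h in 𝓝 (0 : ℂ), ∀ i j, i ≠ j → theta τ (x.1 i - x.1 j + c * h / n) ≠ 0 := by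
    simp only [Filter.eventually_all]
    intro i j hij
    simpa only [one_mul] using eventually_theta_add_mul_ne_zero hτ c n 1 (hx hij)
  filter_upwards [nhdsWithin_le_nhds hpole, nhdsWithin_le_nhds hwall, self_mem_nhdsWithin]
    with h hpole hwall hh
  rw [normalDet_lax_eq_sum_divDiffs_generatingFun hτ hh hu hx
    (fun k hk => hpole k (Finset.mem_range_succ_iff.mpr hk)) hwall he]

theorem diffOp_eq_sum_dirDerivs_generatingFun {τ : ℂ} (hτ : 0 < τ.im) (c : ℂ) {u : ℂ}
    (hu : theta τ u ≠ 0) {e : Fin n → S} (he : IsDirections e) {f : S → ℂ} {x : S}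
    (hf : HolAt f x) (hx : IsRegular τ x.1) {d : ℕ} (hd : d ≤ n) :
    diffOp e τ c u d f x =
      (∑ J ∈ Finset.univ.powersetCard d, dirDerivs (generatingDir e (c / n)) (List.finRange n) J
        (generatingFun S τ f) (u, (x, x))) / (theta τ u * Delta S τ x) := by
  refine eq_of_forall_sum_neg_pow_mul_eq (a := fun d => diffOp e τ c u d f x) (b := fun d =>
    (∑ J ∈ Finset.univ.powersetCard d, dirDerivs (generatingDir e (c / n)) (List.finRange n) J
        (generatingFun S τ f) (u, (x, x))) / (theta τ u * Delta S τ x)) (fun t => ?_) hd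
  rw [← normalDet_eq_sum_diffOp,
    normalDet_laxDeriv_eq_sum_dirDerivs_generatingFun hτ c hu he hf hx, ← Finset.powerset_univ,
    Finset.sum_powerset, Finset.card_univ, Fintype.card_fin, Finset.sum_div]
  refine Finset.sum_congr rfl fun k _ => ?_
  rw [← mul_div_assoc, Finset.mul_sum]
  congr 1
  refine Finset.sum_congr rfl fun J hJ => ?_
  rw [(Finset.mem_powersetCard.mp hJ).2]

end GeneratingFunction

/-! ### The explicit formulas -/

section ExplicitFormulas

variable {n : ℕ} {S : Submodule ℂ (Fin n → ℂ)}

theorem dirDerivs_generatingFun {τ : ℂ} (hτ : 0 < τ.im) (e : Fin n → S) (a u : ℂ) {f : S → ℂ}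
    {x : S} (hf : HolAt f x) (I : Finset (Fin n)) :
    dirDerivs (generatingDir e a) (List.finRange n) I (generatingFun S τ f) (u, (x, x)) =
      ∑ K ∈ I.powerset, a ^ K.card * iteratedDeriv K.card (theta τ) u *
        ∑ J ∈ (I \ K).powerset,
          dirDerivs (fun i => (-a) • e i) (List.finRange n) J (Delta S τ) x *
            dirDerivs e (List.finRange n) ((I \ K) \ J) f x := by
  have hsub : ∀ J : Finset (Fin n), J ⊆ (List.finRange n).toFinset := fun J =>
    List.toFinset_finRange n ▸ J.subset_univ
  have htheta : HolAt (theta τ) u := .of_forall (differentiable_theta hτ)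
  have hprod : HolAt (fun p : S × S => Delta S τ p.1 * f p.2) (x, x) :=
    ((holAt_Delta hτ x).comp (g := Prod.fst) (x := (x, x)) differentiable_fst).mul
      (hf.comp (g := Prod.snd) (x := (x, x)) differentiable_snd)
  refine (dirDerivs_mul htheta hprod (fun _ => a) (fun i => ((-a) • e i, e i))
    (List.nodup_finRange n) (hsub I)).self_of_nhds.trans (Finset.sum_congr rfl fun K _ => ?_)
  have hderiv_theta : dirDerivs (fun _ : Fin n => a) (List.finRange n) K (theta τ) u =
      a ^ K.card * iteratedDeriv K.card (theta τ) u := by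
    have hsmul := dirDerivs_smul (fun _ : Fin n => (1 : ℂ)) a (List.finRange n) K (theta τ)
    simp only [smul_eq_mul, mul_one] at hsmul
    rw [hsmul, dirDerivs_one, countP_mem_finRange]
  exact congrArg₂ (· * ·) hderiv_theta (dirDerivs_mul (holAt_Delta hτ x) hf
    (fun i => (-a) • e i) e (List.nodup_finRange n) (hsub (I \ K))).self_of_nhds

theorem diffOp_eq_sum_dirDerivs {τ : ℂ} (hτ : 0 < τ.im) (c : ℂ) {u : ℂ} (hu : theta τ u ≠ 0)
    {e : Fin n → S} (he : IsDirections e) {f : S → ℂ} {x : S} (hf : HolAt f x)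
    (hx : IsRegular τ x.1) {d : ℕ} (hd : d ≤ n) :
    diffOp e τ c u d f x =
      (∑ I ∈ Finset.univ.powersetCard d, ∑ K ∈ I.powerset,
        (c / n) ^ K.card * iteratedDeriv K.card (theta τ) u * ∑ J ∈ (I \ K).powerset,
          dirDerivs (fun i => (-(c / n)) • e i) (List.finRange n) J (Delta S τ) x *
            dirDerivs e (List.finRange n) ((I \ K) \ J) f x) / (theta τ u * Delta S τ x) := by
  rw [diffOp_eq_sum_dirDerivs_generatingFun hτ c hu he hf hx hd]
  congr 1
  exact Finset.sum_congr rfl fun I _ => dirDerivs_generatingFun hτ e (c / n) u hf I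

theorem diffOp_eq_sum_calogeroMoserOp {τ : ℂ} (hτ : 0 < τ.im) (c : ℂ) {u : ℂ} (hu : theta τ u ≠ 0)
    {e : Fin n → S} (he : IsDirections e) {f : S → ℂ} {x : S} (hf : HolAt f x)
    (hx : IsRegular τ x.1) {d : ℕ} (hd : d ≤ n) :
    diffOp e τ c u d f x = ∑ k ∈ Finset.range (d + 1), ((n - d + k).choose k : ℂ) *
      ((c / n) ^ k * iteratedDeriv k (theta τ) u / theta τ u) *
        calogeroMoserOp e τ (-(c / n)) (d - k) f x := by
  rw [diffOp_eq_sum_dirDerivs hτ c hu he hf hx hd,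
    sum_powersetCard_sum_sdiff (hd.trans_eq (Fintype.card_fin n).symm)
      (fun k => (c / n) ^ k * iteratedDeriv k (theta τ) u) fun I => ∑ J ∈ I.powerset,
        dirDerivs (fun i => (-(c / n)) • e i) (List.finRange n) J (Delta S τ) x *
          dirDerivs e (List.finRange n) (I \ J) f x, Finset.sum_div, Fintype.card_fin]
  refine Finset.sum_congr rfl fun k _ => ?_
  rw [calogeroMoserOp, mul_div_mul_comm, mul_div_assoc]

theorem neg_pow_add_mul_neg_inv_pow {K : Type*} [Field K] {a : K} (ha : a ≠ 0) (k j l : ℕ) :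
    (-a) ^ (k + (j + l)) * (-1) ^ k * (-a⁻¹) ^ l = a ^ k * (-a) ^ j := by
  have hcancel : (-a) ^ l * (-a⁻¹) ^ l = 1 := by
    rw [← mul_pow, neg_mul_neg, mul_inv_cancel₀ ha, one_pow]
  have hsign : (-a) ^ k * (-1) ^ k = a ^ k := by
    rw [← mul_pow, mul_neg_one, neg_neg]
  rw [pow_add, pow_add, ← hsign]
  linear_combination ((-a) ^ k * (-1) ^ k * (-a) ^ j) * hcancel

theorem diffOp_eq_sum_sum {τ : ℂ} (hτ : 0 < τ.im) {c : ℂ} (hc : c / n ≠ 0) {u : ℂ}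
    (hu : theta τ u ≠ 0) {e : Fin n → S} (he : IsDirections e) {f : S → ℂ} {x : S} (hf : HolAt f x)
    (hx : IsRegular τ x.1) {d : ℕ} (hd : d ≤ n) :
    diffOp e τ c u d f x = (-(c / n)) ^ d * ∑ I ∈ Finset.univ.powersetCard d,
      ∑ J' ∈ I.powerset, ∑ J'' ∈ (I \ J').powerset,
        (-1) ^ J'.card * (iteratedDeriv J'.card (theta τ) u / theta τ u) *
          (opProd (pd e) J'' (Delta S τ) x / Delta S τ x) *
            opProd (fun i g => (-(n / c)) • pd e i g) (I \ (J' ∪ J'')) f x := by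
  rw [diffOp_eq_sum_dirDerivs hτ c hu he hf hx hd, Finset.sum_div, Finset.mul_sum]
  refine Finset.sum_congr rfl fun I hI => ?_
  rw [Finset.sum_div, Finset.mul_sum]
  refine Finset.sum_congr rfl fun K hK => ?_
  rw [Finset.mul_sum, Finset.sum_div, Finset.mul_sum]
  refine Finset.sum_congr rfl fun J hJ => ?_
  have hcard : d = K.card + (J.card + ((I \ K) \ J).card) := by
    rw [add_comm J.card, Finset.card_sdiff_add_card_eq_card (Finset.mem_powerset.mp hJ), add_comm,
      Finset.card_sdiff_add_card_eq_card (Finset.mem_powerset.mp hK),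
      Finset.mem_powersetCard_univ.mp hI]
  have hpow := neg_pow_add_mul_neg_inv_pow hc K.card J.card ((I \ K) \ J).card
  rw [← hcard, inv_div] at hpow
  rw [← Finset.sup_eq_union, ← sdiff_sdiff_left, opProd_smul_pd, opProd_pd, dirDerivs_smul,
    countP_mem_finRange]
  simp only [div_eq_mul_inv, mul_inv] at hpow ⊢
  linear_combination (-(iteratedDeriv K.card (theta τ) u * (theta τ u)⁻¹ * (Delta S τ x)⁻¹ *
    dirDerivs e (List.finRange n) J (Delta S τ) x *
      dirDerivs e (List.finRange n) ((I \ K) \ J) f x)) * hpow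

theorem diffOp_eq_sum_choose {τ : ℂ} (hτ : 0 < τ.im) {c : ℂ} (hc : c / n ≠ 0) {u : ℂ}
    (hu : theta τ u ≠ 0) {e : Fin n → S} (he : IsDirections e) {f : S → ℂ} {x : S} (hf : HolAt f x)
    (hx : IsRegular τ x.1) {d : ℕ} (hd : d ≤ n) :
    diffOp e τ c u d f x = (-(c / n)) ^ d * ∑ k ∈ Finset.range (d + 1),
      (-1) ^ k * ((n - d + k).choose k : ℂ) * (iteratedDeriv k (theta τ) u / theta τ u) *
        ∑ I ∈ Finset.univ.powersetCard (d - k), ∑ J ∈ I.powerset,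
          (opProd (pd e) J (Delta S τ) x / Delta S τ x) *
            opProd (fun i g => (-(n / c)) • pd e i g) (I \ J) f x := by
  have hregroup := sum_powersetCard_sum_sdiff (hd.trans_eq (Fintype.card_fin n).symm)
    (fun k => (-1) ^ k * (iteratedDeriv k (theta τ) u / theta τ u)) fun I => ∑ J ∈ I.powerset,
      (opProd (pd e) J (Delta S τ) x / Delta S τ x) *
        opProd (fun i g => (-(n / c)) • pd e i g) (I \ J) f x
  rw [diffOp_eq_sum_sum hτ hc hu he hf hx hd]
  congr 1
  simp only [← Finset.sup_eq_union, ← sdiff_sdiff_left, mul_assoc, ← Finset.mul_sum,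
    Fintype.card_fin] at hregroup ⊢
  rw [hregroup]
  exact Finset.sum_congr rfl fun k _ => mul_left_comm _ _ _

end ExplicitFormulas

/-! ### Commutativity -/

section Commutativity

variable {n : ℕ} {S : Submodule ℂ (Fin n → ℂ)}

theorem calogeroMoserOp_sum (e : Fin n → S) (τ b : ℂ) (m : ℕ) {κ : Type*} {s : Finset κ}
    (a : κ → ℂ) {g : κ → S → ℂ} {x : S} (hg : ∀ k ∈ s, HolAt (g k) x) :
    calogeroMoserOp e τ b m (fun y => ∑ k ∈ s, a k * g k y) x =
      ∑ k ∈ s, a k * calogeroMoserOp e τ b m (g k) x := by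
  have hlinear : ∀ J, dirDerivs e (List.finRange n) J (fun y => ∑ k ∈ s, a k * g k y) x =
      ∑ k ∈ s, a k * dirDerivs e (List.finRange n) J (g k) x := by
    intro J
    rw [(dirDerivs_sum (fun k hk => (HolAt.const (a k) x).mul (hg k hk)) e _ J).self_of_nhds]
    simp only [dirDerivs_const_mul]
  simp only [calogeroMoserOp, hlinear, ← mul_div_assoc, ← Finset.sum_div, Finset.mul_sum]
  rw [Finset.sum_comm]
  congr 1
  refine Finset.sum_congr rfl fun I _ => ?_
  rw [Finset.sum_comm]
  exact Finset.sum_congr rfl fun J _ => Finset.sum_congr rfl fun k _ => mul_left_comm _ _ _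

theorem eventually_isRegular {τ : ℂ} (hτ : 0 < τ.im) {x : S} (hx : IsRegular τ x.1) :
    ∀ᶠ y : S in 𝓝 x, IsRegular τ y.1 := by
  unfold IsRegular Pairwise
  simp only [Filter.eventually_all]
  intro i j hij
  have hcoord : ∀ k, Continuous fun y : S => y.1 k := fun k =>
    (continuous_apply k).comp continuous_subtype_val
  exact ((differentiable_theta hτ).continuous.comp
    ((hcoord i).sub (hcoord j))).continuousAt.eventually_ne (hx hij)

theorem diffOp_diffOp {τ : ℂ} (hτ : 0 < τ.im) (c : ℂ) {u v : ℂ} (hu : theta τ u ≠ 0)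
    (hv : theta τ v ≠ 0) {e : Fin n → S} (he : IsDirections e) {f : S → ℂ} {x : S} (hf : HolAt f x)
    (hx : IsRegular τ x.1) {d d' : ℕ} (hd : d ≤ n) (hd' : d' ≤ n) :
    diffOp e τ c u d (diffOp e τ c v d' f) x =
      ∑ k ∈ Finset.range (d + 1), ∑ k' ∈ Finset.range (d' + 1),
        (((n - d + k).choose k : ℂ) * ((c / n) ^ k * iteratedDeriv k (theta τ) u / theta τ u)) *
        (((n - d' + k').choose k' : ℂ) *
          ((c / n) ^ k' * iteratedDeriv k' (theta τ) v / theta τ v)) *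
        calogeroMoserOp e τ (-(c / n)) (d - k) (calogeroMoserOp e τ (-(c / n)) (d' - k') f) x := by
  have hinner : diffOp e τ c v d' f =ᶠ[𝓝 x] fun y => ∑ k ∈ Finset.range (d' + 1),
      (((n - d' + k).choose k : ℂ) * ((c / n) ^ k * iteratedDeriv k (theta τ) v / theta τ v)) *
        calogeroMoserOp e τ (-(c / n)) (d' - k) f y := by
    filter_upwards [eventually_isRegular hτ hx, eventually_eventually_nhds.mpr hf] with y hy hfy
    exact diffOp_eq_sum_calogeroMoserOp hτ c hv he hfy hy hd'
  have hterm : ∀ k ∈ Finset.range (d' + 1),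
      HolAt (calogeroMoserOp e τ (-(c / n)) (d' - k) f) x := fun k _ =>
    hf.calogeroMoserOp hτ e _ _ (Delta_ne_zero hx)
  have hhol : HolAt (diffOp e τ c v d' f) x :=
    HolAt.congr (HolAt.sum fun k hk => (HolAt.const _ x).mul (hterm k hk)) hinner
  rw [diffOp_eq_sum_calogeroMoserOp hτ c hu he hhol hx hd]
  refine Finset.sum_congr rfl fun k _ => ?_
  rw [calogeroMoserOp_congr e τ _ _ hinner, calogeroMoserOp_sum e τ _ _ _ hterm, Finset.mul_sum]
  exact Finset.sum_congr rfl fun k' _ => (mul_assoc _ _ _).symm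

theorem diffOp_comm {τ : ℂ} (hτ : 0 < τ.im) (c : ℂ) {u v : ℂ} (hu : theta τ u ≠ 0)
    (hv : theta τ v ≠ 0) {e : Fin n → S} (he : IsDirections e) {f : S → ℂ} {x : S} (hf : HolAt f x)
    (hx : IsRegular τ x.1) {d d' : ℕ} (hd : d ≤ n) (hd' : d' ≤ n) :
    diffOp e τ c u d (diffOp e τ c v d' f) x = diffOp e τ c v d' (diffOp e τ c u d f) x := by
  rw [diffOp_diffOp hτ c hu hv he hf hx hd hd', diffOp_diffOp hτ c hv hu he hf hx hd' hd,
    Finset.sum_comm]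
  refine Finset.sum_congr rfl fun k' _ => Finset.sum_congr rfl fun k _ => ?_
  rw [he.calogeroMoserOp_comm hτ _ ((Nat.sub_le d k).trans hd) ((Nat.sub_le d' k').trans hd') hf hx,
    mul_comm (_ * _) (_ * (_ / theta τ v))]

end Commutativity

end EllipticCM

end

open EllipticCM Filter Topology in
theorem proposition4_general {n : ℕ} (hn : n ≠ 0) {S : Submodule ℂ (Fin n → ℂ)} {e : Fin n → S}
    (he : IsDirections e) {τ : ℂ} (hτ : 0 < τ.im) (c : ℂ) {u : ℂ} (hu : u ∉ lattice τ)
    {f : S → ℂ} {x : S} (hf : HolAt f x)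
    (hx : ∀ i j : Fin n, i ≠ j → x.1 i - x.1 j ∉ lattice τ) :
    (∀ i j : Fin n,
      HasDerivAt
        (fun h : ℂ => normalOp (shift e h) (lax S τ c u h i j) f x)
        (normalOp (pd e) (laxDeriv S τ c u i j) f x) 0) ∧
    (∀ t : ℂ,
      Tendsto
        (fun h : ℂ => normalDet (shift e h)
          (h⁻¹ • (lax S τ c u h - (1 + h * t) • 1)) f x)
        (𝓝[≠] 0)
        (𝓝 (normalDet (pd e) (laxDeriv S τ c u - t • 1) f x)) ∧
      normalDet (pd e) (laxDeriv S τ c u - t • 1) f x =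
        ∑ d ∈ Finset.range (n + 1), (-t) ^ (n - d) * diffOp e τ c u d f x) ∧
    (∀ v : ℂ, v ∉ lattice τ → ∀ d ≤ n, ∀ d' ≤ n,
      diffOp e τ c u d (diffOp e τ c v d' f) x =
        diffOp e τ c v d' (diffOp e τ c u d f) x) ∧
    (c ≠ 0 → ∀ d ≤ n,
      diffOp e τ c u d f x =
        (-(c / n)) ^ d *
          ∑ I ∈ Finset.univ.powersetCard d,
            ∑ J' ∈ I.powerset, ∑ J'' ∈ (I \ J').powerset,
              (-1) ^ J'.card * (iteratedDeriv J'.card (theta τ) u / theta τ u) *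
                (opProd (pd e) J'' (Delta S τ) x /
                  Delta S τ x) *
                opProd (fun i g => (-(n / c)) • pd e i g) (I \ (J' ∪ J'')) f x ∧
      diffOp e τ c u d f x =
        (-(c / n)) ^ d *
          ∑ k ∈ Finset.range (d + 1),
            (-1) ^ k * ((n - d + k).choose k : ℂ) *
              (iteratedDeriv k (theta τ) u / theta τ u) *
              ∑ I ∈ Finset.univ.powersetCard (d - k), ∑ J ∈ I.powerset,
                (opProd (pd e) J (Delta S τ) x /
                  Delta S τ x) *
                opProd (fun i g => (-(n / c)) • pd e i g) (I \ J) f x) := by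
  have hθu : theta τ u ≠ 0 := theta_ne_zero hτ hu
  have hreg : IsRegular τ x.1 := fun i j hij => theta_ne_zero hτ (hx i j hij)
  refine ⟨fun i j => hasDerivAt_normalOp_lax hτ c hθu e hf.self_of_nhds hreg i j,
    fun t => ⟨tendsto_normalDet_lax hτ c hθu e hf hreg t, normalDet_eq_sum_diffOp e τ c u t f x⟩,
    fun v hv d hd d' hd' => diffOp_comm hτ c hθu (theta_ne_zero hτ hv) he hf hreg hd hd',
    fun hc d hd => ?_⟩
  have hcn : c / n ≠ 0 := div_ne_zero hc (Nat.cast_ne_zero.mpr hn)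
  exact ⟨diffOp_eq_sum_sum hτ hcn hθu he hf hreg hd, diffOp_eq_sum_choose hτ hcn hθu he hf hreg hd⟩

open EllipticCM Filter Topology in
theorem proposition4 (n : ℕ) (hn : 2 ≤ n) (τ : ℂ) (hτ : 0 < τ.im) (c u : ℂ)
    (hu : u ∉ lattice τ) (r : Realization)
    (U : Set (r.space n)) (hU : IsOpen U) (f : r.space n → ℂ) (hf : DifferentiableOn ℂ f U)
    (x : r.space n) (hxU : x ∈ U)
    (hx : ∀ i j : Fin n, i ≠ j → x.1 i - x.1 j ∉ lattice τ) :
    -- `L̃'_0` is the derivative of `L̃_ħ` at `ħ = 0`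
    (∀ i j : Fin n,
      HasDerivAt
        (fun h : ℂ => normalOp (shift (r.dir n) h) (lax (r.space n) τ c u h i j) f x)
        (normalOp (pd (r.dir n)) (laxDeriv (r.space n) τ c u i j) f x) 0) ∧
    -- the differential limit, and the generating function of the `D_d`
    (∀ t : ℂ,
      Tendsto
        (fun h : ℂ => normalDet (shift (r.dir n) h)
          (h⁻¹ • (lax (r.space n) τ c u h - (1 + h * t) • 1)) f x)
        (𝓝[≠] 0)
        (𝓝 (normalDet (pd (r.dir n)) (laxDeriv (r.space n) τ c u - t • 1) f x)) ∧
      normalDet (pd (r.dir n)) (laxDeriv (r.space n) τ c u - t • 1) f x =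
        ∑ d ∈ Finset.range (n + 1), (-t) ^ (n - d) * diffOp (r.dir n) τ c u d f x) ∧
    -- commutativity
    (∀ v : ℂ, v ∉ lattice τ → ∀ d ≤ n, ∀ d' ≤ n,
      diffOp (r.dir n) τ c u d (diffOp (r.dir n) τ c v d' f) x =
        diffOp (r.dir n) τ c v d' (diffOp (r.dir n) τ c u d f) x) ∧
    -- the two explicit formulas
    (c ≠ 0 → ∀ d ≤ n,
      diffOp (r.dir n) τ c u d f x =
        (-(c / n)) ^ d *
          ∑ I ∈ Finset.univ.powersetCard d,
            ∑ J' ∈ I.powerset, ∑ J'' ∈ (I \ J').powerset,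
              (-1) ^ J'.card * (iteratedDeriv J'.card (theta τ) u / theta τ u) *
                (opProd (pd (r.dir n)) J'' (Delta (r.space n) τ) x /
                  Delta (r.space n) τ x) *
                opProd (fun i g => (-(n / c)) • pd (r.dir n) i g) (I \ (J' ∪ J'')) f x ∧
      diffOp (r.dir n) τ c u d f x =
        (-(c / n)) ^ d *
          ∑ k ∈ Finset.range (d + 1),
            (-1) ^ k * ((n - d + k).choose k : ℂ) *
              (iteratedDeriv k (theta τ) u / theta τ u) *
              ∑ I ∈ Finset.univ.powersetCard (d - k), ∑ J ∈ I.powerset,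
                (opProd (pd (r.dir n)) J (Delta (r.space n) τ) x /
                  Delta (r.space n) τ x) *
                opProd (fun i g => (-(n / c)) • pd (r.dir n) i g) (I \ J) f x) :=
  proposition4_general (by lia) r.isDirections_dir hτ c hu
    (hf.eventually_differentiableAt (hU.mem_nhds hxU)) hx
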